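/- Let $N\ge 1$, let $\Omega\subset\mathbb R^N$ be a bounded domain, let $D^*$ be a nonempty open set with $\overline{D^*}\subset\Omega$, and let $D^0$ be an open set with $\overline{D^0}\subset D^*$ (no regularity of the boundaries and no simple connectedness is needed). Let $a,b,A,B\in\mathbb R$ be constants such that, for some $\lambda$ with $0<\lambda<\mu_1(\Omega)^{-1}$, $$a\xi_1^2+(b+A)\xi_1\xi_2+B\xi_2^2\ \ge\ -\lambda(\xi_1^2+\xi_2^2)\qquad\forall(\xi_1,\xi_2)\in\mathbb R^2,$$ where $\mu_1(\Omega)$ is the smallest positive constant with $\|u\|_{L^2}^2\le\mu_1(\Omega)\|\nabla u\|_{L^2}^2$ for all $u\in H^1_0(\Omega)$. Let $\varphi_1,\psi_1\in H^1(\Omega)$ vanish a.e. in $\overline{D^*}$ (they are liftings of the boundary data $\varphi=\varphi_1|_{\partial\Omega}$, $\psi=\psi_1|_{\partial\Omega}$). Let $0<\epsilon<1$ and $$\mathcal W_\epsilon=\{\mu\in W^{1,\infty}(\mathbb R^N;\mathbb R^N):\ \|\mu\|_{W^{1,\infty}}\le\epsilon,\ \mu=0\text{ in }\Omega\setminus\overline{D^*}\},$$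 where $\|\mu\|_{W^{1,\infty}}=\max(\sup|\mu|,\operatorname{ess\,sup}|\mu'|)$, with the operator norm for the Jacobian matrix $\mu'$. For $\mu\in\mathcal W_\epsilon$ put $m=I+\mu$, $D^1=m(D^0)$, $\mathrm{Jac}(m)=|\det m'|$, $M=((m')^*)^{-1}$. Then: (i) For every $\mu\in\mathcal W_\epsilon$ there is exactly one $(u_1,v_1)\in H^1_0(\Omega\setminus\overline{D^1})^2$ such that, for all $(w,p)\in H^1_0(\Omega\setminus\overline{D^1})^2$, $$\int_{\Omega\setminus\overline{D^1}}(\nabla u_1\cdot\nabla w+\nabla v_1\cdot\nabla p)+\int_{\Omega\setminus\overline{D^1}}(au_1w+bv_1w+Au_1p+Bv_1p)=-\int_{\Omega\setminus\overline{D^1}}(\nabla\varphi_1\cdot\nabla w+\nabla\psi_1\cdot\nabla p)-\int_{\Omega\setminus\overline{D^1}}(a\varphi_1w+b\psi_1w+A\varphi_1p+B\psi_1p);$$ moreover $\varphi_1\circ m=\varphi_1$ and $\psi_1\circ m=\psi_1$ a.e. in $\Omega$. (ii) For every $\mu\in\mathcal W_\epsilon$ the transported pair $(u_0,v_0):=(u_1\circ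 m,\,v_1\circ m)$ belongs to $H^1_0(\Omega\setminus\overline{D^0})^2$ and is the only element of that space which satisfies $T(u_0,v_0)=(F_0,G_0)$ in $H^{-1}(\Omega\setminus\overline{D^0})^2$, where $$T(u,v)=\bigl(-\nabla\cdot(\mathrm{Jac}(m)M^*M\nabla u)+(au+bv)\mathrm{Jac}(m),\ -\nabla\cdot(\mathrm{Jac}(m)M^*M\nabla v)+(Au+Bv)\mathrm{Jac}(m)\bigr),$$ $$F_0=\nabla\cdot(\mathrm{Jac}(m)M^*M\nabla\varphi_1)-(a\varphi_1+b\psi_1)\mathrm{Jac}(m),\qquad G_0=\nabla\cdot(\mathrm{Jac}(m)M^*M\nabla\psi_1)-(A\varphi_1+B\psi_1)\mathrm{Jac}(m).$$ (iii) The mapping $\mu\mapsto(u_0,v_0)\in H^1_0(\Omega\setminus\overline{D^0})^2$ is (real) analytic in a neighbourhood of the origin in $\mathcal W_\epsilon$: there is $r\in(0,\epsilon]$ such that it is analytic on the ball $\|\mu\|<r$ of the normed space $\{\mu\in W^{1,\infty}(\mathbb R^N;\mathbb R^N):\mu=0\text{ in }\Omega\setminus\overline{D^*}\}$. -/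

import Mathlib

open MeasureTheory
open scoped ContDiff InnerProductSpace

noncomputable section

/-- The Euclidean space `ℝ^N`. -/
abbrev RN (N : ℕ) : Type := EuclideanSpace ℝ (Fin N)

/-- `θ ∈ C_c^∞(U)`. -/
structure IsTestFunction {N : ℕ} (U : Set (RN N)) (θ : RN N → ℝ) : Prop where
  contDiff : ContDiff ℝ ∞ θ
  hasCompactSupport : HasCompactSupport θ
  tsupport_subset : tsupport θ ⊆ U

/-- `g` is the weak (distributional) derivative of `f` in the open set `U`:
`∫_U (∂_v θ) f = - ∫_U θ (g v)` for every test function `θ` and every direction `v`. -/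
def HasWeakDeriv {N : ℕ} {F : Type*} [NormedAddCommGroup F] [NormedSpace ℝ F]
    (U : Set (RN N)) (f : RN N → F) (g : RN N → (RN N →L[ℝ] F)) : Prop :=
  ∀ θ : RN N → ℝ, IsTestFunction U θ → ∀ v : RN N,
    ∫ x in U, (fderiv ℝ θ x v) • f x = - ∫ x in U, θ x • g x v

section WeakDerivHelpers

variable {N : ℕ} {F : Type*} [NormedAddCommGroup F] [NormedSpace ℝ F] {U : Set (RN N)}

theorem IsTestFunction.integrable_fderiv_smul {θ : RN N → ℝ} (hθ : IsTestFunction U θ)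
    (v : RN N) {f : RN N → F} (hf : LocallyIntegrable f (volume.restrict U)) :
    Integrable (fun x => (fderiv ℝ θ x v) • f x) (volume.restrict U) := by
  refine hf.integrable_smul_left_of_hasCompactSupport ?_ ?_
  · exact (hθ.contDiff.continuous_fderiv (by simp)).clm_apply continuous_const
  · exact hθ.hasCompactSupport.fderiv_apply (𝕜 := ℝ) v

theorem IsTestFunction.integrable_smul_apply {θ : RN N → ℝ} (hθ : IsTestFunction U θ)
    (v : RN N) {g : RN N → (RN N →L[ℝ] F)} (hg : LocallyIntegrable g (volume.restrict U)) :
    Integrable (fun x => θ x • g x v) (volume.restrict U) := by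
  have h := hg.integrable_smul_left_of_hasCompactSupport hθ.contDiff.continuous
    hθ.hasCompactSupport
  exact h.apply_continuousLinearMap v

theorem HasWeakDeriv.congr {f₁ f₂ : RN N → F} {g₁ g₂ : RN N → (RN N →L[ℝ] F)}
    (h : HasWeakDeriv U f₁ g₁) (hf : f₂ =ᵐ[volume.restrict U] f₁)
    (hg : g₂ =ᵐ[volume.restrict U] g₁) : HasWeakDeriv U f₂ g₂ := by
  intro θ hθ v
  have e₁ : ∫ x in U, (fderiv ℝ θ x v) • f₂ x = ∫ x in U, (fderiv ℝ θ x v) • f₁ x :=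
    integral_congr_ae (by filter_upwards [hf] with x hx; rw [hx])
  have e₂ : ∫ x in U, θ x • g₂ x v = ∫ x in U, θ x • g₁ x v :=
    integral_congr_ae (by filter_upwards [hg] with x hx; rw [hx])
  rw [e₁, e₂, h θ hθ v]

theorem HasWeakDeriv.add {f₁ f₂ : RN N → F} {g₁ g₂ : RN N → (RN N →L[ℝ] F)}
    (h₁ : HasWeakDeriv U f₁ g₁) (h₂ : HasWeakDeriv U f₂ g₂)
    (hf₁ : LocallyIntegrable f₁ (volume.restrict U))
    (hf₂ : LocallyIntegrable f₂ (volume.restrict U))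
    (hg₁ : LocallyIntegrable g₁ (volume.restrict U))
    (hg₂ : LocallyIntegrable g₂ (volume.restrict U)) :
    HasWeakDeriv U (fun x => f₁ x + f₂ x) (fun x => g₁ x + g₂ x) := by
  intro θ hθ v
  simp only [smul_add, _root_.add_apply]
  rw [integral_add (hθ.integrable_fderiv_smul v hf₁) (hθ.integrable_fderiv_smul v hf₂),
    integral_add (hθ.integrable_smul_apply v hg₁) (hθ.integrable_smul_apply v hg₂),
    h₁ θ hθ v, h₂ θ hθ v, neg_add]

theorem HasWeakDeriv.const_smul (c : ℝ) {f : RN N → F} {g : RN N → (RN N →L[ℝ] F)}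
    (h : HasWeakDeriv U f g) : HasWeakDeriv U (fun x => c • f x) (fun x => c • g x) := by
  intro θ hθ v
  have e₁ : ∀ x, (fderiv ℝ θ x v) • c • f x = c • (fderiv ℝ θ x v) • f x :=
    fun x => smul_comm _ _ _
  have e₂ : ∀ x, θ x • (c • g x) v = c • θ x • g x v := fun x => by
    rw [_root_.smul_apply, smul_comm]
  simp only [e₁, e₂]
  rw [integral_smul, integral_smul, h θ hθ v, smul_neg]

theorem HasWeakDeriv.zero : HasWeakDeriv U (fun _ => (0 : F)) (fun _ => 0) := by
  intro θ hθ v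
  simp

end WeakDerivHelpers

/-- The Hilbert space `L²(U) × L²(U; ℝ^N)`, in which a Sobolev function `u` is recorded together
with its weak gradient as the pair `(u, ∇u)`; the norm is then the usual `H¹` norm. -/
abbrev L2Pair {N : ℕ} (U : Set (RN N)) : Type :=
  WithLp 2 (Lp ℝ 2 (volume.restrict U) × Lp (RN N) 2 (volume.restrict U))

/-- The function `u` of a pair `(u, ∇u)`. -/
def L2Pair.fn {N : ℕ} {U : Set (RN N)} (p : L2Pair U) : RN N → ℝ := p.fst

/-- The gradient `∇u` of a pair `(u, ∇u)`. -/
def L2Pair.grad {N : ℕ} {U : Set (RN N)} (p : L2Pair U) : RN N → RN N := p.snd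

/-- `H¹(U)`: the pairs `(u, ∇u)`, where `u ∈ L²(U)` has the weak gradient `∇u ∈ L²(U; ℝ^N)`. -/
def H1 {N : ℕ} (U : Set (RN N)) : Submodule ℝ (L2Pair U) where
  carrier := {p | HasWeakDeriv U p.fn (fun x => innerSL ℝ (p.grad x))}
  zero_mem' := by
    refine HasWeakDeriv.zero.congr (Lp.coeFn_zero ℝ 2 _) ?_
    filter_upwards [Lp.coeFn_zero (RN N) 2 (volume.restrict U)] with x hx
    have hx' : (0 : L2Pair U).grad x = 0 := hx
    rw [hx', map_zero]
  add_mem' := by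
    intro p q hp hq
    have key := fun r : L2Pair U => (Lp.memLp r.fst).locallyIntegrable (by norm_num)
    have key' : ∀ r : L2Pair U,
        LocallyIntegrable (fun x => innerSL ℝ (r.grad x)) (volume.restrict U) := fun r => by
      refine MemLp.locallyIntegrable (p := 2) ?_ (by norm_num)
      exact (innerSL ℝ).comp_memLp' (Lp.memLp r.snd)
    refine (HasWeakDeriv.add hp hq (key p) (key q) (key' p) (key' q)).congr
      (Lp.coeFn_add p.fst q.fst) ?_
    filter_upwards [Lp.coeFn_add p.snd q.snd] with x hx
    have hx' : (p + q).grad x = p.grad x + q.grad x := hx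
    rw [hx', map_add]
  smul_mem' := by
    intro c p hp
    refine (HasWeakDeriv.const_smul c hp).congr (Lp.coeFn_smul c p.fst) ?_
    filter_upwards [Lp.coeFn_smul c p.snd] with x hx
    have hx' : (c • p).grad x = c • p.grad x := hx
    rw [hx', map_smul]

/-- `H¹₀(U)`: the closure of `C_c^∞(U)` in the `H¹` norm. -/
def H10 {N : ℕ} (U : Set (RN N)) : Submodule ℝ (L2Pair U) :=
  (Submodule.span ℝ {p : L2Pair U | ∃ θ : RN N → ℝ, IsTestFunction U θ ∧
    p.fn =ᵐ[volume.restrict U] θ ∧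
    p.grad =ᵐ[volume.restrict U] fun x => gradient θ x}).topologicalClosure

/-- The Banach space `C_b(ℝ^N; ℝ^N) × L^∞(ℝ^N; ℝ^{N×N})`, with the norm
`max (sup |f|) (ess sup |g|)`, where `|g|` is the operator norm. -/
abbrev LinfPair (N : ℕ) : Type :=
  BoundedContinuousFunction (RN N) (RN N) × Lp (RN N →L[ℝ] RN N) ⊤ (volume : Measure (RN N))

/-- `W^{1,∞}(ℝ^N; ℝ^N)`: the pairs `(μ, μ')`, where `μ` is the (bounded, continuous)
representative and `μ' ∈ L^∞` its weak Jacobian matrix.  The norm is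
`max (sup |μ|) (ess sup |μ'|)`, with the operator norm for `μ'`. -/
def W1inf (N : ℕ) :
    Submodule ℝ (LinfPair N) where
  carrier := {p | HasWeakDeriv Set.univ p.1 p.2}
  zero_mem' := by
    refine HasWeakDeriv.zero.congr (Filter.EventuallyEq.refl _ _) ?_
    rw [Measure.restrict_univ]
    exact Lp.coeFn_zero _ _ _
  add_mem' := by
    intro p q hp hq
    have h₁ : ∀ r : BoundedContinuousFunction (RN N) (RN N),
        LocallyIntegrable r (volume.restrict Set.univ) :=
      fun r => r.continuous.locallyIntegrable
    have h₂ : ∀ r : Lp (RN N →L[ℝ] RN N) ⊤ (volume : Measure (RN N)),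
        LocallyIntegrable r (volume.restrict Set.univ) := fun r => by
      rw [Measure.restrict_univ]
      exact (Lp.memLp r).locallyIntegrable le_top
    refine (HasWeakDeriv.add hp hq (h₁ _) (h₁ _) (h₂ _) (h₂ _)).congr
      (Filter.EventuallyEq.refl _ _) ?_
    rw [Measure.restrict_univ]
    exact Lp.coeFn_add p.2 q.2
  smul_mem' := by
    intro c p hp
    refine (HasWeakDeriv.const_smul c hp).congr (Filter.EventuallyEq.refl _ _) ?_
    rw [Measure.restrict_univ]
    exact Lp.coeFn_smul c p.2

/-- The fields `μ ∈ W^{1,∞}(ℝ^N; ℝ^N)` with `μ = 0` in `Ω ∖ closure Dstar`. -/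
def WZero {N : ℕ} (Ω Dstar : Set (RN N)) : Submodule ℝ (LinfPair N) where
  carrier := {μ | μ ∈ W1inf N ∧ ∀ x ∈ Ω \ closure Dstar, μ.1 x = 0}
  zero_mem' := ⟨(W1inf N).zero_mem, fun _ _ => rfl⟩
  add_mem' := by
    rintro μ ν ⟨hμ, hμ0⟩ ⟨hν, hν0⟩
    refine ⟨(W1inf N).add_mem hμ hν, fun x hx => ?_⟩
    have h : (μ + ν).1 x = μ.1 x + ν.1 x := rfl
    rw [h, hμ0 x hx, hν0 x hx, add_zero]
  smul_mem' := by
    rintro c μ ⟨hμ, hμ0⟩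
    refine ⟨(W1inf N).smul_mem c hμ, fun x hx => ?_⟩
    have h : (c • μ).1 x = c • μ.1 x := rfl
    rw [h, hμ0 x hx, smul_zero]

/-- `𝒲_ε = {μ ∈ W^{1,∞}(ℝ^N; ℝ^N) : ‖μ‖ ≤ ε, μ = 0 in Ω ∖ closure Dstar}`. -/
def WEps {N : ℕ} (Ω Dstar : Set (RN N)) (ε : ℝ) : Set (WZero Ω Dstar) := {μ | ‖μ‖ ≤ ε}

section Deformation

variable {N : ℕ} {Ω Dstar : Set (RN N)}

/-- The deformation `m = I + μ`. -/
def defMap (μ : WZero Ω Dstar) (x : RN N) : RN N := x + μ.1.1 x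

/-- The Jacobian matrix `m' = I + μ'`, defined almost everywhere. -/
def defDeriv (μ : WZero Ω Dstar) (x : RN N) : RN N →L[ℝ] RN N :=
  ContinuousLinearMap.id ℝ (RN N) + μ.1.2 x

/-- `Jac(m) = |det m'|`. -/
def defJac (μ : WZero Ω Dstar) (x : RN N) : ℝ := |(defDeriv μ x).det|

/-- `M = ((m')^*)⁻¹`. -/
def defM (μ : WZero Ω Dstar) (x : RN N) : RN N →L[ℝ] RN N :=
  (ContinuousLinearMap.adjoint (defDeriv μ x)).inverse

end Deformation

/-- The smallest constant `μ₁(Ω) > 0` with `‖u‖² ≤ μ₁(Ω) ‖∇u‖²` for all `u ∈ H¹₀(Ω)`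
(norms of `L²(Ω)`). -/
def poincareConst {N : ℕ} (Ω : Set (RN N)) : ℝ :=
  sInf {C : ℝ | 0 < C ∧ ∀ u ∈ H10 Ω,
    ∫ x in Ω, u.fn x ^ 2 ≤ C * ∫ x in Ω, ‖u.grad x‖ ^ 2}

/-- `(a, b, A, B) ∈ 𝒜`, for constant coefficients. -/
def AdmissibleCoeffs {N : ℕ} (Ω : Set (RN N)) (a b A B : ℝ) : Prop :=
  ∃ lam : ℝ, 0 < lam ∧ lam < (poincareConst Ω)⁻¹ ∧
    ∀ ξ₁ ξ₂ : ℝ, -lam * (ξ₁ ^ 2 + ξ₂ ^ 2) ≤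
      a * ξ₁ * ξ₁ + b * ξ₁ * ξ₂ + A * ξ₂ * ξ₁ + B * ξ₂ * ξ₂

/-- `(u₁, v₁) ∈ H¹₀(U)²` is the weak solution of
`-Δu₁ + a u₁ + b v₁ = F₁`, `-Δv₁ + A u₁ + B v₁ = G₁` in `U`, `u₁ = v₁ = 0` on `∂U`, where
`F₁ = Δφ₁ - a φ₁ - b ψ₁` and `G₁ = Δψ₁ - A φ₁ - B ψ₁` and `φ₁, ψ₁ ∈ H¹(Ω)`, `U ⊆ Ω`.
That is, `(u₁ + φ₁, v₁ + ψ₁)` solves the homogeneous system in `U` with the boundary values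
of `(φ₁, ψ₁)` on `∂U`. -/
def IsWeakSolution {N : ℕ} {Ω : Set (RN N)} (a b A B : ℝ) (φ₁ ψ₁ : H1 Ω) (U : Set (RN N))
    (w₁ : H10 U × H10 U) : Prop :=
  ∀ w p : H10 U,
    (∫ x in U, (⟪w₁.1.1.grad x, w.1.grad x⟫_ℝ + ⟪w₁.2.1.grad x, p.1.grad x⟫_ℝ))
      + (∫ x in U, (a * w₁.1.1.fn x * w.1.fn x + b * w₁.2.1.fn x * w.1.fn x
          + A * w₁.1.1.fn x * p.1.fn x + B * w₁.2.1.fn x * p.1.fn x))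
    = - (∫ x in U, (⟪φ₁.1.grad x, w.1.grad x⟫_ℝ + ⟪ψ₁.1.grad x, p.1.grad x⟫_ℝ))
      - (∫ x in U, (a * φ₁.1.fn x * w.1.fn x + b * ψ₁.1.fn x * w.1.fn x
          + A * φ₁.1.fn x * p.1.fn x + B * ψ₁.1.fn x * p.1.fn x))

/-- The pair `(f, g)` of Sobolev functions on `U'` is transported to the pair `(f ∘ m, g ∘ m)`
of Sobolev functions on `U`. -/
def IsTransport {N : ℕ} {Ω Dstar : Set (RN N)} (μ : WZero Ω Dstar) {U U' : Set (RN N)}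
    (w₁ : H10 U' × H10 U') (w₀ : H10 U × H10 U) : Prop :=
  (w₀.1.1.fn =ᵐ[volume.restrict U] fun x => w₁.1.1.fn (defMap μ x)) ∧
  (w₀.2.1.fn =ᵐ[volume.restrict U] fun x => w₁.2.1.fn (defMap μ x))

/-- The transported operator `T`, in weak form: the value `⟨T(u, v), (z, q)⟩` of the functional
`T(u, v) = (-∇·(Jac(m) M^* M ∇u) + (a u + b v) Jac(m), -∇·(Jac(m) M^* M ∇v) + (A u + B v) Jac(m))`
in `H⁻¹(U)²` at `(z, q) ∈ H¹₀(U)²`. -/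
def transportedT {N : ℕ} {Ω Dstar : Set (RN N)} (a b A B : ℝ) (μ : WZero Ω Dstar)
    (U : Set (RN N)) (w₀ : H10 U × H10 U) (t : H10 U × H10 U) : ℝ :=
  (∫ x in U, (⟪defM μ x (w₀.1.1.grad x), defM μ x (t.1.1.grad x)⟫_ℝ
      + ⟪defM μ x (w₀.2.1.grad x), defM μ x (t.2.1.grad x)⟫_ℝ) * defJac μ x)
  + (∫ x in U, (a * w₀.1.1.fn x * t.1.1.fn x + b * w₀.2.1.fn x * t.1.1.fn x
      + A * w₀.1.1.fn x * t.2.1.fn x + B * w₀.2.1.fn x * t.2.1.fn x) * defJac μ x)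

/-- The transported right-hand side `(F₀, G₀) ∈ H⁻¹(U)²`, in weak form:
`F₀ = ∇·(Jac(m) M^* M ∇φ₀) - (a φ₀ + b ψ₀) Jac(m)` and
`G₀ = ∇·(Jac(m) M^* M ∇ψ₀) - (A φ₀ + B ψ₀) Jac(m)`. -/
def transportedRHS {N : ℕ} {Ω Dstar : Set (RN N)} (a b A B : ℝ) (μ : WZero Ω Dstar)
    (φ₀ ψ₀ : H1 Ω) (U : Set (RN N)) (t : H10 U × H10 U) : ℝ :=
  - (∫ x in U, (⟪defM μ x (φ₀.1.grad x), defM μ x (t.1.1.grad x)⟫_ℝ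
      + ⟪defM μ x (ψ₀.1.grad x), defM μ x (t.2.1.grad x)⟫_ℝ) * defJac μ x)
  - (∫ x in U, (a * φ₀.1.fn x * t.1.1.fn x + b * ψ₀.1.fn x * t.1.1.fn x
      + A * φ₀.1.fn x * t.2.1.fn x + B * ψ₀.1.fn x * t.2.1.fn x) * defJac μ x)

end

/-! The deformation `m = I + μ` with `‖μ‖ < 1` pulls everything back to a fixed domain.
Mollification shows that a `W^{1,∞}` field is Lipschitz with constant at most `‖μ‖` and has `μ'` as
its derivative almost everywhere, so `m` is a bi-Lipschitz homeomorphism of `ℝ^N` (`WZero.homeo`).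
Since `μ` vanishes on the frontier of `closure Dstar`, a segment argument shows that `m` preserves
`closure Dstar`, hence `Ω`, and carries `Ω \ closure D₀` onto `Ω \ closure (m D₀)`.

The pullback `(u, ∇u) ↦ (u ∘ m, (m')^* (∇u ∘ m))` is then a bijection between the `H¹₀` spaces of
the two domains, and the change of variables turns the system on the deformed domain into the
transported one (`isWeakSolution_iff_transportedT`). The liftings do not change, because they vanish
where `m` moves points of `Ω`.

Existence and uniqueness are Lax–Milgram on the deformed domain. The Poincaré inequality passes to
subdomains through extension by zero, and `λ C < 1` makes the form coercive
(`AdmissibleCoeffs.systemCoercive`). The transported problem inherits well-posedness through the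
bijection.

For analyticity, the transported coefficients depend on `μ` only through `μ' ∈ L^∞`. As operators on
`L²`, multiplication by `det m'` is a polynomial in `μ'`, the determinant being positive, and
multiplication by `Jac(m) M^* M` is a product of that operator with two inverses in a Banach
algebra. The equation therefore reads `R(μ') w = r(μ')` with `R`, `r` analytic at `0` and `R(0)`
invertible by coercivity. Its solution is analytic near `0`, and uniqueness identifies it with `(u₀,
v₀)`. -/

/-! ### Mollification in `L²` and of weak derivatives. -/

section Mollification

open Filter Topology Set
open scoped ENNReal NNReal Convolution Pointwise

variable {N : ℕ}

/-- This is continuity at the origin of the translation action of `ℝ^N` on `L²`, the exponent being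
finite. -/
theorem tendsto_eLpNorm_translate_sub {F : Type*} [NormedAddCommGroup F] {f : RN N → F} (hf : MemLp f 2 volume) :
    Tendsto (fun t : RN N => eLpNorm (fun x => f (x - t) - f x) 2 volume) (𝓝 0) (𝓝 0) := by
  have hc : Continuous fun t : RN N => DomAddAct.mk (-t) +ᵥ hf.toLp f := by
    have : Continuous fun t : RN N => DomAddAct.mk (-t) :=
      DomAddAct.continuous_mk.comp continuous_neg
    have hp : Fact ((2 : ℝ≥0∞) ≠ ⊤) := ⟨by norm_num⟩
    exact this.vadd continuous_const
  have h0 := hc.tendsto 0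
  simp only [neg_zero, DomAddAct.mk_zero, zero_vadd, DomAddAct.mk_vadd_toLp] at h0
  rw [Lp.tendsto_Lp_iff_tendsto_eLpNorm] at h0
  refine h0.congr fun t => ?_
  refine eLpNorm_congr_ae ?_
  have hm : MemLp (fun x => f (-t +ᵥ x)) 2 volume :=
    hf.comp_measurePreserving (measurePreserving_add_left volume (-t))
  filter_upwards [hm.coeFn_toLp] with x h2
  simp only [Pi.sub_apply]
  erw [h2]
  simp [sub_eq_neg_add]

variable {F : Type*} [NormedAddCommGroup F] [NormedSpace ℝ F]

/-- The normalised bump is the density of a probability measure `ν`, so the error is a `ν`-average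
of the differences `f (x - t) - f x`. Jensen and Tonelli then bound its square norm by an average of
those of the differences. -/
theorem eLpNorm_convolution_sub_le [CompleteSpace F] (φ : ContDiffBump (0 : RN N)) {f : RN N → F}
    (hf : MemLp f 2 volume) {δ : ℝ≥0∞}
    (hδ : ∀ t, ‖t‖ < φ.rOut → eLpNorm (fun x => f (x - t) - f x) 2 volume ≤ δ) :
    eLpNorm (fun x => (φ.normed volume ⋆[ContinuousLinearMap.lsmul ℝ ℝ, volume] f) x - f x)
      2 volume ≤ δ := by
  set ρ : RN N → ℝ := φ.normed volume
  have hρ0 : ∀ t, 0 ≤ ρ t := φ.nonneg_normed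
  have hρi : Integrable ρ := φ.integrable_normed
  have hρm : Measurable ρ := φ.continuous_normed.measurable
  set ν : Measure (RN N) := volume.withDensity fun t => ENNReal.ofReal (ρ t)
  have hν : IsProbabilityMeasure ν := by
    constructor
    rw [withDensity_apply _ MeasurableSet.univ, Measure.restrict_univ,
      ← ofReal_integral_eq_lintegral_ofReal hρi (Eventually.of_forall hρ0), φ.integral_normed]
    simp
  have hνac : ν ≪ volume := withDensity_absolutelyContinuous _ _
  have hloc : LocallyIntegrable f volume := hf.locallyIntegrable (by norm_num)
  have hsmul : ∀ (h : RN N → F), ∫ t, h t ∂ν = ∫ t, ρ t • h t := by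
    intro h
    have := integral_withDensity_eq_integral_smul (μ := volume)
      (f := fun t => Real.toNNReal (ρ t)) hρm.real_toNNReal h
    rw [show ν = volume.withDensity fun t => ((Real.toNNReal (ρ t) : ℝ≥0) : ℝ≥0∞) from rfl, this]
    refine integral_congr_ae (Eventually.of_forall fun t => ?_)
    simp only [NNReal.smul_def, Real.coe_toNNReal _ (hρ0 t)]
  have hrep : ∀ x, (ρ ⋆[ContinuousLinearMap.lsmul ℝ ℝ, volume] f) x - f x
      = ∫ t, (f (x - t) - f x) ∂ν := by
    intro x
    have hex : Integrable fun t => ρ t • f (x - t) :=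
      (φ.hasCompactSupport_normed.convolutionExists_left (ContinuousLinearMap.lsmul ℝ ℝ)
        φ.continuous_normed hloc x)
    rw [hsmul]
    simp only [smul_sub]
    rw [integral_sub hex (hρi.smul_const _), integral_smul_const, φ.integral_normed, one_smul]
    rfl
  have hmeas : AEStronglyMeasurable (fun p : RN N × RN N => f (p.1 - p.2) - f p.1)
      (volume.prod ν) := by
    refine AEStronglyMeasurable.sub ?_ hf.1.comp_fst
    exact hf.1.comp_quasiMeasurePreserving (quasiMeasurePreserving_sub_of_right_invariant _ _)
  have hpt : ∀ᵐ x, ‖(ρ ⋆[ContinuousLinearMap.lsmul ℝ ℝ, volume] f) x - f x‖ₑ ^ (2 : ℝ)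
      ≤ ∫⁻ t, ‖f (x - t) - f x‖ₑ ^ (2 : ℝ) ∂ν := by
    filter_upwards [hmeas.prodMk_left] with x hx
    rw [hrep]
    -- Jensen: for a probability measure the `L¹` norm is at most the `L²` norm.
    have h1 := eLpNorm_le_eLpNorm_of_exponent_le (p := 1) (q := 2) (by norm_num) hx
    rw [eLpNorm_one_eq_lintegral_enorm] at h1
    have h2 := (enorm_integral_le_lintegral_enorm (μ := ν) fun t => f (x - t) - f x).trans h1
    have h3 := eLpNorm_nnreal_pow_eq_lintegral (μ := ν) (p := 2)
      (f := fun t => f (x - t) - f x) (by norm_num)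
    simp only [NNReal.coe_ofNat, ENNReal.coe_ofNat] at h3
    rw [← h3]
    gcongr
  have hpow : ∀ g : RN N → F, eLpNorm g 2 volume ^ (2 : ℝ) = ∫⁻ x, ‖g x‖ₑ ^ (2 : ℝ) := by
    intro g
    have h3 := eLpNorm_nnreal_pow_eq_lintegral (μ := volume) (p := 2) (f := g) (by norm_num)
    simpa only [NNReal.coe_ofNat, ENNReal.coe_ofNat] using h3
  have key : eLpNorm (fun x => (ρ ⋆[ContinuousLinearMap.lsmul ℝ ℝ, volume] f) x - f x)
      2 volume ^ (2 : ℝ) ≤ δ ^ (2 : ℝ) := by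
    rw [hpow]
    calc _ ≤ ∫⁻ x, ∫⁻ t, ‖f (x - t) - f x‖ₑ ^ (2 : ℝ) ∂ν := lintegral_mono_ae hpt
      _ = ∫⁻ t, ∫⁻ x, ‖f (x - t) - f x‖ₑ ^ (2 : ℝ) ∂volume ∂ν := by
          exact lintegral_lintegral_swap (f := fun x t => ‖f (x - t) - f x‖ₑ ^ (2 : ℝ))
            (hmeas.enorm.pow_const _)
      _ ≤ ∫⁻ t, δ ^ (2 : ℝ) ∂ν := by
          -- `ν` charges only the support of the bump, where the hypothesis `hδ` applies.
          have : ∀ᵐ t ∂ν, ‖t‖ < φ.rOut := by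
            rw [ae_withDensity_iff hρm.ennreal_ofReal]
            refine Eventually.of_forall fun t ht => ?_
            by_contra hcon
            refine ht ?_
            have : t ∉ Function.support ρ := by
              rw [φ.support_normed_eq]; simpa using hcon
            rw [Function.notMem_support.1 this]; simp
          refine lintegral_mono_ae (this.mono fun t ht => ?_)
          rw [← hpow]
          gcongr
          exact hδ t ht
      _ = δ ^ (2 : ℝ) := by simp
  exact (ENNReal.rpow_le_rpow_iff (by norm_num : (0 : ℝ) < 2)).1 key

theorem tendsto_eLpNorm_convolution_sub [CompleteSpace F] {φ : ℕ → ContDiffBump (0 : RN N)}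
    (hφ : Tendsto (fun k => (φ k).rOut) atTop (𝓝 0)) {f : RN N → F} (hf : MemLp f 2 volume) :
    Tendsto (fun k => eLpNorm (fun x =>
      ((φ k).normed volume ⋆[ContinuousLinearMap.lsmul ℝ ℝ, volume] f) x - f x) 2 volume)
      atTop (𝓝 0) := by
  rw [ENNReal.tendsto_nhds_zero]
  intro δ hδ
  have h := (ENNReal.tendsto_nhds_zero.1 (tendsto_eLpNorm_translate_sub hf)) δ hδ
  obtain ⟨r, hr, hball⟩ := Metric.eventually_nhds_iff.1 h
  filter_upwards [hφ.eventually (gt_mem_nhds hr)] with k hk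
  exact eLpNorm_convolution_sub_le (φ k) hf fun t ht => hball (by simpa using ht.trans hk)

/-- The kernel `t ↦ φ (x - t)` is itself a test function. Its reflection contributes a sign that
cancels the one in the definition of the weak derivative. -/
theorem HasWeakDeriv.hasFDerivAt_convolution {f : RN N → F} {g : RN N → (RN N →L[ℝ] F)}
    (h : HasWeakDeriv univ f g) (hf : LocallyIntegrable f volume)
    (hg : LocallyIntegrable g volume) {φ : RN N → ℝ} (hφ : ContDiff ℝ ∞ φ)
    (hφc : HasCompactSupport φ) (x : RN N) :
    HasFDerivAt (φ ⋆[ContinuousLinearMap.lsmul ℝ ℝ, volume] f)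
      ((φ ⋆[ContinuousLinearMap.lsmul ℝ ℝ, volume] g) x) x := by
  have h1 := hφc.hasFDerivAt_convolution_left (ContinuousLinearMap.lsmul ℝ ℝ)
    (hφ.of_le (by simp)) hf x
  refine h1.congr_fderiv (ContinuousLinearMap.ext fun v => ?_)
  have hθ : IsTestFunction univ (fun t => φ (x - t)) :=
    ⟨hφ.comp (contDiff_const.sub contDiff_id), hφc.comp_homeomorph (Homeomorph.subLeft x),
      subset_univ _⟩
  have e1 : Integrable fun t => φ (x - t) • g t :=
    hg.integrable_smul_left_of_hasCompactSupport hθ.contDiff.continuous hθ.hasCompactSupport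
  have e2 : ConvolutionExistsAt (fderiv ℝ φ) f x
      ((ContinuousLinearMap.lsmul ℝ ℝ).precompL (RN N)) volume :=
    (hφc.fderiv (𝕜 := ℝ)).convolutionExists_left _ (hφ.continuous_fderiv (by simp)) hf x
  have e3 : ((φ ⋆[ContinuousLinearMap.lsmul ℝ ℝ, volume] g) x) v
      = ∫ t, φ (x - t) • g t v := by
    rw [convolution_lsmul_swap, ContinuousLinearMap.integral_apply e1]
    rfl
  have e4 : ((fderiv ℝ φ ⋆[(ContinuousLinearMap.lsmul ℝ ℝ).precompL (RN N), volume] f) x) v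
      = ∫ t, fderiv ℝ φ (x - t) v • f t := by
    rw [convolution_eq_swap, ContinuousLinearMap.integral_apply e2.integrable_swap]
    simp only [ContinuousLinearMap.precompL_apply, ContinuousLinearMap.lsmul_apply]
  have hd : ∀ t, HasFDerivAt (fun t => φ (x - t)) (-(fderiv ℝ φ (x - t))) t := by
    intro t
    have := ((hφ.differentiable (by simp) (x - t)).hasFDerivAt).comp t
      ((hasFDerivAt_id t).const_sub x)
    rw [ContinuousLinearMap.comp_neg] at this
    exact this
  have := h _ hθ v
  rw [Measure.restrict_univ] at this
  simp only [(hd _).fderiv, _root_.neg_apply, neg_smul, integral_neg, neg_inj] at this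
  rw [e3, e4, this]

end Mollification

/-! ### Weak derivatives and membership in `H¹₀`. -/

section SobolevBasics

open Filter Topology Set
open scoped ENNReal NNReal Convolution

variable {N : ℕ}

theorem gradient_eq_of_hasFDerivAt_innerSL {f : RN N → ℝ} {x w : RN N}
    (h : HasFDerivAt f (innerSL ℝ w) x) : gradient f x = w := by
  rw [gradient, h.fderiv]
  exact (InnerProductSpace.toDual ℝ (RN N)).symm_apply_apply w

theorem innerSL_gradient (f : RN N → ℝ) (x : RN N) :
    innerSL ℝ (gradient f x) = fderiv ℝ f x :=
  (InnerProductSpace.toDual ℝ (RN N)).apply_symm_apply _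

/-- A pair of square integrable functions as an element of `L²(U) × L²(U; ℝ^N)`. -/
noncomputable def L2Pair.mk {U : Set (RN N)} {f : RN N → ℝ} {g : RN N → RN N}
    (hf : MemLp f 2 (volume.restrict U)) (hg : MemLp g 2 (volume.restrict U)) : L2Pair U :=
  WithLp.toLp 2 (hf.toLp f, hg.toLp g)

theorem L2Pair.mk_fn {U : Set (RN N)} {f : RN N → ℝ} {g : RN N → RN N}
    (hf : MemLp f 2 (volume.restrict U)) (hg : MemLp g 2 (volume.restrict U)) :
    (L2Pair.mk hf hg).fn =ᵐ[volume.restrict U] f := hf.coeFn_toLp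

theorem L2Pair.mk_grad {U : Set (RN N)} {f : RN N → ℝ} {g : RN N → RN N}
    (hf : MemLp f 2 (volume.restrict U)) (hg : MemLp g 2 (volume.restrict U)) :
    (L2Pair.mk hf hg).grad =ᵐ[volume.restrict U] g := hg.coeFn_toLp

theorem L2Pair.ext_ae {U : Set (RN N)} {p q : L2Pair U}
    (h₁ : p.fn =ᵐ[volume.restrict U] q.fn) (h₂ : p.grad =ᵐ[volume.restrict U] q.grad) :
    p = q := by
  have e₁ : p.fst = q.fst := Lp.ext h₁
  have e₂ : p.snd = q.snd := Lp.ext h₂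
  exact (WithLp.ofLp_injective 2) (Prod.ext e₁ e₂)

theorem L2Pair.memLp_fn {U : Set (RN N)} (p : L2Pair U) : MemLp p.fn 2 (volume.restrict U) :=
  Lp.memLp p.fst

theorem L2Pair.memLp_grad {U : Set (RN N)} (p : L2Pair U) :
    MemLp p.grad 2 (volume.restrict U) := Lp.memLp p.snd

theorem IsTestFunction.memLp {U V : Set (RN N)} {θ : RN N → ℝ} (h : IsTestFunction U θ) :
    MemLp θ 2 (volume.restrict V) :=
  (h.contDiff.continuous.memLp_of_hasCompactSupport h.hasCompactSupport).restrict V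

theorem IsTestFunction.continuous_gradient {U : Set (RN N)} {θ : RN N → ℝ}
    (h : IsTestFunction U θ) : Continuous (gradient θ) :=
  (InnerProductSpace.toDual ℝ (RN N)).symm.continuous.comp
    (h.contDiff.continuous_fderiv (by simp))

theorem IsTestFunction.memLp_gradient {U V : Set (RN N)} {θ : RN N → ℝ}
    (h : IsTestFunction U θ) : MemLp (gradient θ) 2 (volume.restrict V) := by
  refine (h.continuous_gradient.memLp_of_hasCompactSupport ?_).restrict V
  exact (h.hasCompactSupport.fderiv (𝕜 := ℝ)).comp_left
    (g := (InnerProductSpace.toDual ℝ (RN N)).symm) (map_zero _)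

theorem IsTestFunction.mk_mem_H10 {U : Set (RN N)} {θ : RN N → ℝ} (h : IsTestFunction U θ) :
    L2Pair.mk h.memLp h.memLp_gradient ∈ H10 U :=
  Submodule.le_topologicalClosure _ <| Submodule.subset_span
    ⟨θ, h, L2Pair.mk_fn _ _, L2Pair.mk_grad _ _⟩

/-- The bump functions with support in the ball of radius `1 / (k + 1)`. -/
noncomputable def mollifierBump (N k : ℕ) : ContDiffBump (0 : RN N) where
  rIn := 1 / (2 * ((k : ℝ) + 1))
  rOut := 1 / ((k : ℝ) + 1)
  rIn_pos := by positivity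
  rIn_lt_rOut := by
    apply one_div_lt_one_div_of_lt <;> nlinarith [(Nat.cast_nonneg k : (0 : ℝ) ≤ k)]

theorem tendsto_mollifierBump_rOut (N : ℕ) :
    Tendsto (fun k => (mollifierBump N k).rOut) atTop (𝓝 0) :=
  tendsto_one_div_add_atTop_nhds_zero_nat

/-- The mollifications converge to `f` in `L²` together with their gradients, and their supports lie
in a small thickening of `K`, which stays inside `U`. This is the way nonsmooth functions enter
`H¹₀`, which is defined as a closure of test functions. -/
theorem exists_mem_H10_of_hasWeakDeriv {U K : Set (RN N)} (hU : IsOpen U) (hK : IsCompact K)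
    (hKU : K ⊆ U) {f : RN N → ℝ} {g : RN N → RN N} (hf : MemLp f 2 volume)
    (hg : MemLp g 2 volume) (h : HasWeakDeriv univ f (fun x => innerSL ℝ (g x)))
    (hf0 : ∀ x, x ∉ K → f x = 0) :
    ∃ p ∈ H10 U, p.fn =ᵐ[volume.restrict U] f ∧ p.grad =ᵐ[volume.restrict U] g := by
  set φ : ℕ → RN N → ℝ := fun k => (mollifierBump N k).normed volume
  set fk : ℕ → RN N → ℝ := fun k => φ k ⋆[ContinuousLinearMap.lsmul ℝ ℝ, volume] f
  set gk : ℕ → RN N → RN N := fun k => φ k ⋆[ContinuousLinearMap.lsmul ℝ ℝ, volume] g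
  have hlf : LocallyIntegrable f volume := hf.locallyIntegrable (by norm_num)
  have hlg : LocallyIntegrable g volume := hg.locallyIntegrable (by norm_num)
  have hlg' : LocallyIntegrable (fun x => innerSL ℝ (g x)) volume :=
    MemLp.locallyIntegrable (p := 2) ((innerSL ℝ).comp_memLp' hg) (by norm_num)
  have hφs : ∀ k, ContDiff ℝ ∞ (φ k) := fun k => (mollifierBump N k).contDiff_normed
  have hφc : ∀ k, HasCompactSupport (φ k) := fun k => (mollifierBump N k).hasCompactSupport_normed
  have hfks : ∀ k, ContDiff ℝ ∞ (fk k) := fun k =>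
    (hφc k).contDiff_convolution_left _ (hφs k) hlf
  have hgrad : ∀ k x, gradient (fk k) x = gk k x := by
    intro k x
    apply gradient_eq_of_hasFDerivAt_innerSL
    have h1 := h.hasFDerivAt_convolution hlf hlg' (hφs k) (hφc k) x
    refine h1.congr_fderiv ?_
    have hi : Integrable fun t => φ k (x - t) • g t :=
      hlg.integrable_smul_left_of_hasCompactSupport
        ((hφs k).continuous.comp (continuous_const.sub continuous_id))
        ((hφc k).comp_homeomorph (Homeomorph.subLeft x))
    simp only [gk]
    rw [convolution_lsmul_swap, convolution_lsmul_swap,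
      ← ContinuousLinearMap.integral_comp_comm _ hi]
    simp only [map_smul]
  obtain ⟨δ, hδ, hδU⟩ := hK.exists_cthickening_subset_open hU hKU
  have hsupp : ∀ᶠ k in atTop, IsTestFunction U (fk k) := by
    filter_upwards [(tendsto_mollifierBump_rOut N).eventually (gt_mem_nhds hδ)] with k hk
    have hts : tsupport (fk k) ⊆ Metric.cthickening δ K := by
      refine closure_minimal ?_ Metric.isClosed_cthickening
      refine (support_convolution_subset _).trans ?_
      rintro _ ⟨y, hy, z, hz, rfl⟩
      have hzK : z ∈ K := by
        by_contra hcon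
        exact hz (hf0 z hcon)
      rw [ContDiffBump.support_normed_eq] at hy
      refine Metric.mem_cthickening_of_dist_le _ z δ K hzK ?_
      simp only [Metric.mem_ball, dist_zero_right] at hy
      simpa using hy.le.trans hk.le
    exact ⟨hfks k, hK.cthickening.of_isClosed_subset (isClosed_tsupport _) hts, hts.trans hδU⟩
  have hfr : MemLp f 2 (volume.restrict U) := hf.restrict U
  have hgr : MemLp g 2 (volume.restrict U) := hg.restrict U
  refine ⟨L2Pair.mk hfr hgr, ?_, L2Pair.mk_fn _ _, L2Pair.mk_grad _ _⟩
  -- Only late mollifications are supported in `U`, so the sequence is shifted by `k₀`.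
  obtain ⟨k₀, hk₀⟩ := eventually_atTop.1 hsupp
  have ht : ∀ k, IsTestFunction U (fk (k + k₀)) := fun k => hk₀ _ (by omega)
  refine (Submodule.isClosed_topologicalClosure _).mem_of_tendsto
    (b := atTop) (f := fun k => L2Pair.mk (ht k).memLp (ht k).memLp_gradient) ?_
    (Eventually.of_forall fun k => (ht k).mk_mem_H10)
  refine ((WithLp.prod_continuous_toLp 2 _ _).tendsto _).comp (Tendsto.prodMk_nhds ?_ ?_)
  · rw [Lp.tendsto_Lp_iff_tendsto_eLpNorm'']
    have := (tendsto_eLpNorm_convolution_sub (tendsto_mollifierBump_rOut N) hf).comp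
      (tendsto_add_atTop_nat k₀)
    refine tendsto_of_tendsto_of_tendsto_of_le_of_le tendsto_const_nhds this
      (fun _ => zero_le) fun k => ?_
    exact eLpNorm_mono_measure _ Measure.restrict_le_self
  · rw [Lp.tendsto_Lp_iff_tendsto_eLpNorm'']
    have := (tendsto_eLpNorm_convolution_sub (tendsto_mollifierBump_rOut N) hg).comp
      (tendsto_add_atTop_nat k₀)
    refine tendsto_of_tendsto_of_tendsto_of_le_of_le tendsto_const_nhds this
      (fun _ => zero_le) fun k => ?_
    have e : gradient (fk (k + k₀)) = gk (k + k₀) := funext (hgrad _)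
    rw [e]
    exact eLpNorm_mono_measure _ Measure.restrict_le_self

theorem HasWeakDeriv.clm_comp {F G : Type*} [NormedAddCommGroup F] [NormedSpace ℝ F]
    [NormedAddCommGroup G] [NormedSpace ℝ G] [CompleteSpace F] [CompleteSpace G]
    {U : Set (RN N)} {f : RN N → F}
    {g : RN N → (RN N →L[ℝ] F)} (h : HasWeakDeriv U f g)
    (hf : LocallyIntegrable f (volume.restrict U))
    (hg : LocallyIntegrable g (volume.restrict U)) (L : F →L[ℝ] G) :
    HasWeakDeriv U (fun x => L (f x)) (fun x => L.comp (g x)) := by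
  intro θ hθ v
  have := congrArg L (h θ hθ v)
  rw [map_neg, ← L.integral_comp_comm (hθ.integrable_fderiv_smul v hf),
    ← L.integral_comp_comm (hθ.integrable_smul_apply v hg)] at this
  simpa only [map_smul, ContinuousLinearMap.comp_apply] using this

theorem IsTestFunction.mono {U V : Set (RN N)} (hUV : U ⊆ V) {θ : RN N → ℝ}
    (h : IsTestFunction U θ) : IsTestFunction V θ :=
  ⟨h.contDiff, h.hasCompactSupport, h.tsupport_subset.trans hUV⟩

theorem IsTestFunction.setIntegral_fderiv_smul {F : Type*} [NormedAddCommGroup F]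
    [NormedSpace ℝ F] {U : Set (RN N)} {θ : RN N → ℝ} (h : IsTestFunction U θ) (v : RN N)
    (f : RN N → F) : ∫ x in U, (fderiv ℝ θ x v) • f x = ∫ x, (fderiv ℝ θ x v) • f x := by
  refine setIntegral_eq_integral_of_forall_compl_eq_zero fun x hx => ?_
  have : x ∉ tsupport (fderiv ℝ θ) := fun hx' =>
    hx (h.tsupport_subset (tsupport_fderiv_subset ℝ hx'))
  rw [image_eq_zero_of_notMem_tsupport this]
  simp

theorem IsTestFunction.setIntegral_smul {F : Type*} [NormedAddCommGroup F]
    [NormedSpace ℝ F] {U : Set (RN N)} {θ : RN N → ℝ} (h : IsTestFunction U θ)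
    (f : RN N → F) : ∫ x in U, θ x • f x = ∫ x, θ x • f x := by
  refine setIntegral_eq_integral_of_forall_compl_eq_zero fun x hx => ?_
  rw [image_eq_zero_of_notMem_tsupport fun hx' => hx (h.tsupport_subset hx')]
  simp

theorem HasWeakDeriv.mono {F : Type*} [NormedAddCommGroup F]
    [NormedSpace ℝ F] {U V : Set (RN N)} (hUV : U ⊆ V) {f : RN N → F}
    {g : RN N → (RN N →L[ℝ] F)} (h : HasWeakDeriv V f g) : HasWeakDeriv U f g := by
  intro θ hθ v
  have := h θ (hθ.mono hUV) v
  rw [(hθ.mono hUV).setIntegral_fderiv_smul, (hθ.mono hUV).setIntegral_smul] at this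
  rw [hθ.setIntegral_fderiv_smul, hθ.setIntegral_smul, this]

theorem IsTestFunction.exists_lipschitzWith {U : Set (RN N)} {θ : RN N → ℝ}
    (h : IsTestFunction U θ) : ∃ C, LipschitzWith C θ :=
  h.contDiff.lipschitzWith_of_hasCompactSupport h.hasCompactSupport (by simp)

/-- Rademacher's theorem combined with integration by parts for directional derivatives of Lipschitz
functions. -/
theorem LipschitzWith.hasWeakDeriv_fderiv {C : ℝ≥0} {f : RN N → ℝ} (hf : LipschitzWith C f)
    (U : Set (RN N)) : HasWeakDeriv U f (fderiv ℝ f) := by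
  refine HasWeakDeriv.mono (subset_univ U) fun θ hθ v => ?_
  rw [Measure.restrict_univ]
  obtain ⟨D, hD⟩ := hθ.exists_lipschitzWith
  have key := hf.integral_lineDeriv_mul_eq (μ := volume) hD hθ.hasCompactSupport v
  have e1 : ∫ x, lineDeriv ℝ f x v * θ x = ∫ x, θ x • fderiv ℝ f x v := by
    refine integral_congr_ae ?_
    filter_upwards [hf.ae_differentiableAt] with x hx
    rw [hx.lineDeriv_eq_fderiv, smul_eq_mul, mul_comm]
  have e2 : ∫ x, lineDeriv ℝ θ x (-v) * f x = -∫ x, (fderiv ℝ θ x v) • f x := by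
    rw [← integral_neg]
    refine integral_congr_ae (Eventually.of_forall fun x => ?_)
    simp only [((hθ.contDiff.differentiable (by simp)) x).lineDeriv_eq_fderiv, map_neg,
      smul_eq_mul, neg_mul]
  rw [e1, e2] at key
  rw [key, neg_neg]

/-- The difference integrates to zero against every test function, so the fundamental lemma of the
calculus of variations applies. -/
theorem HasWeakDeriv.ae_eq {F : Type*} [NormedAddCommGroup F] [NormedSpace ℝ F]
    [CompleteSpace F] {U : Set (RN N)} (hU : IsOpen U) {f : RN N → F}
    {g₁ g₂ : RN N → (RN N →L[ℝ] F)} (h₁ : HasWeakDeriv U f g₁) (h₂ : HasWeakDeriv U f g₂)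
    (hg₁ : LocallyIntegrable g₁ (volume.restrict U))
    (hg₂ : LocallyIntegrable g₂ (volume.restrict U)) : g₁ =ᵐ[volume.restrict U] g₂ := by
  have hli : LocallyIntegrable (fun x => g₁ x - g₂ x) (volume.restrict U) := hg₁.sub hg₂
  have := hU.ae_eq_zero_of_integral_contDiff_smul_eq_zero
    (locallyIntegrableOn_of_locallyIntegrable_restrict hli) (fun θ h1 h2 h3 => by
      have hθ : IsTestFunction U θ := ⟨h1, h2, h3⟩
      rw [← hθ.setIntegral_smul]
      have hi := hli.integrable_smul_left_of_hasCompactSupport h1.continuous h2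
      ext v
      rw [ContinuousLinearMap.integral_apply hi]
      simp only [_root_.smul_apply, _root_.sub_apply, smul_sub, _root_.zero_apply]
      rw [integral_sub (hθ.integrable_smul_apply v hg₁) (hθ.integrable_smul_apply v hg₂),
        sub_eq_zero, ← neg_inj, ← h₁ θ hθ v, h₂ θ hθ v])
  rw [Filter.EventuallyEq, ae_restrict_iff' hU.measurableSet]
  filter_upwards [this] with x hx hxU
  exact sub_eq_zero.1 (hx hxU)

end SobolevBasics

/-! ### The spaces `H¹`, `H¹₀` and `W^{1,∞}`. -/

section SobolevSpaces

open Filter Topology Set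
open scoped ENNReal NNReal Convolution

variable {N : ℕ}

/-- For a fixed test function and direction, both sides of the integration by parts identity are
inner products with fixed `L²` functions, so each identity is a closed condition. -/
theorem isClosed_H1 (U : Set (RN N)) : IsClosed (H1 U : Set (L2Pair U)) := by
  have hset : (H1 U : Set (L2Pair U)) = ⋂ (θ : RN N → ℝ) (_ : IsTestFunction U θ) (v : RN N),
      {p : L2Pair U | ∫ x in U, (fderiv ℝ θ x v) • p.fn x
        = - ∫ x in U, θ x • innerSL ℝ (p.grad x) v} := by
    ext p
    simp only [mem_iInter]
    rfl
  rw [hset]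
  refine isClosed_iInter fun θ => isClosed_iInter fun hθ => isClosed_iInter fun v => ?_
  have m1 : MemLp (fun x => fderiv ℝ θ x v) 2 (volume.restrict U) :=
    ((((hθ.contDiff.continuous_fderiv (by simp)).clm_apply continuous_const)).memLp_of_hasCompactSupport
      (hθ.hasCompactSupport.fderiv_apply (𝕜 := ℝ) v)).restrict U
  have m2 : MemLp (fun x => θ x • v) 2 (volume.restrict U) :=
    ((hθ.contDiff.continuous.smul continuous_const).memLp_of_hasCompactSupport
      hθ.hasCompactSupport.smul_right).restrict U
  have e1 : ∀ p : L2Pair U, ∫ x in U, (fderiv ℝ θ x v) • p.fn x = ⟪m1.toLp _, p.fst⟫_ℝ := by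
    intro p
    rw [L2.inner_def]
    refine integral_congr_ae ?_
    filter_upwards [m1.coeFn_toLp] with x hx
    rw [hx]
    simp [L2Pair.fn, mul_comm]
  have e2 : ∀ p : L2Pair U, ∫ x in U, θ x • innerSL ℝ (p.grad x) v = ⟪m2.toLp _, p.snd⟫_ℝ := by
    intro p
    rw [L2.inner_def]
    refine integral_congr_ae ?_
    filter_upwards [m2.coeFn_toLp] with x hx
    rw [hx, innerSL_apply_apply, inner_smul_left, real_inner_comm]
    rfl
  simp only [e1, e2]
  have c1 : Continuous fun p : L2Pair U => p.fst :=
    continuous_fst.comp (WithLp.prod_continuous_ofLp 2 _ _)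
  have c2 : Continuous fun p : L2Pair U => p.snd :=
    continuous_snd.comp (WithLp.prod_continuous_ofLp 2 _ _)
  exact isClosed_eq (continuous_const.inner c1) (continuous_const.inner c2).neg

theorem H10_le_H1 (U : Set (RN N)) : H10 U ≤ H1 U := by
  refine Submodule.topologicalClosure_minimal _ (Submodule.span_le.2 ?_) (isClosed_H1 U)
  rintro p ⟨θ, hθ, h1, h2⟩
  obtain ⟨C, hC⟩ := hθ.exists_lipschitzWith
  refine (hC.hasWeakDeriv_fderiv U).congr h1 ?_
  filter_upwards [h2] with x hx
  rw [hx, innerSL_gradient]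

theorem L2Pair.locallyIntegrable_fn {U : Set (RN N)} (p : L2Pair U) :
    LocallyIntegrable p.fn (volume.restrict U) :=
  p.memLp_fn.locallyIntegrable (by norm_num)

theorem L2Pair.locallyIntegrable_innerSL_grad {U : Set (RN N)} (p : L2Pair U) :
    LocallyIntegrable (fun x => innerSL ℝ (p.grad x)) (volume.restrict U) :=
  MemLp.locallyIntegrable (p := 2) ((innerSL ℝ).comp_memLp' p.memLp_grad) (by norm_num)

theorem H1.grad_ae_eq {U : Set (RN N)} (hU : IsOpen U) {p q : L2Pair U} (hp : p ∈ H1 U)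
    (hq : q ∈ H1 U) (h : p.fn =ᵐ[volume.restrict U] q.fn) :
    p.grad =ᵐ[volume.restrict U] q.grad := by
  have hq' : HasWeakDeriv U p.fn (fun x => innerSL ℝ (q.grad x)) :=
    HasWeakDeriv.congr hq h (EventuallyEq.refl _ _)
  filter_upwards [HasWeakDeriv.ae_eq hU hp hq' p.locallyIntegrable_innerSL_grad
    q.locallyIntegrable_innerSL_grad] with x hx
  exact innerSL_inj.1 hx

theorem measurable_gradient (f : RN N → ℝ) : Measurable (gradient f) :=
  (InnerProductSpace.toDual ℝ (RN N)).symm.continuous.measurable.comp (measurable_fderiv ℝ f)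

theorem LipschitzWith.norm_gradient_le {C : ℝ≥0} {f : RN N → ℝ} (hf : LipschitzWith C f)
    (x : RN N) : ‖gradient f x‖ ≤ C := by
  rw [gradient, LinearIsometryEquiv.norm_map]
  exact norm_fderiv_le_of_lipschitz ℝ hf

theorem LipschitzWith.exists_mem_H10 {U K : Set (RN N)} (hU : IsOpen U) (hK : IsCompact K)
    (hKU : K ⊆ U) {C : ℝ≥0} {f : RN N → ℝ} (hf : LipschitzWith C f)
    (hf0 : ∀ x, x ∉ K → f x = 0) :
    ∃ p ∈ H10 U, p.fn =ᵐ[volume.restrict U] f ∧ p.grad =ᵐ[volume.restrict U] gradient f := by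
  have hcs : HasCompactSupport f := HasCompactSupport.intro hK hf0
  refine exists_mem_H10_of_hasWeakDeriv hU hK hKU
    (hf.continuous.memLp_of_hasCompactSupport hcs) ?_ ?_ hf0
  · have hind : gradient f = K.indicator (gradient f) := by
      refine (indicator_eq_self.2 fun x hx => ?_).symm
      by_contra hxK
      refine hx ?_
      have : f =ᶠ[𝓝 x] fun _ => 0 :=
        Filter.mem_of_superset (hK.isClosed.isOpen_compl.mem_nhds hxK) fun y hy => hf0 y hy
      rw [gradient, this.fderiv_eq]
      simp
    rw [hind, memLp_indicator_iff_restrict hK.measurableSet]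
    have : IsFiniteMeasure (volume.restrict K) := ⟨by simpa using hK.measure_lt_top⟩
    exact MemLp.of_bound (measurable_gradient f).aestronglyMeasurable C
      (Eventually.of_forall hf.norm_gradient_le)
  · simp only [innerSL_gradient]
    exact hf.hasWeakDeriv_fderiv univ

theorem Lp.ae_norm_le_norm_top {α F : Type*} [MeasurableSpace α] {ν : Measure α}
    [NormedAddCommGroup F] (f : Lp F ⊤ ν) : ∀ᵐ x ∂ν, ‖f x‖ ≤ ‖f‖ := by
  filter_upwards [enorm_ae_le_eLpNormEssSup f ν] with x hx
  rw [Lp.norm_def, eLpNorm_exponent_top, ← toReal_enorm]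
  refine ENNReal.toReal_mono ?_ hx
  rw [← eLpNorm_exponent_top]
  exact Lp.eLpNorm_ne_top f

theorem W1inf.locallyIntegrable_snd (μ : LinfPair N) : LocallyIntegrable μ.2 volume :=
  (Lp.memLp μ.2).locallyIntegrable le_top

/-- The derivative of a mollified field is an average of `μ'`, hence bounded by `‖μ'‖`. The
Lipschitz bound survives the pointwise limit, since `μ` is continuous. -/
theorem W1inf.lipschitzWith {μ : LinfPair N} (hμ : μ ∈ W1inf N) : LipschitzWith ‖μ.2‖₊ μ.1 := by
  set φ : ℕ → RN N → ℝ := fun k => (mollifierBump N k).normed volume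
  have hcont : Continuous μ.1 := μ.1.continuous
  have hL : ∀ k, LipschitzWith ‖μ.2‖₊
      (φ k ⋆[ContinuousLinearMap.lsmul ℝ ℝ, volume] μ.1) := by
    intro k
    have hφs : ContDiff ℝ ∞ (φ k) := (mollifierBump N k).contDiff_normed
    have hφc : HasCompactSupport (φ k) := (mollifierBump N k).hasCompactSupport_normed
    have hd := fun x => HasWeakDeriv.hasFDerivAt_convolution hμ hcont.locallyIntegrable
      (W1inf.locallyIntegrable_snd μ) hφs hφc x
    refine lipschitzWith_of_nnnorm_fderiv_le (𝕜 := ℝ) (fun x => (hd x).differentiableAt)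
      fun x => ?_
    rw [(hd x).fderiv, ← NNReal.coe_le_coe, coe_nnnorm, coe_nnnorm, convolution_lsmul_swap]
    have hi : Integrable fun t => φ k (x - t) * ‖μ.2‖ :=
      ((mollifierBump N k).integrable_normed.comp_sub_left x).mul_const _
    refine (norm_integral_le_of_norm_le hi ?_).trans ?_
    · filter_upwards [Lp.ae_norm_le_norm_top μ.2] with t ht
      rw [norm_smul, Real.norm_of_nonneg ((mollifierBump N k).nonneg_normed _)]
      exact mul_le_mul_of_nonneg_left ht ((mollifierBump N k).nonneg_normed _)
    · rw [integral_mul_const, integral_sub_left_eq_self (φ k),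
        (mollifierBump N k).integral_normed, one_mul]
  refine LipschitzWith.of_dist_le_mul fun x y => ?_
  have ht := fun z => ContDiffBump.convolution_tendsto_right_of_continuous (μ := volume)
    (tendsto_mollifierBump_rOut N) hcont z
  exact le_of_tendsto ((ht x).dist (ht y)) (Eventually.of_forall fun k => (hL k).dist_le_mul x y)

/-- By Rademacher the classical derivative exists almost everywhere, and uniqueness of weak
derivatives identifies it with `μ'`. The argument is made coordinate by coordinate because
`LipschitzWith.hasWeakDeriv_fderiv` concerns scalar functions. -/
theorem W1inf.ae_hasFDerivAt {μ : LinfPair N} (hμ : μ ∈ W1inf N) :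
    ∀ᵐ x, HasFDerivAt μ.1 (μ.2 x) x := by
  have hL := W1inf.lipschitzWith hμ
  have hcoord : ∀ i : Fin N, ∀ᵐ x, fderiv ℝ (fun y => μ.1 y i) x
      = (EuclideanSpace.proj i : RN N →L[ℝ] ℝ).comp (μ.2 x) := by
    intro i
    have hLi : LipschitzWith (‖(EuclideanSpace.proj i : RN N →L[ℝ] ℝ)‖₊ * ‖μ.2‖₊)
        (fun y => μ.1 y i) :=
      (EuclideanSpace.proj i : RN N →L[ℝ] ℝ).lipschitz.comp hL
    have h1 := hLi.hasWeakDeriv_fderiv univ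
    have h2 := HasWeakDeriv.clm_comp hμ
      (by rw [Measure.restrict_univ]; exact μ.1.continuous.locallyIntegrable)
      (by rw [Measure.restrict_univ]; exact W1inf.locallyIntegrable_snd μ)
      (EuclideanSpace.proj i : RN N →L[ℝ] ℝ)
    have := HasWeakDeriv.ae_eq isOpen_univ h1 h2 ?_ ?_
    · rwa [Measure.restrict_univ] at this
    · rw [Measure.restrict_univ]
      refine MemLp.locallyIntegrable (p := ⊤) (memLp_top_of_bound
        (measurable_fderiv ℝ _).aestronglyMeasurable _ (Eventually.of_forall fun x =>
          norm_fderiv_le_of_lipschitz ℝ hLi)) le_top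
    · rw [Measure.restrict_univ]
      refine MemLp.locallyIntegrable (p := ⊤) ?_ le_top
      exact (ContinuousLinearMap.compL ℝ (RN N) (RN N) ℝ
        (EuclideanSpace.proj i : RN N →L[ℝ] ℝ)).comp_memLp' (Lp.memLp μ.2)
  filter_upwards [hL.ae_differentiableAt, ae_all_iff.2 hcoord] with x hx hi
  have hd := hx.hasFDerivAt
  have heq : μ.2 x = fderiv ℝ μ.1 x := by
    refine ContinuousLinearMap.ext fun v => ?_
    refine PiLp.ext fun i => ?_
    have h1 : fderiv ℝ (fun y => μ.1 y i) x
        = (EuclideanSpace.proj i : RN N →L[ℝ] ℝ).comp (fderiv ℝ μ.1 x) :=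
      ((EuclideanSpace.proj i : RN N →L[ℝ] ℝ).hasFDerivAt.comp x hd).fderiv
    exact DFunLike.congr_fun ((hi i).symm.trans h1) v
  rw [heq]
  exact hd

end SobolevSpaces

/-! ### Change of variables and pullback under bi-Lipschitz homeomorphisms. -/

section Bilipschitz

open Filter Topology Set
open scoped ENNReal NNReal

variable {N : ℕ}

/-- Lebesgue measure is a multiple of `N`-dimensional Hausdorff measure, for which the bound is
immediate from coverings. -/
theorem LipschitzWith.volume_image_le {K : ℝ≥0} {f : RN N → RN N} (hf : LipschitzWith K f)
    (s : Set (RN N)) : volume (f '' s) ≤ (K : ℝ≥0∞) ^ N * volume s := by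
  have hd : Module.finrank ℝ (RN N) = N := by simp
  have h1 := hf.hausdorffMeasure_image_le (d := (N : ℝ)) (by positivity) s
  have : Measure.IsAddHaarMeasure (Measure.hausdorffMeasure (N : ℝ) : Measure (RN N)) := by
    have := isAddHaarMeasure_hausdorffMeasure (E := RN N)
    rwa [hd] at this
  have h2 := Measure.isAddLeftInvariant_eq_smul (volume : Measure (RN N))
    (Measure.hausdorffMeasure (N : ℝ))
  rw [h2]
  simp only [Measure.smul_apply, ENNReal.smul_def, smul_eq_mul]
  calc _ ≤ _ := mul_le_mul_right h1 _
    _ = _ := by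
      rw [ENNReal.rpow_natCast]
      ring

/-- A bi-Lipschitz homeomorphism of `ℝ^N`. -/
structure BilipHomeo (N : ℕ) extends RN N ≃ₜ RN N where
  const : ℝ≥0
  lipschitz : LipschitzWith const toFun
  lipschitz_symm : LipschitzWith const invFun

namespace BilipHomeo

variable (e : BilipHomeo N)

/-- The inverse of a bi-Lipschitz homeomorphism. -/
def symm : BilipHomeo N where
  toHomeomorph := e.toHomeomorph.symm
  const := e.const
  lipschitz := e.lipschitz_symm
  lipschitz_symm := e.lipschitz

/-- The underlying map. -/
def map : RN N → RN N := e.toHomeomorph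

theorem map_map_symm (x : RN N) : e.map (e.symm.map x) = x := e.toHomeomorph.apply_symm_apply x

theorem lipschitz_map : LipschitzWith e.const e.map := e.lipschitz

theorem continuous_map : Continuous e.map := e.toHomeomorph.continuous

theorem injective_map : Function.Injective e.map := e.toHomeomorph.injective

theorem volume_preimage_le (s : Set (RN N)) :
    volume (e.map ⁻¹' s) ≤ (e.const : ℝ≥0∞) ^ N * volume s := by
  have h : e.map ⁻¹' s = e.symm.map '' s := (e.toHomeomorph.symm.image_eq_preimage_symm s).symm
  rw [h]
  exact e.symm.lipschitz_map.volume_image_le s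

theorem quasiMeasurePreserving : Measure.QuasiMeasurePreserving e.map volume volume := by
  refine ⟨e.continuous_map.measurable, Measure.AbsolutelyContinuous.mk fun s hs h0 => ?_⟩
  rw [Measure.map_apply e.continuous_map.measurable hs]
  have := e.volume_preimage_le s
  rw [h0, mul_zero] at this
  exact le_antisymm this zero_le

theorem map_volume_le : Measure.map e.map volume ≤ (e.const : ℝ≥0∞) ^ N • volume := by
  refine Measure.le_iff.2 fun s hs => ?_
  rw [Measure.map_apply e.continuous_map.measurable hs, Measure.smul_apply, smul_eq_mul]
  exact e.volume_preimage_le s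

variable {U V : Set (RN N)}

theorem preimage_eq (h : ∀ x, x ∈ V ↔ e.map x ∈ U) : e.map ⁻¹' U = V := by
  ext x; exact (h x).symm

theorem mem_symm_iff (h : ∀ x, x ∈ V ↔ e.map x ∈ U) (x : RN N) : x ∈ U ↔ e.symm.map x ∈ V := by
  rw [h, map_map_symm]

theorem map_restrict_le (hU : MeasurableSet U) (h : ∀ x, x ∈ V ↔ e.map x ∈ U) :
    Measure.map e.map (volume.restrict V) ≤ (e.const : ℝ≥0∞) ^ N • volume.restrict U := by
  rw [← e.preimage_eq h, ← Measure.restrict_map e.continuous_map.measurable hU,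
    ← Measure.restrict_smul]
  exact Measure.restrict_mono subset_rfl e.map_volume_le

theorem quasiMeasurePreserving_restrict (hU : MeasurableSet U)
    (h : ∀ x, x ∈ V ↔ e.map x ∈ U) :
    Measure.QuasiMeasurePreserving e.map (volume.restrict V) (volume.restrict U) :=
  ⟨e.continuous_map.measurable, (Measure.absolutelyContinuous_of_le (e.map_restrict_le hU h)).trans
    Measure.smul_absolutelyContinuous⟩

theorem eLpNorm_comp_le {F : Type*} [NormedAddCommGroup F] (hU : MeasurableSet U)
    (h : ∀ x, x ∈ V ↔ e.map x ∈ U) {f : RN N → F}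
    (hf : AEStronglyMeasurable f (volume.restrict U)) :
    eLpNorm (fun x => f (e.map x)) 2 (volume.restrict V)
      ≤ ((e.const : ℝ≥0∞) ^ N) ^ (1 / 2 : ℝ) * eLpNorm f 2 (volume.restrict U) := by
  have hac : Measure.map e.map (volume.restrict V) ≪ volume.restrict U :=
    (e.quasiMeasurePreserving_restrict hU h).absolutelyContinuous
  have h1 := eLpNorm_map_measure (p := 2) (hf.mono_ac hac)
    e.continuous_map.measurable.aemeasurable
  calc _ = eLpNorm f 2 (Measure.map e.map (volume.restrict V)) := h1.symm
    _ ≤ eLpNorm f 2 ((e.const : ℝ≥0∞) ^ N • volume.restrict U) :=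
      eLpNorm_mono_measure _ (e.map_restrict_le hU h)
    _ = _ := by
      rw [eLpNorm_smul_measure_of_ne_top (by norm_num)]
      simp

theorem ae_comp (hU : MeasurableSet U) (h : ∀ x, x ∈ V ↔ e.map x ∈ U) {p : RN N → Prop}
    (hp : ∀ᵐ x ∂volume.restrict U, p x) : ∀ᵐ x ∂volume.restrict V, p (e.map x) :=
  (e.quasiMeasurePreserving_restrict hU h).ae hp

theorem ae_hasFDerivAt : ∀ᵐ x, HasFDerivAt e.map (fderiv ℝ e.map x) x :=
  e.lipschitz_map.ae_differentiableAt.mono fun _ hx => hx.hasFDerivAt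

theorem ae_restrict_hasFDerivAt (V : Set (RN N)) :
    ∀ᵐ x ∂volume.restrict V, HasFDerivAt e.map (fderiv ℝ e.map x) x :=
  ae_restrict_of_ae e.ae_hasFDerivAt

/-- The points of nondifferentiability form a null set, and so does its image under the Lipschitz
map. Off these sets the change of variables formula for injective differentiable maps applies. -/
theorem setIntegral_comp (hV : MeasurableSet V) (h : ∀ x, x ∈ V ↔ e.map x ∈ U)
    (f : RN N → ℝ) :
    ∫ x in U, f x = ∫ x in V, |(fderiv ℝ e.map x).det| * f (e.map x) := by
  set D : Set (RN N) := {x | DifferentiableAt ℝ e.map x}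
  have hD : MeasurableSet D := measurableSet_of_differentiableAt ℝ e.map
  have hDae : volume Dᶜ = 0 := e.lipschitz_map.ae_differentiableAt
  have hVD : (V ∩ D : Set (RN N)) =ᵐ[volume] V := by
    have h1 : D =ᵐ[volume] univ := ae_eq_univ.2 hDae
    exact inter_ae_eq_left_of_ae_eq_univ h1
  have hUV : e.map '' V = U := by
    ext y
    constructor
    · rintro ⟨x, hx, rfl⟩; exact (h x).1 hx
    · intro hy; exact ⟨e.symm.map y, (e.mem_symm_iff h y).1 hy, e.map_map_symm y⟩
  have hUD : e.map '' (V ∩ D) =ᵐ[volume] U := by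
    rw [image_inter e.injective_map, hUV]
    have h0 : volume (e.map '' D)ᶜ = 0 := by
      have hc : (e.map '' D)ᶜ = e.map '' Dᶜ :=
        (image_compl_eq ⟨e.injective_map, e.toHomeomorph.surjective⟩).symm
      rw [hc]
      refine le_antisymm ((e.lipschitz_map.volume_image_le _).trans ?_) zero_le
      rw [hDae, mul_zero]
    have h1 : e.map '' D =ᵐ[volume] univ := ae_eq_univ.2 h0
    exact inter_ae_eq_left_of_ae_eq_univ h1
  rw [← setIntegral_congr_set hUD, ← setIntegral_congr_set hVD]
  exact integral_image_eq_integral_abs_det_fderiv_smul volume (hV.inter hD)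
    (fun x hx => (hx.2.hasFDerivAt).hasFDerivWithinAt) e.injective_map.injOn f

section WeightedComposition

variable {F : Type*} [NormedAddCommGroup F] [NormedSpace ℝ F]

/-- The field `T` serves both components of a pair: the identity for the function and `(e')^*` for
the gradient. -/
theorem memLp_weightedComp (hU : MeasurableSet U) (h : ∀ x, x ∈ V ↔ e.map x ∈ U)
    {T : RN N → F →L[ℝ] F} (hT : AEStronglyMeasurable T volume) {C : ℝ≥0}
    (hC : ∀ x, ‖T x‖ ≤ C) {f : RN N → F} (hf : MemLp f 2 (volume.restrict U)) :
    MemLp (fun x => T x (f (e.map x))) 2 (volume.restrict V) ∧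
    eLpNorm (fun x => T x (f (e.map x))) 2 (volume.restrict V)
      ≤ C * (((e.const : ℝ≥0∞) ^ N) ^ (1 / 2 : ℝ) * eLpNorm f 2 (volume.restrict U)) := by
  have hb : eLpNorm (fun x => T x (f (e.map x))) 2 (volume.restrict V)
      ≤ C * (((e.const : ℝ≥0∞) ^ N) ^ (1 / 2 : ℝ) * eLpNorm f 2 (volume.restrict U)) := by
    refine (eLpNorm_le_nnreal_smul_eLpNorm_of_ae_le_mul (g := fun x => f (e.map x)) (c := C)
      (Eventually.of_forall fun x => ?_) 2).trans ?_
    · exact (T x).le_of_opNorm_le (hC x) _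
    · rw [ENNReal.smul_def, smul_eq_mul]
      gcongr
      exact e.eLpNorm_comp_le hU h hf.1
  refine ⟨⟨?_, hb.trans_lt ?_⟩, hb⟩
  · exact (ContinuousLinearMap.id ℝ (F →L[ℝ] F)).aestronglyMeasurable_comp₂ hT.restrict
      (hf.1.comp_quasiMeasurePreserving (e.quasiMeasurePreserving_restrict hU h))
  · have := hf.2
    finiteness

/-- The operator `f ↦ T (f ∘ e)` from `L²(U)` to `L²(V)`, where `V = e⁻¹(U)`. -/
noncomputable def weightedComp (hU : MeasurableSet U) (h : ∀ x, x ∈ V ↔ e.map x ∈ U)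
    {T : RN N → F →L[ℝ] F} (hT : AEStronglyMeasurable T volume) {C : ℝ≥0}
    (hC : ∀ x, ‖T x‖ ≤ C) :
    Lp F 2 (volume.restrict U) →L[ℝ] Lp F 2 (volume.restrict V) :=
  LinearMap.mkContinuous
    { toFun := fun f => (e.memLp_weightedComp hU h hT hC (Lp.memLp f)).1.toLp _
      map_add' := by
        intro f g
        refine Lp.ext ?_
        filter_upwards [(e.memLp_weightedComp hU h hT hC (Lp.memLp (f + g))).1.coeFn_toLp,
          (e.memLp_weightedComp hU h hT hC (Lp.memLp f)).1.coeFn_toLp,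
          (e.memLp_weightedComp hU h hT hC (Lp.memLp g)).1.coeFn_toLp,
          Lp.coeFn_add ((e.memLp_weightedComp hU h hT hC (Lp.memLp f)).1.toLp _)
            ((e.memLp_weightedComp hU h hT hC (Lp.memLp g)).1.toLp _),
          e.ae_comp hU h (Lp.coeFn_add f g)] with x h1 h2 h3 h4 h5
        rw [h1, h4, Pi.add_apply, h2, h3, h5, Pi.add_apply, map_add]
      map_smul' := by
        intro c f
        refine Lp.ext ?_
        filter_upwards [(e.memLp_weightedComp hU h hT hC (Lp.memLp (c • f))).1.coeFn_toLp,
          (e.memLp_weightedComp hU h hT hC (Lp.memLp f)).1.coeFn_toLp,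
          Lp.coeFn_smul c ((e.memLp_weightedComp hU h hT hC (Lp.memLp f)).1.toLp _),
          e.ae_comp hU h (Lp.coeFn_smul c f)] with x h1 h2 h4 h5
        rw [h1, RingHom.id_apply, h4, Pi.smul_apply, h2, h5, Pi.smul_apply, map_smul] }
    (C * (((e.const : ℝ≥0∞) ^ N) ^ (1 / 2 : ℝ)).toReal) (by
      intro f
      have hm := e.memLp_weightedComp hU h hT hC (Lp.memLp f)
      change ‖hm.1.toLp _‖ ≤ _
      rw [Lp.norm_toLp, Lp.norm_def]
      refine (ENNReal.toReal_mono ?_ hm.2).trans_eq ?_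
      · have := Lp.eLpNorm_ne_top f
        finiteness
      · simp [mul_assoc])

theorem weightedComp_apply (hU : MeasurableSet U) (h : ∀ x, x ∈ V ↔ e.map x ∈ U)
    {T : RN N → F →L[ℝ] F} (hT : AEStronglyMeasurable T volume) {C : ℝ≥0}
    (hC : ∀ x, ‖T x‖ ≤ C) (f : Lp F 2 (volume.restrict U)) :
    e.weightedComp hU h hT hC f =ᵐ[volume.restrict V] fun x => T x (f (e.map x)) :=
  (e.memLp_weightedComp hU h hT hC (Lp.memLp f)).1.coeFn_toLp

end WeightedComposition

theorem aestronglyMeasurable_adjoint_fderiv :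
    AEStronglyMeasurable (fun x => ContinuousLinearMap.adjoint (fderiv ℝ e.map x)) volume :=
  (ContinuousLinearMap.adjoint (𝕜 := ℝ) (E := RN N) (F := RN N)).continuous.comp_aestronglyMeasurable
    (measurable_fderiv ℝ e.map).aestronglyMeasurable

theorem norm_adjoint_fderiv_le (x : RN N) :
    ‖ContinuousLinearMap.adjoint (fderiv ℝ e.map x)‖ ≤ e.const := by
  rw [LinearIsometryEquiv.norm_map]
  exact norm_fderiv_le_of_lipschitz ℝ e.lipschitz_map

/-- The pullback `(f, g) ↦ (f ∘ e, (e')^* (g ∘ e))`. -/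
noncomputable def pullback (hU : MeasurableSet U) (h : ∀ x, x ∈ V ↔ e.map x ∈ U) :
    L2Pair U →L[ℝ] L2Pair V :=
  (WithLp.prodContinuousLinearEquiv 2 ℝ _ _).symm.toContinuousLinearMap ∘L
    ((e.weightedComp hU h (T := fun _ => ContinuousLinearMap.id ℝ ℝ)
        aestronglyMeasurable_const (C := 1) (fun _ => ContinuousLinearMap.norm_id_le)).prodMap
      (e.weightedComp hU h e.aestronglyMeasurable_adjoint_fderiv e.norm_adjoint_fderiv_le)) ∘L
    (WithLp.prodContinuousLinearEquiv 2 ℝ _ _).toContinuousLinearMap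

theorem pullback_fn (hU : MeasurableSet U) (h : ∀ x, x ∈ V ↔ e.map x ∈ U) (p : L2Pair U) :
    (e.pullback hU h p).fn =ᵐ[volume.restrict V] fun x => p.fn (e.map x) :=
  e.weightedComp_apply hU h aestronglyMeasurable_const
    (C := 1) (fun _ => ContinuousLinearMap.norm_id_le) p.fst

theorem pullback_grad (hU : MeasurableSet U) (h : ∀ x, x ∈ V ↔ e.map x ∈ U) (p : L2Pair U) :
    (e.pullback hU h p).grad =ᵐ[volume.restrict V]
      fun x => ContinuousLinearMap.adjoint (fderiv ℝ e.map x) (p.grad (e.map x)) :=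
  e.weightedComp_apply hU h e.aestronglyMeasurable_adjoint_fderiv e.norm_adjoint_fderiv_le p.snd

/-- For the gradients, take adjoints in the chain rule `e' ∘ (e⁻¹)' = id`, valid almost everywhere
because both maps preserve null sets. -/
theorem pullback_symm_pullback (hU : MeasurableSet U) (hV : MeasurableSet V)
    (h : ∀ x, x ∈ V ↔ e.map x ∈ U) (p : L2Pair U) :
    e.symm.pullback hV (e.mem_symm_iff h) (e.pullback hU h p) = p := by
  refine L2Pair.ext_ae ?_ ?_
  · filter_upwards [e.symm.pullback_fn hV (e.mem_symm_iff h) (e.pullback hU h p),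
      e.symm.ae_comp hV (e.mem_symm_iff h) (e.pullback_fn hU h p)] with x h1 h2
    rw [h1, h2, map_map_symm]
  · filter_upwards [e.symm.pullback_grad hV (e.mem_symm_iff h) (e.pullback hU h p),
      e.symm.ae_comp hV (e.mem_symm_iff h) (e.pullback_grad hU h p),
      e.symm.ae_restrict_hasFDerivAt U,
      e.symm.ae_comp hV (e.mem_symm_iff h) (e.ae_restrict_hasFDerivAt V)] with x h1 h2 h3 h4
    have hcomp : (fderiv ℝ e.map (e.symm.map x)).comp (fderiv ℝ e.symm.map x)
        = ContinuousLinearMap.id ℝ (RN N) := by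
      refine (h4.comp x h3).unique ?_
      have : e.map ∘ e.symm.map = id := funext e.map_map_symm
      rw [this]
      exact hasFDerivAt_id x
    rw [h1, h2, map_map_symm, ← ContinuousLinearMap.comp_apply, ← ContinuousLinearMap.adjoint_comp,
      hcomp, ContinuousLinearMap.adjoint_id]
    rfl

/-- The composition `θ ∘ e` need not be smooth, but it is Lipschitz and supported in a compact
subset of `V`, so `LipschitzWith.exists_mem_H10` puts it in `H¹₀`. -/
theorem pullback_mem_H10_of_isTestFunction (hU : MeasurableSet U) (hV : IsOpen V)
    (h : ∀ x, x ∈ V ↔ e.map x ∈ U) {p : L2Pair U} {θ : RN N → ℝ} (hθ : IsTestFunction U θ)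
    (h1 : p.fn =ᵐ[volume.restrict U] θ)
    (h2 : p.grad =ᵐ[volume.restrict U] fun x => gradient θ x) :
    e.pullback hU h p ∈ H10 V := by
  obtain ⟨C, hC⟩ := hθ.exists_lipschitzWith
  have hK : IsCompact (e.map ⁻¹' tsupport θ) :=
    e.toHomeomorph.isCompact_preimage.2 hθ.hasCompactSupport
  obtain ⟨q, hq, hq1, hq2⟩ := (hC.comp e.lipschitz_map).exists_mem_H10 hV hK
    (fun x hx => (h x).2 (hθ.tsupport_subset hx))
    (fun x hx => image_eq_zero_of_notMem_tsupport (f := θ) (x := e.map x) hx)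
  have key : e.pullback hU h p = q := by
    refine L2Pair.ext_ae ?_ ?_
    · filter_upwards [e.pullback_fn hU h p, e.ae_comp hU h h1, hq1] with x e1 e2 e3
      rw [e1, e2, e3, Function.comp_apply]
    · filter_upwards [e.pullback_grad hU h p, e.ae_comp hU h h2, hq2,
        e.ae_restrict_hasFDerivAt V] with x e1 e2 e3 e4
      rw [e1, e2, e3]
      refine (gradient_eq_of_hasFDerivAt_innerSL ?_).symm
      have h5 := ((hθ.contDiff.differentiable (by simp)) (e.map x)).hasFDerivAt.comp x e4
      refine h5.congr_fderiv (ContinuousLinearMap.ext fun v => ?_)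
      rw [innerSL_apply_apply, ContinuousLinearMap.adjoint_inner_left, ← innerSL_apply_apply ℝ,
        innerSL_gradient, ContinuousLinearMap.comp_apply]
  rw [key]
  exact hq

theorem pullback_mem_H10 (hU : MeasurableSet U) (hV : IsOpen V)
    (h : ∀ x, x ∈ V ↔ e.map x ∈ U) {p : L2Pair U} (hp : p ∈ H10 U) :
    e.pullback hU h p ∈ H10 V := by
  have hcl : IsClosed (H10 V : Set (L2Pair V)) := Submodule.isClosed_topologicalClosure _
  refine hcl.closure_subset (map_mem_closure (e.pullback hU h).continuous hp fun q hq => ?_)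
  induction hq using Submodule.span_induction with
  | mem q hq =>
    obtain ⟨θ, hθ, h1, h2⟩ := hq
    exact e.pullback_mem_H10_of_isTestFunction hU hV h hθ h1 h2
  | zero => rw [map_zero]; exact (H10 V).zero_mem
  | add q r _ _ hq hr => rw [map_add]; exact (H10 V).add_mem hq hr
  | smul c q _ hq => rw [map_smul]; exact (H10 V).smul_mem c hq

/-- The pullback as a bijection from `H¹₀(U)` onto `H¹₀(V)`. -/
noncomputable def pullbackH10 (hU : IsOpen U) (hV : IsOpen V) (h : ∀ x, x ∈ V ↔ e.map x ∈ U) :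
    H10 U ≃ H10 V where
  toFun p := ⟨e.pullback hU.measurableSet h p, e.pullback_mem_H10 _ hV h p.2⟩
  invFun q := ⟨e.symm.pullback hV.measurableSet (e.mem_symm_iff h) q,
    e.symm.pullback_mem_H10 _ hU _ q.2⟩
  left_inv p := Subtype.ext (e.pullback_symm_pullback hU.measurableSet hV.measurableSet h p)
  right_inv q := Subtype.ext (e.symm.pullback_symm_pullback hV.measurableSet hU.measurableSet
    (e.mem_symm_iff h) q)

end BilipHomeo

end Bilipschitz

/-! ### Geometry of the deformation `I + μ`. -/

section DeformationGeometry

open Filter Topology Set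
open scoped ENNReal NNReal

variable {N : ℕ}

theorem isUnit_id_add_of_norm_lt_one {A : RN N →L[ℝ] RN N} (hA : ‖A‖ < 1) :
    IsUnit (ContinuousLinearMap.id ℝ (RN N) + A) := by
  have h := (Units.oneSub (-A) (by rwa [norm_neg])).isUnit
  rwa [Units.val_oneSub, sub_neg_eq_add] at h

/-- Along `t ↦ det (I + tA)`, `0 ≤ t ≤ 1`, the determinant starts at `1` and never vanishes.
Positivity removes the absolute value from `Jac(m)` and leaves a polynomial in the entries of `A`.
-/
theorem det_id_add_pos_of_norm_lt_one {A : RN N →L[ℝ] RN N} (hA : ‖A‖ < 1) :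
    0 < (ContinuousLinearMap.id ℝ (RN N) + A).det := by
  set f : ℝ → ℝ := fun t => (ContinuousLinearMap.id ℝ (RN N) + t • A).det
  have hf : Continuous f := ContinuousLinearMap.continuous_det.comp (by fun_prop)
  have hne : ∀ t ∈ Icc (0 : ℝ) 1, f t ≠ 0 := by
    intro t ht
    have hlt : ‖t • A‖ < 1 := by
      rw [norm_smul, Real.norm_of_nonneg ht.1]
      exact (mul_le_of_le_one_left (norm_nonneg _) ht.2).trans_lt hA
    obtain ⟨B, hB⟩ := (isUnit_id_add_of_norm_lt_one hlt).exists_right_inv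
    have h1 : ((ContinuousLinearMap.id ℝ (RN N) + t • A : RN N →L[ℝ] RN N) : RN N →ₗ[ℝ] RN N)
        * (B : RN N →ₗ[ℝ] RN N) = 1 := congrArg ContinuousLinearMap.toLinearMap hB
    have h2 := congrArg LinearMap.det h1
    rw [map_mul, map_one] at h2
    exact left_ne_zero_of_mul_eq_one h2
  have h0 : f 0 = 1 := by simp [f, ContinuousLinearMap.det]
  have h1 : f 1 = (ContinuousLinearMap.id ℝ (RN N) + A).det := by simp [f]
  rw [← h1]
  by_contra hcon
  obtain ⟨t, ht, ht0⟩ := intermediate_value_Icc' zero_le_one hf.continuousOn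
    (show (0 : ℝ) ∈ Icc (f 1) (f 0) from ⟨not_lt.1 hcon, h0 ▸ zero_le_one⟩)
  exact hne t ht ht0

variable {Ω Dstar : Set (RN N)} (μ : WZero Ω Dstar)

theorem WZero.norm_deriv_le : ‖μ.1.2‖ ≤ ‖μ‖ := norm_snd_le μ.1

theorem WZero.ae_norm_deriv_le : ∀ᵐ x, ‖μ.1.2 x‖ ≤ ‖μ‖ :=
  (Lp.ae_norm_le_norm_top μ.1.2).mono fun _ hx => hx.trans (WZero.norm_deriv_le μ)

theorem WZero.lipschitzWith : LipschitzWith ‖μ‖₊ μ.1.1 :=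
  (W1inf.lipschitzWith μ.2.1).weaken (WZero.norm_deriv_le μ)

theorem WZero.approximatesLinearOn :
    ApproximatesLinearOn (defMap μ)
      ((ContinuousLinearEquiv.refl ℝ (RN N) : RN N ≃L[ℝ] RN N) : RN N →L[ℝ] RN N) univ ‖μ‖₊ := by
  intro x _ y _
  have := (WZero.lipschitzWith μ).dist_le_mul x y
  rw [dist_eq_norm, dist_eq_norm] at this
  have e : defMap μ x - defMap μ y - (x - y) = μ.1.1 x - μ.1.1 y := by
    simp only [defMap]
    abel
  exact (congrArg norm e).trans_le this

/-- The identity has norm `1` only on a nontrivial space; the other alternative covers the trivial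
one. -/
theorem WZero.approximates_const (hμ : ‖μ‖ < 1) : Subsingleton (RN N) ∨
    ‖μ‖₊ < ‖((ContinuousLinearEquiv.refl ℝ (RN N)).symm : RN N →L[ℝ] RN N)‖₊⁻¹ := by
  rcases subsingleton_or_nontrivial (RN N) with h | h
  · exact Or.inl h
  · right
    have : ‖((ContinuousLinearEquiv.refl ℝ (RN N)).symm : RN N →L[ℝ] RN N)‖₊ = 1 := by
      ext
      exact ContinuousLinearMap.norm_id
    rw [this, inv_one]
    exact hμ

theorem WZero.antilipschitzWith (hμ : ‖μ‖ < 1) :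
    AntilipschitzWith (1 - ‖μ‖₊)⁻¹ (defMap μ) := by
  have h := (AntilipschitzWith.id (α := RN N)).add_lipschitzWith (WZero.lipschitzWith μ)
    (show ‖μ‖₊ < 1⁻¹ by rw [inv_one]; exact hμ)
  rw [inv_one] at h
  exact h

theorem WZero.lipschitzWith_defMap : LipschitzWith (1 + ‖μ‖₊) (defMap μ) :=
  LipschitzWith.id.add (WZero.lipschitzWith μ)

/-- The deformation `I + μ` as a bi-Lipschitz homeomorphism. -/
noncomputable def WZero.homeo (hμ : ‖μ‖ < 1) : BilipHomeo N where
  toHomeomorph := (WZero.approximatesLinearOn μ).toHomeomorph _ (WZero.approximates_const μ hμ)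
  const := max (1 + ‖μ‖₊) (1 - ‖μ‖₊)⁻¹
  lipschitz := (WZero.lipschitzWith_defMap μ).weaken (le_max_left _ _)
  lipschitz_symm := by
    refine LipschitzWith.weaken ?_ (le_max_right _ _)
    refine (WZero.antilipschitzWith μ hμ).to_rightInverse fun y => ?_
    exact ((WZero.approximatesLinearOn μ).toHomeomorph _
      (WZero.approximates_const μ hμ)).apply_symm_apply y

theorem WZero.homeo_map (hμ : ‖μ‖ < 1) : (WZero.homeo μ hμ).map = defMap μ := rfl

theorem WZero.ae_defDeriv_eq : ∀ᵐ x, HasFDerivAt (defMap μ) (defDeriv μ x) x := by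
  filter_upwards [W1inf.ae_hasFDerivAt μ.2.1] with x hx
  exact (hasFDerivAt_id x).add hx

theorem WZero.ae_isUnit_defDeriv (hμ : ‖μ‖ < 1) : ∀ᵐ x, IsUnit (defDeriv μ x) :=
  (WZero.ae_norm_deriv_le μ).mono fun _ hx => isUnit_id_add_of_norm_lt_one (hx.trans_lt hμ)

theorem inverse_adjoint_apply {A : RN N →L[ℝ] RN N} (hA : IsUnit A) (w : RN N) :
    (ContinuousLinearMap.adjoint A).inverse (ContinuousLinearMap.adjoint A w) = w ∧
    ContinuousLinearMap.adjoint A ((ContinuousLinearMap.adjoint A).inverse w) = w := by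
  have h : IsUnit (ContinuousLinearMap.adjoint A) := hA.star
  have hinv : (ContinuousLinearMap.adjoint A).IsInvertible := by
    obtain ⟨u, hu⟩ := h
    exact ⟨ContinuousLinearEquiv.unitsEquiv ℝ (RN N) u, by ext v; rw [← hu]; rfl⟩
  exact ⟨hinv.inverse_apply_self w, hinv.self_apply_inverse w⟩

theorem WZero.ae_defM_adjoint (hμ : ‖μ‖ < 1) : ∀ᵐ x, ∀ w,
    defM μ x (ContinuousLinearMap.adjoint (defDeriv μ x) w) = w ∧
    ContinuousLinearMap.adjoint (defDeriv μ x) (defM μ x w) = w :=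
  (WZero.ae_isUnit_defDeriv μ hμ).mono fun _ hx w => inverse_adjoint_apply hx w

theorem WZero.ae_fderiv_defMap : ∀ᵐ x, fderiv ℝ (defMap μ) x = defDeriv μ x :=
  (WZero.ae_defDeriv_eq μ).mono fun _ hx => hx.fderiv

theorem WZero.defMap_of_notMem {x : RN N} (hx : x ∈ Ω \ closure Dstar) : defMap μ x = x := by
  rw [defMap, μ.2.2 x hx, add_zero]

/-- Since `Ω` is a neighbourhood of the frontier, every frontier point is a limit of points of `Ω \
closure Dstar`, where the continuous field `μ` vanishes. -/
theorem WZero.apply_frontier (hΩ : IsOpen Ω) (hD : closure Dstar ⊆ Ω) {x : RN N}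
    (hx : x ∈ frontier (closure Dstar)) : μ.1.1 x = 0 := by
  have h1 : x ∈ closure (closure Dstar)ᶜ := by
    rw [frontier_eq_closure_inter_closure] at hx
    exact hx.2
  have h2 : x ∈ Ω := hD (isClosed_closure.frontier_subset hx)
  have h3 : x ∈ closure (Ω \ closure Dstar) := hΩ.inter_closure ⟨h2, h1⟩
  exact closure_minimal (fun y hy => μ.2.2 y hy)
    (isClosed_eq μ.1.1.continuous continuous_const) h3

theorem exists_mem_frontier_of_segment {E : Set (RN N)} (hE : IsClosed E) {x y : RN N}
    (h : (x ∈ E ∧ y ∉ E) ∨ (x ∉ E ∧ y ∈ E)) : ∃ z ∈ segment ℝ x y, z ∈ frontier E := by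
  by_contra! hcon
  have hpre : IsPreconnected (segment ℝ x y) := (convex_segment x y).isPreconnected
  have hsub : segment ℝ x y ⊆ interior E ∪ Eᶜ := by
    intro z hz
    by_cases hzE : z ∈ E
    · left
      by_contra hzi
      exact hcon z hz (by rw [hE.frontier_eq]; exact ⟨hzE, hzi⟩)
    · exact Or.inr hzE
  have hint : ∀ z ∈ segment ℝ x y, z ∈ E → z ∈ interior E := fun z hz hzE =>
    (hsub hz).resolve_right (not_not.2 hzE)
  have hne : (segment ℝ x y ∩ interior E).Nonempty ∧ (segment ℝ x y ∩ Eᶜ).Nonempty := by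
    rcases h with ⟨h1, h2⟩ | ⟨h1, h2⟩
    · exact ⟨⟨x, left_mem_segment ℝ x y, hint x (left_mem_segment ℝ x y) h1⟩,
        ⟨y, right_mem_segment ℝ x y, h2⟩⟩
    · exact ⟨⟨y, right_mem_segment ℝ x y, hint y (right_mem_segment ℝ x y) h2⟩,
        ⟨x, left_mem_segment ℝ x y, h1⟩⟩
  obtain ⟨z, -, hz1, hz2⟩ := hpre _ _ isOpen_interior hE.isOpen_compl hsub hne.1 hne.2
  exact hz2 (interior_subset hz1)

/-- If exactly one of `x` and `m x` lay in `closure Dstar`, the segment between them would meet the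
frontier at some `z` with `μ z = 0`. Then `|z - x| ≤ |μ x - μ z| ≤ ‖μ‖ |z - x|` forces `z = x`, so
`m x = x`, a contradiction. -/
theorem WZero.mem_closure_iff (hΩ : IsOpen Ω) (hD : closure Dstar ⊆ Ω) (hμ : ‖μ‖ < 1)
    (x : RN N) : x ∈ closure Dstar ↔ defMap μ x ∈ closure Dstar := by
  by_contra hcon
  have hor : (x ∈ closure Dstar ∧ defMap μ x ∉ closure Dstar) ∨
      (x ∉ closure Dstar ∧ defMap μ x ∈ closure Dstar) := by tauto
  obtain ⟨z, hz, hzf⟩ := exists_mem_frontier_of_segment isClosed_closure hor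
  have hz0 := WZero.apply_frontier μ hΩ hD hzf
  have h1 : dist z x ≤ dist x (defMap μ x) := segment_subset_closedBall_left x _ hz
  have h2 : dist x (defMap μ x) = dist (μ.1.1 x) (μ.1.1 z) := by
    rw [hz0, dist_zero_right, defMap, dist_self_add_right]
  have h3 := (WZero.lipschitzWith μ).dist_le_mul x z
  rw [coe_nnnorm, dist_comm x z] at h3
  have h4 : dist z x = 0 := by
    have := dist_nonneg (x := z) (y := x)
    nlinarith
  have h5 : x = z := (dist_eq_zero.1 h4).symm
  have h6 : defMap μ x = x := by rw [defMap, h5, hz0, add_zero]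
  rw [h6] at hor
  tauto

/-- Nothing is known of `μ` outside `Ω`. If `m x` lies in `Ω \ closure Dstar`, however, then `m`
fixes `m x`, and injectivity gives `m x = x`. -/
theorem WZero.mem_iff (hΩ : IsOpen Ω) (hD : closure Dstar ⊆ Ω) (hμ : ‖μ‖ < 1)
    (x : RN N) : x ∈ Ω ↔ defMap μ x ∈ Ω := by
  by_cases hx : x ∈ closure Dstar
  · exact ⟨fun _ => hD ((WZero.mem_closure_iff μ hΩ hD hμ x).1 hx), fun _ => hD hx⟩
  · have hmx : defMap μ x ∉ closure Dstar := fun h =>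
      hx ((WZero.mem_closure_iff μ hΩ hD hμ x).2 h)
    refine ⟨fun h => ?_, fun h => ?_⟩
    · rwa [WZero.defMap_of_notMem μ ⟨h, hx⟩]
    · have h1 := WZero.defMap_of_notMem μ ⟨h, hmx⟩
      have h2 : defMap μ x = x := (WZero.homeo μ hμ).injective_map h1
      rwa [h2] at h

theorem WZero.mem_diff_iff (hΩ : IsOpen Ω) (hD : closure Dstar ⊆ Ω) (hμ : ‖μ‖ < 1)
    (D₀ : Set (RN N)) (x : RN N) :
    x ∈ Ω \ closure D₀ ↔ (WZero.homeo μ hμ).map x ∈ Ω \ closure (defMap μ '' D₀) := by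
  have h1 : closure (defMap μ '' D₀) = defMap μ '' closure D₀ :=
    ((WZero.homeo μ hμ).toHomeomorph.image_closure D₀).symm
  have h2 : defMap μ x ∈ defMap μ '' closure D₀ ↔ x ∈ closure D₀ :=
    (WZero.homeo μ hμ).injective_map.mem_set_image
  rw [WZero.homeo_map, h1, Set.mem_sdiff, Set.mem_sdiff, WZero.mem_iff μ hΩ hD hμ x, h2]

theorem WZero.ae_defDeriv_of_notMem (hΩ : IsOpen Ω) :
    ∀ᵐ x, x ∈ Ω \ closure Dstar → defDeriv μ x = ContinuousLinearMap.id ℝ (RN N) := by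
  filter_upwards [WZero.ae_defDeriv_eq μ] with x hx hxm
  refine hx.unique ((hasFDerivAt_id x).congr_of_eventuallyEq ?_)
  filter_upwards [(hΩ.sdiff isClosed_closure).mem_nhds hxm] with y hy
  exact WZero.defMap_of_notMem μ hy

end DeformationGeometry

/-! ### Invariance of the liftings under the deformation. -/

section Lifting

open Filter Topology Set
open scoped ENNReal NNReal Manifold

variable {N : ℕ}

/-- The cutoff equals `1` near each point of `K`, not only on `K`, so that its gradient vanishes
there. -/
theorem exists_isTestFunction_eq_one {K U : Set (RN N)} (hK : IsCompact K) (hU : IsOpen U)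
    (hKU : K ⊆ U) : ∃ χ : RN N → ℝ, IsTestFunction U χ ∧ ∀ x ∈ K, χ =ᶠ[𝓝 x] fun _ => 1 := by
  obtain ⟨δ, hδ, hδU⟩ := hK.exists_cthickening_subset_open hU hKU
  have hint : K ⊆ interior (Metric.cthickening δ K) :=
    (Metric.self_subset_thickening hδ K).trans
      (interior_maximal (Metric.thickening_subset_cthickening δ K) Metric.isOpen_thickening)
  obtain ⟨f, hf1, hf0, -⟩ := exists_contMDiffMap_one_nhds_of_subset_interior (n := ⊤)
    (𝓘(ℝ, RN N)) hK.isClosed hint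
  have hts : tsupport f ⊆ Metric.cthickening δ K := by
    refine closure_minimal (fun x hx => ?_) Metric.isClosed_cthickening
    by_contra hcon
    exact hx (hf0 x hcon)
  refine ⟨f, ⟨f.contMDiff.contDiff, hK.cthickening.of_isClosed_subset (isClosed_tsupport _) hts,
    hts.trans hδU⟩, fun x hx => ?_⟩
  exact mem_nhdsSet_iff_forall.1 hf1 x hx

theorem memLp_of_restrict_of_forall_notMem {F : Type*} [NormedAddCommGroup F] {U : Set (RN N)}
    (hU : MeasurableSet U) {f : RN N → F} (hf : MemLp f 2 (volume.restrict U))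
    (h0 : ∀ x, x ∉ U → f x = 0) : MemLp f 2 volume := by
  have : U.indicator f = f := indicator_eq_self.2 fun x hx => by
    by_contra hcon
    exact hx (h0 x hcon)
  rw [← this, memLp_indicator_iff_restrict hU]
  exact hf

theorem IsTestFunction.gradient_eq_zero {U : Set (RN N)} {χ : RN N → ℝ}
    (hχ : IsTestFunction U χ) {x : RN N} (hx : x ∉ U) : gradient χ x = 0 := by
  have : x ∉ tsupport (fderiv ℝ χ) := fun hx' =>
    hx (hχ.tsupport_subset (tsupport_fderiv_subset ℝ hx'))
  rw [gradient, image_eq_zero_of_notMem_tsupport this, map_zero]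

theorem IsTestFunction.exists_bound {U : Set (RN N)} {χ : RN N → ℝ} (hχ : IsTestFunction U χ) :
    ∃ C : ℝ, ∀ x, ‖χ x‖ ≤ C ∧ ‖gradient χ x‖ ≤ C := by
  obtain ⟨D, hD⟩ := hχ.exists_lipschitzWith
  obtain ⟨C, hC⟩ := hχ.contDiff.continuous.bounded_above_of_compact_support hχ.hasCompactSupport
  exact ⟨max C D, fun x => ⟨(hC x).trans (le_max_left _ _),
    (hD.norm_gradient_le x).trans (le_max_right _ _)⟩⟩

/-- The product rule for weak derivatives; compact support of the cutoff then gives membership in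
`H¹₀`. -/
theorem H1.exists_cutoff_mem_H10 {U : Set (RN N)} (hU : IsOpen U) {p : L2Pair U}
    (hp : p ∈ H1 U) {χ : RN N → ℝ} (hχ : IsTestFunction U χ) :
    ∃ q ∈ H10 U, (q.fn =ᵐ[volume.restrict U] fun x => χ x * p.fn x) ∧
      q.grad =ᵐ[volume.restrict U] fun x => χ x • p.grad x + p.fn x • gradient χ x := by
  obtain ⟨C, hC⟩ := hχ.exists_bound
  have m1 : MemLp (fun x => χ x * p.fn x) 2 (volume.restrict U) :=
    p.memLp_fn.of_le_mul (hχ.contDiff.continuous.aestronglyMeasurable.mul p.memLp_fn.1)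
      (c := C) (Eventually.of_forall fun x => by
        rw [norm_mul]; exact mul_le_mul_of_nonneg_right (hC x).1 (norm_nonneg _))
  have m2 : MemLp (fun x => χ x • p.grad x) 2 (volume.restrict U) :=
    p.memLp_grad.of_le_mul (hχ.contDiff.continuous.aestronglyMeasurable.smul p.memLp_grad.1)
      (c := C) (Eventually.of_forall fun x => by
        rw [norm_smul]; exact mul_le_mul_of_nonneg_right (hC x).1 (norm_nonneg _))
  have m3 : MemLp (fun x => p.fn x • gradient χ x) 2 (volume.restrict U) :=
    p.memLp_fn.of_le_mul (p.memLp_fn.1.smul hχ.continuous_gradient.aestronglyMeasurable)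
      (c := C) (Eventually.of_forall fun x => by
        rw [norm_smul, mul_comm]; exact mul_le_mul_of_nonneg_right (hC x).2 (norm_nonneg _))
  have hχ0 : ∀ x, x ∉ tsupport χ → χ x = 0 := fun x hx => image_eq_zero_of_notMem_tsupport hx
  have hχ0' : ∀ x, x ∉ U → χ x = 0 := fun x hx => hχ0 x fun h => hx (hχ.tsupport_subset h)
  refine exists_mem_H10_of_hasWeakDeriv hU hχ.hasCompactSupport hχ.tsupport_subset
    (memLp_of_restrict_of_forall_notMem hU.measurableSet m1 fun x hx => by rw [hχ0' x hx, zero_mul])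
    (memLp_of_restrict_of_forall_notMem hU.measurableSet (m2.add m3) fun x hx => by
      simp [hχ0' x hx, hχ.gradient_eq_zero hx])
    ?_ (fun x hx => by rw [hχ0 x hx, zero_mul])
  intro θ hθ v
  rw [Measure.restrict_univ]
  -- The function `θ` may be supported anywhere, but `θ χ` is a test function in `U`, where the weak
  -- derivative of `p` is available.
  have hθχ : IsTestFunction U (fun x => θ x * χ x) :=
    ⟨hθ.contDiff.mul hχ.contDiff, hχ.hasCompactSupport.mul_left,
      (tsupport_mul_subset_right).trans hχ.tsupport_subset⟩
  have key := hp _ hθχ v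
  have hd : ∀ x, fderiv ℝ (fun x => θ x * χ x) x v
      = θ x * fderiv ℝ χ x v + χ x * fderiv ℝ θ x v := by
    intro x
    rw [fderiv_fun_mul (hθ.contDiff.differentiable (by simp) x)
      (hχ.contDiff.differentiable (by simp) x)]
    simp
  have i1 : Integrable (fun x => fderiv ℝ (fun x => θ x * χ x) x v • p.fn x)
      (volume.restrict U) := hθχ.integrable_fderiv_smul v p.locallyIntegrable_fn
  have i2 : Integrable (fun x => (θ x * χ x) • innerSL ℝ (p.grad x) v) (volume.restrict U) :=
    hθχ.integrable_smul_apply v p.locallyIntegrable_innerSL_grad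
  have i3 : Integrable (fun x => (θ x * fderiv ℝ χ x v) * p.fn x) (volume.restrict U) := by
    refine p.locallyIntegrable_fn.integrable_smul_left_of_hasCompactSupport
      (f := p.fn) (g := fun x => θ x * fderiv ℝ χ x v) ?_ hθ.hasCompactSupport.mul_right
    exact hθ.contDiff.continuous.mul ((hχ.contDiff.continuous_fderiv (by simp)).clm_apply
      continuous_const)
  have e1 : ∫ x, (fderiv ℝ θ x v) • (χ x * p.fn x)
      = ∫ x in U, (fderiv ℝ θ x v) • (χ x * p.fn x) :=
    (setIntegral_eq_integral_of_forall_compl_eq_zero fun x hx => by simp [hχ0' x hx]).symm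
  have e2 : ∫ x, θ x • innerSL ℝ (χ x • p.grad x + p.fn x • gradient χ x) v
      = ∫ x in U, θ x • innerSL ℝ (χ x • p.grad x + p.fn x • gradient χ x) v :=
    (setIntegral_eq_integral_of_forall_compl_eq_zero fun x hx => by
      simp [hχ0' x hx, hχ.gradient_eq_zero hx]).symm
  have e3 : ∫ x in U, (fderiv ℝ θ x v) • (χ x * p.fn x)
      = ∫ x in U, (fderiv ℝ (fun x => θ x * χ x) x v • p.fn x
        - (θ x * fderiv ℝ χ x v) * p.fn x) := by
    refine integral_congr_ae (Eventually.of_forall fun x => ?_)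
    simp only [hd, smul_eq_mul]
    ring
  have e4 : ∫ x in U, θ x • innerSL ℝ (χ x • p.grad x + p.fn x • gradient χ x) v
      = ∫ x in U, ((θ x * χ x) • innerSL ℝ (p.grad x) v
        + (θ x * fderiv ℝ χ x v) * p.fn x) := by
    refine integral_congr_ae (Eventually.of_forall fun x => ?_)
    simp only [map_add, map_smul, _root_.add_apply, _root_.smul_apply, innerSL_gradient,
      smul_eq_mul]
    ring
  rw [e1, e2, e3, e4, integral_sub i1 i3, integral_add i2 i3, key]
  ring

variable {Ω Dstar : Set (RN N)} (μ : WZero Ω Dstar)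

/-- On `closure Dstar`, which `m` preserves, both sides vanish almost everywhere, because preimages
of null sets under `m` are null. On the rest of `Ω`, `m` is the identity. -/
theorem WZero.comp_defMap_ae_eq (hΩ : IsOpen Ω) (hD : closure Dstar ⊆ Ω) (hμ : ‖μ‖ < 1)
    {f : RN N → ℝ} (hf : ∀ᵐ x ∂volume.restrict (closure Dstar), f x = 0) :
    (fun x => f (defMap μ x)) =ᵐ[volume.restrict Ω] f := by
  rw [ae_restrict_iff' isClosed_closure.measurableSet] at hf
  rw [Filter.EventuallyEq, ae_restrict_iff' hΩ.measurableSet]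
  filter_upwards [hf, (WZero.homeo μ hμ).quasiMeasurePreserving.ae hf] with x h1 h2 hx
  by_cases hxD : x ∈ closure Dstar
  · rw [h1 hxD]
    exact h2 ((WZero.mem_closure_iff μ hΩ hD hμ x).1 hxD)
  · rw [WZero.defMap_of_notMem μ ⟨hx, hxD⟩]

/-- The pullback rule for weak gradients is available in `H¹₀`, whereas `φ` is only in `H¹`.
Multiplying `φ` by a cutoff equal to `1` near `closure Dstar` gives an element of `H¹₀` that agrees
with its own pullback, so their gradients agree. Off `closure Dstar` one has `m' = I`. -/
theorem WZero.adjoint_defDeriv_grad (hΩ : IsOpen Ω) (hΩb : Bornology.IsBounded Ω)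
    (hD : closure Dstar ⊆ Ω) (hμ : ‖μ‖ < 1) (φ : H1 Ω)
    (hφ : ∀ᵐ x ∂volume.restrict (closure Dstar), φ.1.fn x = 0) :
    ∀ᵐ x ∂volume.restrict Ω,
      ContinuousLinearMap.adjoint (defDeriv μ x) (φ.1.grad (defMap μ x)) = φ.1.grad x := by
  have hK : IsCompact (closure Dstar) :=
    Metric.isCompact_of_isClosed_isBounded isClosed_closure (hΩb.subset hD)
  obtain ⟨χ, hχ, hχ1⟩ := exists_isTestFunction_eq_one hK hΩ hD
  obtain ⟨q, hq, hq1, hq2⟩ := H1.exists_cutoff_mem_H10 hΩ φ.2 hχ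
  set e := WZero.homeo μ hμ
  have hm : ∀ x, x ∈ Ω ↔ e.map x ∈ Ω := WZero.mem_iff μ hΩ hD hμ
  have hχφ : ∀ᵐ x ∂volume.restrict (closure Dstar), χ x * φ.1.fn x = 0 :=
    hφ.mono fun x hx => by rw [hx, mul_zero]
  have hfn : (e.pullback hΩ.measurableSet hm q).fn =ᵐ[volume.restrict Ω] q.fn := by
    filter_upwards [e.pullback_fn hΩ.measurableSet hm q, hq1, e.ae_comp hΩ.measurableSet hm hq1,
      WZero.comp_defMap_ae_eq μ hΩ hD hμ hχφ] with x h1 h2 h3 h4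
    rw [h1, h3, h2]
    exact h4
  have hgr := H1.grad_ae_eq hΩ
    (H10_le_H1 Ω (e.pullback_mem_H10 hΩ.measurableSet hΩ hm hq)) (H10_le_H1 Ω hq) hfn
  have hloc : ∀ x ∈ closure Dstar,
      χ x • φ.1.grad x + φ.1.fn x • gradient χ x = φ.1.grad x := by
    intro x hx
    have h1 : gradient χ x = 0 := by
      rw [gradient, (hχ1 x hx).fderiv_eq]
      simp
    rw [h1, (hχ1 x hx).eq_of_nhds, one_smul, smul_zero, add_zero]
  filter_upwards [hgr, e.pullback_grad hΩ.measurableSet hm q, hq2,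
    e.ae_comp hΩ.measurableSet hm hq2, ae_restrict_of_ae (WZero.ae_fderiv_defMap μ),
    ae_restrict_of_ae (WZero.ae_defDeriv_of_notMem μ hΩ),
    ae_restrict_mem hΩ.measurableSet] with x h1 h2 h3 h4 h5 h6 hx
  by_cases hxD : x ∈ closure Dstar
  · have h7 := h2.symm.trans h1
    rw [h3, h4, hloc x hxD, hloc (e.map x) ((WZero.mem_closure_iff μ hΩ hD hμ x).1 hxD)] at h7
    rw [← h5]
    exact h7
  · rw [h6 ⟨hx, hxD⟩, WZero.defMap_of_notMem μ ⟨hx, hxD⟩, ContinuousLinearMap.adjoint_id]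
    rfl

end Lifting

/-! ### Lax–Milgram and the Poincaré inequality on subdomains. -/

section LaxMilgram

open Filter Topology Set
open scoped ENNReal NNReal

theorem bijective_of_coercive {V : Type*} [NormedAddCommGroup V] [InnerProductSpace ℝ V]
    [CompleteSpace V] (B : V →L[ℝ] V →L[ℝ] ℝ) {c : ℝ} (hc : 0 < c)
    (hB : ∀ v, c * ‖v‖ ^ 2 ≤ B v v) : Function.Bijective B := by
  have hB' : IsCoercive B := ⟨c, hc, fun u => by
    have := hB u
    rwa [pow_two, ← mul_assoc] at this⟩
  constructor
  · rw [injective_iff_map_eq_zero]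
    intro v hv
    have h1 := hB v
    rw [hv, _root_.zero_apply] at h1
    have h2 : ‖v‖ ^ 2 ≤ 0 := by
      by_contra! h
      exact absurd h1 (not_le.2 (mul_pos hc h))
    exact norm_eq_zero.1 (pow_eq_zero_iff two_ne_zero |>.1 (le_antisymm h2 (sq_nonneg _)))
  · intro ℓ
    refine ⟨hB'.continuousLinearEquivOfBilin.symm ((InnerProductSpace.toDual ℝ V).symm ℓ),
      ContinuousLinearMap.ext fun w => ?_⟩
    rw [← hB'.continuousLinearEquivOfBilin_apply, ContinuousLinearEquiv.apply_symm_apply,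
      InnerProductSpace.toDual_symm_apply]

variable {N : ℕ}

theorem L2Pair.norm_fst_sq {U : Set (RN N)} (p : L2Pair U) :
    ‖p.fst‖ ^ 2 = ∫ x in U, p.fn x ^ 2 := by
  rw [← real_inner_self_eq_norm_sq, L2.inner_def]
  refine integral_congr_ae (Eventually.of_forall fun x => ?_)
  simp only [real_inner_self_eq_norm_sq, Real.norm_eq_abs, sq_abs, L2Pair.fn]

theorem L2Pair.norm_snd_sq {U : Set (RN N)} (p : L2Pair U) :
    ‖p.snd‖ ^ 2 = ∫ x in U, ‖p.grad x‖ ^ 2 := by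
  rw [← real_inner_self_eq_norm_sq, L2.inner_def]
  refine integral_congr_ae (Eventually.of_forall fun x => ?_)
  simp only [real_inner_self_eq_norm_sq, L2Pair.grad]

theorem L2Pair.norm_sq {U : Set (RN N)} (p : L2Pair U) :
    ‖p‖ ^ 2 = ‖p.fst‖ ^ 2 + ‖p.snd‖ ^ 2 := WithLp.prod_norm_sq_eq_of_L2 p

theorem IsTestFunction.add {U : Set (RN N)} {θ η : RN N → ℝ} (hθ : IsTestFunction U θ)
    (hη : IsTestFunction U η) : IsTestFunction U (fun x => θ x + η x) :=
  ⟨hθ.contDiff.add hη.contDiff, hθ.hasCompactSupport.add hη.hasCompactSupport,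
    (tsupport_add θ η).trans (union_subset hθ.tsupport_subset hη.tsupport_subset)⟩

theorem IsTestFunction.const_smul {U : Set (RN N)} {θ : RN N → ℝ} (hθ : IsTestFunction U θ)
    (c : ℝ) : IsTestFunction U (fun x => c • θ x) :=
  ⟨hθ.contDiff.const_smul c, hθ.hasCompactSupport.smul_left (f := fun _ => c),
    (closure_mono (Function.support_const_smul_subset c θ)).trans hθ.tsupport_subset⟩

theorem IsTestFunction.zero {U : Set (RN N)} : IsTestFunction U (fun _ => (0 : ℝ)) :=
  ⟨contDiff_const, HasCompactSupport.zero, by simp [tsupport]⟩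

/-- Test functions already form a subspace, so the span in the definition of `H10` adds nothing. -/
theorem exists_isTestFunction_of_mem_span {U : Set (RN N)} {p : L2Pair U}
    (hp : p ∈ Submodule.span ℝ {p : L2Pair U | ∃ θ : RN N → ℝ, IsTestFunction U θ ∧
      p.fn =ᵐ[volume.restrict U] θ ∧
      p.grad =ᵐ[volume.restrict U] fun x => gradient θ x}) :
    ∃ θ : RN N → ℝ, IsTestFunction U θ ∧ p.fn =ᵐ[volume.restrict U] θ ∧
      p.grad =ᵐ[volume.restrict U] fun x => gradient θ x := by
  induction hp using Submodule.span_induction with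
  | mem q hq => exact hq
  | zero =>
    refine ⟨_, IsTestFunction.zero, Lp.coeFn_zero ℝ 2 _, ?_⟩
    filter_upwards [Lp.coeFn_zero (RN N) 2 (volume.restrict U)] with x hx
    refine Eq.trans hx ?_
    simp [gradient]
  | add p q _ _ hp hq =>
    obtain ⟨θ, hθ, h1, h2⟩ := hp
    obtain ⟨η, hη, h3, h4⟩ := hq
    refine ⟨_, hθ.add hη, ?_, ?_⟩
    · filter_upwards [Lp.coeFn_add p.fst q.fst, h1, h3] with x e1 e2 e3
      rw [← e2, ← e3]; exact e1
    · filter_upwards [Lp.coeFn_add p.snd q.snd, h2, h4] with x e1 e2 e3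
      refine (e1.trans (congrArg₂ (· + ·) e2 e3)).trans ?_
      · rw [gradient, gradient, gradient, fderiv_fun_add (hθ.contDiff.differentiable (by simp) x)
          (hη.contDiff.differentiable (by simp) x), map_add]
  | smul c p _ hp =>
    obtain ⟨θ, hθ, h1, h2⟩ := hp
    refine ⟨_, hθ.const_smul c, ?_, ?_⟩
    · filter_upwards [Lp.coeFn_smul c p.fst, h1] with x e1 e2
      rw [← e2]; exact e1
    · filter_upwards [Lp.coeFn_smul c p.snd, h2] with x e1 e2
      refine (e1.trans (congrArg (c • ·) e2)).trans ?_
      · rw [gradient, gradient, fderiv_fun_const_smul (hθ.contDiff.differentiable (by simp) x),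
          map_smul]

/-- A test function in `U` is one in `Ω` with the same integrals, and the inequality is closed in
the `H¹` norm. -/
theorem H10.norm_fst_sq_le_of_subset {U Ω : Set (RN N)} (hUΩ : U ⊆ Ω) {C : ℝ}
    (hC : ∀ u ∈ H10 Ω, ∫ x in Ω, u.fn x ^ 2 ≤ C * ∫ x in Ω, ‖u.grad x‖ ^ 2) {u : L2Pair U}
    (hu : u ∈ H10 U) : ‖u.fst‖ ^ 2 ≤ C * ‖u.snd‖ ^ 2 := by
  have c1 : Continuous fun p : L2Pair U => p.fst :=
    continuous_fst.comp (WithLp.prod_continuous_ofLp 2 _ _)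
  have c2 : Continuous fun p : L2Pair U => p.snd :=
    continuous_snd.comp (WithLp.prod_continuous_ofLp 2 _ _)
  have hcl : IsClosed {p : L2Pair U | ‖p.fst‖ ^ 2 ≤ C * ‖p.snd‖ ^ 2} :=
    isClosed_le (c1.norm.pow 2) (continuous_const.mul (c2.norm.pow 2))
  refine closure_minimal (fun p hp => ?_) hcl hu
  obtain ⟨θ, hθ, h1, h2⟩ := exists_isTestFunction_of_mem_span hp
  have hθ' := hθ.mono hUΩ
  have key := hC _ hθ'.mk_mem_H10
  have e1 : ∫ x in Ω, (L2Pair.mk (U := Ω) hθ'.memLp hθ'.memLp_gradient).fn x ^ 2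
      = ∫ x in U, p.fn x ^ 2 := by
    have i1 : ∫ x in Ω, (L2Pair.mk (U := Ω) hθ'.memLp hθ'.memLp_gradient).fn x ^ 2
        = ∫ x in Ω, θ x ^ 2 := integral_congr_ae
      ((L2Pair.mk_fn hθ'.memLp hθ'.memLp_gradient).mono fun x hx => by simp only [hx])
    have i2 : ∫ x in U, p.fn x ^ 2 = ∫ x in U, θ x ^ 2 := integral_congr_ae
      (h1.mono fun x hx => by simp only [hx])
    have hz : ∀ x, x ∉ U → θ x ^ 2 = 0 := fun x hx => by
      rw [image_eq_zero_of_notMem_tsupport fun h => hx (hθ.tsupport_subset h)]; simp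
    rw [i1, i2, setIntegral_eq_integral_of_forall_compl_eq_zero fun x hx => hz x hx,
      setIntegral_eq_integral_of_forall_compl_eq_zero fun x hx => hz x fun h => hx (hUΩ h)]
  have e2 : ∫ x in Ω, ‖(L2Pair.mk (U := Ω) hθ'.memLp hθ'.memLp_gradient).grad x‖ ^ 2
      = ∫ x in U, ‖p.grad x‖ ^ 2 := by
    have i1 : ∫ x in Ω, ‖(L2Pair.mk (U := Ω) hθ'.memLp hθ'.memLp_gradient).grad x‖ ^ 2
        = ∫ x in Ω, ‖gradient θ x‖ ^ 2 := integral_congr_ae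
      ((L2Pair.mk_grad hθ'.memLp hθ'.memLp_gradient).mono fun x hx => by simp only [hx])
    have i2 : ∫ x in U, ‖p.grad x‖ ^ 2 = ∫ x in U, ‖gradient θ x‖ ^ 2 := integral_congr_ae
      (h2.mono fun x hx => by simp only [hx])
    have hz : ∀ x, x ∉ U → ‖gradient θ x‖ ^ 2 = 0 := fun x hx => by
      rw [hθ.gradient_eq_zero hx]; simp
    rw [i1, i2, setIntegral_eq_integral_of_forall_compl_eq_zero fun x hx => hz x hx,
      setIntegral_eq_integral_of_forall_compl_eq_zero fun x hx => hz x fun h => hx (hUΩ h)]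
  rw [e1, e2] at key
  change ‖p.fst‖ ^ 2 ≤ C * ‖p.snd‖ ^ 2
  rw [p.norm_fst_sq, p.norm_snd_sq]
  exact key

/-- The infimum need not be known to be attained: `λ < μ₁(Ω)⁻¹` leaves room for an admissible
constant `C` with `λ C < 1`. -/
theorem AdmissibleCoeffs.exists_poincare {Ω : Set (RN N)} {a b A B : ℝ}
    (h : AdmissibleCoeffs Ω a b A B) : ∃ lam C : ℝ, 0 < lam ∧ 0 < C ∧ lam * C < 1 ∧
      (∀ u ∈ H10 Ω, ∫ x in Ω, u.fn x ^ 2 ≤ C * ∫ x in Ω, ‖u.grad x‖ ^ 2) ∧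
      ∀ ξ₁ ξ₂ : ℝ, -lam * (ξ₁ ^ 2 + ξ₂ ^ 2) ≤
        a * ξ₁ * ξ₁ + b * ξ₁ * ξ₂ + A * ξ₂ * ξ₁ + B * ξ₂ * ξ₂ := by
  obtain ⟨lam, h0, h1, h2⟩ := h
  have hP : 0 < poincareConst Ω := inv_pos.1 (h0.trans h1)
  have hne : {C : ℝ | 0 < C ∧ ∀ u ∈ H10 Ω,
      ∫ x in Ω, u.fn x ^ 2 ≤ C * ∫ x in Ω, ‖u.grad x‖ ^ 2}.Nonempty := by
    by_contra hcon
    rw [not_nonempty_iff_eq_empty] at hcon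
    -- If no Poincaré constant existed, the infimum would take its default value `0`, contradicting
    -- `hP`.
    rw [poincareConst, hcon, Real.sInf_empty] at hP
    exact lt_irrefl _ hP
  have h3 : poincareConst Ω < lam⁻¹ := (lt_inv_comm₀ h0 hP).1 h1
  obtain ⟨C, ⟨hC0, hC⟩, hC1⟩ := exists_lt_of_csInf_lt hne h3
  refine ⟨lam, C, h0, hC0, ?_, hC, h2⟩
  calc lam * C < lam * lam⁻¹ := by gcongr
    _ = 1 := mul_inv_cancel₀ h0.ne'

instance H10.instCompleteSpace (U : Set (RN N)) : CompleteSpace (H10 U) :=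
  (Submodule.isClosed_topologicalClosure _).completeSpace_coe

end LaxMilgram

/-! ### The system as an operator equation, and analytic dependence of its solution. -/

section SystemForm

open Filter Topology Set
open scoped ENNReal NNReal

theorem AnalyticAt.continuousLinearMap_comp {X E F : Type*} [NormedAddCommGroup X]
    [NormedSpace ℝ X] [NormedAddCommGroup E] [NormedSpace ℝ E] [NormedAddCommGroup F]
    [NormedSpace ℝ F] (L : E →L[ℝ] F) {f : X → E} {x : X} (hf : AnalyticAt ℝ f x) :
    AnalyticAt ℝ (fun y => L (f y)) x := by
  have h := ContinuousLinearMap.analyticAt (𝕜 := ℝ) (E := E) (F := F) L (f x)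
  exact h.comp hf

theorem AnalyticAt.continuousLinearMap_apply {X E F : Type*} [NormedAddCommGroup X]
    [NormedSpace ℝ X] [NormedAddCommGroup E] [NormedSpace ℝ E] [NormedAddCommGroup F]
    [NormedSpace ℝ F] {T : X → E →L[ℝ] F} {v : X → E} {x : X} (hT : AnalyticAt ℝ T x)
    (hv : AnalyticAt ℝ v x) : AnalyticAt ℝ (fun y => T y (v y)) x := by
  have h := (ContinuousLinearMap.id ℝ (E →L[ℝ] F)).analyticAt_bilinear (T x, v x)
  exact AnalyticAt.comp (f := fun y => (T y, v y)) h (hT.prod hv)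

section Abstract

variable {H H' E : Type*} [NormedAddCommGroup H] [InnerProductSpace ℝ H]
  [NormedAddCommGroup H'] [InnerProductSpace ℝ H']
  [NormedAddCommGroup E] [InnerProductSpace ℝ E]

/-- The bilinear form `(w, t) ↦ ⟪K (π w), π' t⟫`, as a function of `K`. -/
noncomputable def operatorForm {V : Type*} [NormedAddCommGroup V] [NormedSpace ℝ V]
    (π π' : V →L[ℝ] H) : (H →L[ℝ] H) →L[ℝ] (V →L[ℝ] V →L[ℝ] ℝ) :=
  (ContinuousLinearMap.compL ℝ V H (V →L[ℝ] ℝ)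
    (((ContinuousLinearMap.compL ℝ V H ℝ).flip π').comp
      (isBoundedBilinearMap_inner (𝕜 := ℝ) (E := H)).toContinuousLinearMap)).comp
    ((ContinuousLinearMap.compL ℝ V H H).flip π)

/-- The functional `t ↦ ⟪K γ, π' t⟫`, as a function of `K`. -/
noncomputable def operatorFunctional {V : Type*} [NormedAddCommGroup V] [NormedSpace ℝ V]
    (γ : H) (π' : V →L[ℝ] H) : (H →L[ℝ] H) →L[ℝ] (V →L[ℝ] ℝ) :=
  (((ContinuousLinearMap.compL ℝ V H ℝ).flip π').comp
      (isBoundedBilinearMap_inner (𝕜 := ℝ) (E := H)).toContinuousLinearMap).comp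
    (ContinuousLinearMap.apply ℝ H γ)

/-- The bilinear form of the system on gradients `γ` and functions `η`, for an operator `K` acting
on gradients and an operator `Q` acting on functions. -/
def systemForm (a b A B : ℝ) (K : H →L[ℝ] H) (Q : H' →L[ℝ] H') (γ₁ γ₂ : H) (η₁ η₂ : H')
    (δ₁ δ₂ : H) (θ₁ θ₂ : H') : ℝ :=
  ⟪K γ₁, δ₁⟫_ℝ + ⟪K γ₂, δ₂⟫_ℝ + (a * ⟪Q η₁, θ₁⟫_ℝ + b * ⟪Q η₂, θ₁⟫_ℝ
    + A * ⟪Q η₁, θ₂⟫_ℝ + B * ⟪Q η₂, θ₂⟫_ℝ)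

section Hilbert

variable {V : Type*} [NormedAddCommGroup V] [InnerProductSpace ℝ V]

/-- The bilinear form of the system as a continuous bilinear form on `V`. -/
noncomputable def systemFormL (a b A B : ℝ) (g₁ g₂ : V →L[ℝ] H) (f₁ f₂ : V →L[ℝ] H')
    (K : H →L[ℝ] H) (Q : H' →L[ℝ] H') : V →L[ℝ] V →L[ℝ] ℝ :=
  operatorForm g₁ g₁ K + operatorForm g₂ g₂ K
    + (a • operatorForm f₁ f₁ Q + b • operatorForm f₂ f₁ Q
      + A • operatorForm f₁ f₂ Q + B • operatorForm f₂ f₂ Q)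

/-- The system form with a fixed first argument as a functional on `V`. -/
noncomputable def systemFunctional (a b A B : ℝ) (g₁ g₂ : V →L[ℝ] H) (f₁ f₂ : V →L[ℝ] H')
    (γ₁ γ₂ : H) (η₁ η₂ : H') (K : H →L[ℝ] H) (Q : H' →L[ℝ] H') : V →L[ℝ] ℝ :=
  operatorFunctional γ₁ g₁ K + operatorFunctional γ₂ g₂ K
    + (a • operatorFunctional η₁ f₁ Q + b • operatorFunctional η₂ f₁ Q
      + A • operatorFunctional η₁ f₂ Q + B • operatorFunctional η₂ f₂ Q)

variable {X : Type*} [NormedAddCommGroup X] [NormedSpace ℝ X] {x : X}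
  {K : X → H →L[ℝ] H} {Q : X → H' →L[ℝ] H'}

theorem analyticAt_systemFormL (a b A B : ℝ) (g₁ g₂ : V →L[ℝ] H) (f₁ f₂ : V →L[ℝ] H')
    (hK : AnalyticAt ℝ K x) (hQ : AnalyticAt ℝ Q x) :
    AnalyticAt ℝ (fun y => systemFormL a b A B g₁ g₂ f₁ f₂ (K y) (Q y)) x := by
  have hK' : ∀ π π' : V →L[ℝ] H, AnalyticAt ℝ (fun y => operatorForm π π' (K y)) x :=
    fun π π' => AnalyticAt.continuousLinearMap_comp (E := H →L[ℝ] H) (F := V →L[ℝ] V →L[ℝ] ℝ)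
      (operatorForm π π') hK
  have hQ' : ∀ (π π' : V →L[ℝ] H') (c : ℝ),
      AnalyticAt ℝ (fun y => c • operatorForm π π' (Q y)) x := fun π π' c =>
    AnalyticAt.continuousLinearMap_comp (E := H' →L[ℝ] H') (F := V →L[ℝ] V →L[ℝ] ℝ)
      (c • operatorForm π π') hQ
  exact ((hK' _ _).add (hK' _ _)).add
    ((((hQ' _ _ a).add (hQ' _ _ b)).add (hQ' _ _ A)).add (hQ' _ _ B))

theorem analyticAt_systemFunctional (a b A B : ℝ) (g₁ g₂ : V →L[ℝ] H) (f₁ f₂ : V →L[ℝ] H')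
    (γ₁ γ₂ : H) (η₁ η₂ : H') (hK : AnalyticAt ℝ K x) (hQ : AnalyticAt ℝ Q x) :
    AnalyticAt ℝ (fun y => systemFunctional a b A B g₁ g₂ f₁ f₂ γ₁ γ₂ η₁ η₂ (K y) (Q y)) x := by
  have hK' : ∀ (γ : H) (π' : V →L[ℝ] H),
      AnalyticAt ℝ (fun y => operatorFunctional γ π' (K y)) x :=
    fun π π' => AnalyticAt.continuousLinearMap_comp (E := H →L[ℝ] H) (F := V →L[ℝ] ℝ)
      (operatorFunctional π π') hK
  have hQ' : ∀ (γ : H') (π' : V →L[ℝ] H') (c : ℝ),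
      AnalyticAt ℝ (fun y => c • operatorFunctional γ π' (Q y)) x := fun π π' c =>
    AnalyticAt.continuousLinearMap_comp (E := H' →L[ℝ] H') (F := V →L[ℝ] ℝ)
      (c • operatorFunctional π π') hQ
  exact ((hK' _ _).add (hK' _ _)).add
    ((((hQ' _ _ a).add (hQ' _ _ b)).add (hQ' _ _ A)).add (hQ' _ _ B))

theorem existsUnique_systemForm [CompleteSpace V] {a b A B : ℝ} {g₁ g₂ : V →L[ℝ] H}
    {f₁ f₂ : V →L[ℝ] H'} {c : ℝ} (hc : 0 < c)
    (h : ∀ v, c * ‖v‖ ^ 2 ≤ systemForm a b A B (1 : H →L[ℝ] H) (1 : H' →L[ℝ] H')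
      (g₁ v) (g₂ v) (f₁ v) (f₂ v) (g₁ v) (g₂ v) (f₁ v) (f₂ v))
    (γ₁ γ₂ : H) (η₁ η₂ : H') :
    ∃! w : V, ∀ t : V, systemForm a b A B (1 : H →L[ℝ] H) (1 : H' →L[ℝ] H')
        (g₁ w) (g₂ w) (f₁ w) (f₂ w) (g₁ t) (g₂ t) (f₁ t) (f₂ t)
      = -systemForm a b A B (1 : H →L[ℝ] H) (1 : H' →L[ℝ] H') γ₁ γ₂ η₁ η₂
        (g₁ t) (g₂ t) (f₁ t) (f₂ t) := by
  obtain ⟨w, hw, hu⟩ := (bijective_of_coercive (systemFormL a b A B g₁ g₂ f₁ f₂ 1 1) hc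
    h).existsUnique (-systemFunctional a b A B g₁ g₂ f₁ f₂ γ₁ γ₂ η₁ η₂ 1 1)
  refine ⟨w, fun t => DFunLike.congr_fun hw t, fun v hv => hu v ?_⟩
  exact ContinuousLinearMap.ext hv

/-- Composing with the inverse of the form at the base point gives `R y` in the Banach algebra of
operators on `V`, with `R x = 1`. Inversion is analytic at `1` and units are open, so `(R y)⁻¹ (r
y)` is analytic at `x` and solves the equation nearby. -/
theorem exists_analyticAt_systemForm [CompleteSpace V] {a b A B : ℝ} {g₁ g₂ : V →L[ℝ] H}
    {f₁ f₂ : V →L[ℝ] H'} {c : ℝ} (hc : 0 < c)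
    (h : ∀ v, c * ‖v‖ ^ 2 ≤ systemForm a b A B (1 : H →L[ℝ] H) (1 : H' →L[ℝ] H')
      (g₁ v) (g₂ v) (f₁ v) (f₂ v) (g₁ v) (g₂ v) (f₁ v) (f₂ v))
    (γ₁ γ₂ : H) (η₁ η₂ : H')
    (hK : AnalyticAt ℝ K x) (hQ : AnalyticAt ℝ Q x) (hK1 : K x = 1) (hQ1 : Q x = 1) :
    ∃ G : X → V, AnalyticAt ℝ G x ∧ ∀ᶠ y in 𝓝 x, ∀ t : V,
      systemForm a b A B (K y) (Q y) (g₁ (G y)) (g₂ (G y)) (f₁ (G y)) (f₂ (G y))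
        (g₁ t) (g₂ t) (f₁ t) (f₂ t)
      = -systemForm a b A B (K y) (Q y) γ₁ γ₂ η₁ η₂ (g₁ t) (g₂ t) (f₁ t) (f₂ t) := by
  have hbij := bijective_of_coercive (systemFormL a b A B g₁ g₂ f₁ f₂ 1 1) hc h
  let e : V ≃L[ℝ] (V →L[ℝ] ℝ) :=
    ContinuousLinearEquiv.ofBijective (systemFormL a b A B g₁ g₂ f₁ f₂ 1 1)
      (LinearMap.ker_eq_bot.2 hbij.1) (LinearMap.range_eq_top.2 hbij.2)
  have he : ∀ v, systemFormL a b A B g₁ g₂ f₁ f₂ 1 1 v = e v := fun v => rfl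
  let R : X → V →L[ℝ] V := fun y =>
    (e.symm : (V →L[ℝ] ℝ) →L[ℝ] V).comp (systemFormL a b A B g₁ g₂ f₁ f₂ (K y) (Q y))
  let r : X → V := fun y => e.symm (-systemFunctional a b A B g₁ g₂ f₁ f₂ γ₁ γ₂ η₁ η₂ (K y) (Q y))
  have hR : AnalyticAt ℝ R x :=
    AnalyticAt.continuousLinearMap_comp (E := V →L[ℝ] V →L[ℝ] ℝ) (F := V →L[ℝ] V)
      (ContinuousLinearMap.compL ℝ V (V →L[ℝ] ℝ) V (e.symm : (V →L[ℝ] ℝ) →L[ℝ] V))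
      (analyticAt_systemFormL a b A B g₁ g₂ f₁ f₂ hK hQ)
  have hr : AnalyticAt ℝ r x :=
    AnalyticAt.continuousLinearMap_comp (e.symm : (V →L[ℝ] ℝ) →L[ℝ] V)
      (analyticAt_systemFunctional a b A B g₁ g₂ f₁ f₂ γ₁ γ₂ η₁ η₂ hK hQ).neg
  have hR1 : R x = 1 := by
    refine ContinuousLinearMap.ext fun v => ?_
    change e.symm (systemFormL a b A B g₁ g₂ f₁ f₂ (K x) (Q x) v) = v
    rw [hK1, hQ1, he]
    exact e.symm_apply_apply v
  have hinv : AnalyticAt ℝ (fun y => Ring.inverse (R y)) x := by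
    have h1 : AnalyticAt ℝ Ring.inverse (R x) := by
      rw [hR1]
      exact analyticAt_inverse (𝕜 := ℝ) (1 : (V →L[ℝ] V)ˣ)
    exact h1.comp hR
  have hunit : ∀ᶠ y in 𝓝 x, IsUnit (R y) := by
    have h1 : {T : V →L[ℝ] V | IsUnit T} ∈ 𝓝 (R x) :=
      Units.isOpen.mem_nhds (by rw [hR1]; exact isUnit_one)
    exact hR.continuousAt.eventually h1
  refine ⟨fun y => Ring.inverse (R y) (r y), ?_, ?_⟩
  · exact hinv.continuousLinearMap_apply hr
  · filter_upwards [hunit] with y hy t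
    have h1 : R y (Ring.inverse (R y) (r y)) = r y :=
      DFunLike.congr_fun (Ring.mul_inverse_cancel (R y) hy) (r y)
    have h2 := e.symm.injective h1
    exact DFunLike.congr_fun h2 t

end Hilbert

/-- Coercivity of the unperturbed system on `E × E`. -/
def SystemCoercive (a b A B : ℝ) (g : E →L[ℝ] H) (f : E →L[ℝ] H') : Prop :=
  ∃ c : ℝ, 0 < c ∧ ∀ v₁ v₂ : E, c * (‖v₁‖ ^ 2 + ‖v₂‖ ^ 2) ≤
    systemForm a b A B (1 : H →L[ℝ] H) (1 : H' →L[ℝ] H') (g v₁) (g v₂) (f v₁) (f v₂)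
      (g v₁) (g v₂) (f v₁) (f v₂)

variable [CompleteSpace E]

theorem SystemCoercive.existsUnique {a b A B : ℝ} {g : E →L[ℝ] H} {f : E →L[ℝ] H'}
    (h : SystemCoercive a b A B g f) (γ₁ γ₂ : H) (η₁ η₂ : H') :
    ∃! w : E × E, ∀ t : E × E,
      systemForm a b A B (1 : H →L[ℝ] H) (1 : H' →L[ℝ] H') (g w.1) (g w.2) (f w.1) (f w.2)
        (g t.1) (g t.2) (f t.1) (f t.2)
      = -systemForm a b A B (1 : H →L[ℝ] H) (1 : H' →L[ℝ] H') γ₁ γ₂ η₁ η₂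
        (g t.1) (g t.2) (f t.1) (f t.2) := by
  obtain ⟨c, hc, hco⟩ := h
  -- The product `E × E` carries the maximum norm; Lax–Milgram is applied on its Hilbert version
  -- `WithLp 2 (E × E)`.
  let p := WithLp.fstL 2 ℝ E E
  let q := WithLp.sndL 2 ℝ E E
  obtain ⟨w, hw, hu⟩ := existsUnique_systemForm (a := a) (b := b) (A := A) (B := B)
    (g₁ := g.comp p) (g₂ := g.comp q) (f₁ := f.comp p) (f₂ := f.comp q) hc
    (fun v => by rw [WithLp.prod_norm_sq_eq_of_L2]; exact hco v.fst v.snd) γ₁ γ₂ η₁ η₂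
  refine ⟨(w.fst, w.snd), fun t => hw (WithLp.toLp 2 t), fun v hv => ?_⟩
  have := hu (WithLp.toLp 2 v) fun t => hv (t.fst, t.snd)
  rw [← this]
  rfl

theorem SystemCoercive.exists_analyticAt {a b A B : ℝ} {g : E →L[ℝ] H} {f : E →L[ℝ] H'}
    (h : SystemCoercive a b A B g f) (γ₁ γ₂ : H) (η₁ η₂ : H') {X : Type*}
    [NormedAddCommGroup X] [NormedSpace ℝ X] {x : X} {K : X → H →L[ℝ] H} {Q : X → H' →L[ℝ] H'}
    (hK : AnalyticAt ℝ K x) (hQ : AnalyticAt ℝ Q x) (hK1 : K x = 1) (hQ1 : Q x = 1) :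
    ∃ G : X → E × E, AnalyticAt ℝ G x ∧ ∀ᶠ y in 𝓝 x, ∀ t : E × E,
      systemForm a b A B (K y) (Q y) (g (G y).1) (g (G y).2) (f (G y).1) (f (G y).2)
        (g t.1) (g t.2) (f t.1) (f t.2)
      = -systemForm a b A B (K y) (Q y) γ₁ γ₂ η₁ η₂ (g t.1) (g t.2) (f t.1) (f t.2) := by
  obtain ⟨c, hc, hco⟩ := h
  let p := WithLp.fstL 2 ℝ E E
  let q := WithLp.sndL 2 ℝ E E
  obtain ⟨G, hG, hev⟩ := exists_analyticAt_systemForm (a := a) (b := b) (A := A) (B := B)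
    (g₁ := g.comp p) (g₂ := g.comp q) (f₁ := f.comp p) (f₂ := f.comp q) hc
    (fun v => by rw [WithLp.prod_norm_sq_eq_of_L2]; exact hco v.fst v.snd) γ₁ γ₂ η₁ η₂
    hK hQ hK1 hQ1
  refine ⟨fun y => (p (G y), q (G y)), ?_, hev.mono fun y hy t => hy (WithLp.toLp 2 t)⟩
  exact ((p.analyticAt _).comp hG).prod ((q.analyticAt _).comp hG)

end Abstract

variable {N : ℕ}

/-- The function part of a pair of `H¹₀(U)`, as a continuous linear map. -/
noncomputable def H10.fstL (U : Set (RN N)) : H10 U →L[ℝ] Lp ℝ 2 (volume.restrict U) :=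
  (WithLp.fstL 2 ℝ _ _).comp (H10 U).subtypeL

/-- The gradient part of a pair of `H¹₀(U)`, as a continuous linear map. -/
noncomputable def H10.sndL (U : Set (RN N)) : H10 U →L[ℝ] Lp (RN N) 2 (volume.restrict U) :=
  (WithLp.sndL 2 ℝ _ _).comp (H10 U).subtypeL

/-- The integral form of the system with matrix field `m` and weight `j`. -/
noncomputable def weightedForm (a b A B : ℝ) (U : Set (RN N)) (m : RN N → RN N →L[ℝ] RN N)
    (j : RN N → ℝ) (f₁ f₂ s₁ s₂ : RN N → ℝ) (g₁ g₂ h₁ h₂ : RN N → RN N) : ℝ :=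
  (∫ x in U, (⟪m x (g₁ x), m x (h₁ x)⟫_ℝ + ⟪m x (g₂ x), m x (h₂ x)⟫_ℝ) * j x)
  + (∫ x in U, (a * f₁ x * s₁ x + b * f₂ x * s₁ x + A * f₁ x * s₂ x + B * f₂ x * s₂ x) * j x)

theorem integral_linear_combination {α : Type*} [MeasurableSpace α] {ν : Measure α}
    {F₁ F₂ F₃ F₄ : α → ℝ} (a b A B : ℝ) (h₁ : Integrable F₁ ν) (h₂ : Integrable F₂ ν)
    (h₃ : Integrable F₃ ν) (h₄ : Integrable F₄ ν) :
    a * ∫ x, F₁ x ∂ν + b * ∫ x, F₂ x ∂ν + A * ∫ x, F₃ x ∂ν + B * ∫ x, F₄ x ∂ν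
      = ∫ x, (a * F₁ x + b * F₂ x + A * F₃ x + B * F₄ x) ∂ν := by
  have e₁ := h₁.const_mul a
  have e₂ := h₂.const_mul b
  have e₃ := h₃.const_mul A
  have e₄ := h₄.const_mul B
  have e₁₂ : Integrable (fun x => a * F₁ x + b * F₂ x) ν := e₁.add e₂
  have e₁₂₃ : Integrable (fun x => a * F₁ x + b * F₂ x + A * F₃ x) ν := e₁₂.add e₃
  rw [integral_add e₁₂₃ e₄, integral_add e₁₂ e₃, integral_add e₁ e₂, integral_const_mul,
    integral_const_mul, integral_const_mul, integral_const_mul]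

/-- The operators `K` and `Q` act as `m^* (j m ·)` and `j ·`. With `m = id`, `j = 1` this is the
original system; with `m = M`, `j = Jac(m)` it is the transported one. -/
theorem systemForm_eq_weightedForm (a b A B : ℝ) (U : Set (RN N))
    {K : Lp (RN N) 2 (volume.restrict U) →L[ℝ] Lp (RN N) 2 (volume.restrict U)}
    {Q : Lp ℝ 2 (volume.restrict U) →L[ℝ] Lp ℝ 2 (volume.restrict U)}
    {m : RN N → RN N →L[ℝ] RN N} {j : RN N → ℝ}
    (hK : ∀ g, K g =ᵐ[volume.restrict U]
      fun x => ContinuousLinearMap.adjoint (m x) (j x • m x (g x)))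
    (hQ : ∀ f, Q f =ᵐ[volume.restrict U] fun x => j x * f x)
    (γ₁ γ₂ δ₁ δ₂ : Lp (RN N) 2 (volume.restrict U))
    (η₁ η₂ θ₁ θ₂ : Lp ℝ 2 (volume.restrict U)) :
    systemForm a b A B K Q γ₁ γ₂ η₁ η₂ δ₁ δ₂ θ₁ θ₂
      = weightedForm a b A B U m j η₁ η₂ θ₁ θ₂ γ₁ γ₂ δ₁ δ₂ := by
  rw [systemForm, weightedForm]
  have hi := fun (g h : Lp (RN N) 2 (volume.restrict U)) => L2.integrable_inner (𝕜 := ℝ) (K g) h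
  have hi' := fun (g h : Lp ℝ 2 (volume.restrict U)) => L2.integrable_inner (𝕜 := ℝ) (Q g) h
  simp only [L2.inner_def]
  congr 1
  · rw [← integral_add (hi _ _) (hi _ _)]
    refine integral_congr_ae ?_
    filter_upwards [hK γ₁, hK γ₂] with x h1 h2
    rw [h1, h2, ContinuousLinearMap.adjoint_inner_left, ContinuousLinearMap.adjoint_inner_left,
      real_inner_smul_left, real_inner_smul_left]
    ring
  · rw [integral_linear_combination a b A B (hi' _ _) (hi' _ _) (hi' _ _) (hi' _ _)]
    refine integral_congr_ae ?_
    filter_upwards [hQ η₁, hQ η₂] with x h1 h2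
    rw [h1, h2]
    simp only [RCLike.inner_apply, conj_trivial]
    ring

theorem one_ae_eq_adjoint (U : Set (RN N)) (g : Lp (RN N) 2 (volume.restrict U)) :
    (1 : Lp (RN N) 2 (volume.restrict U) →L[ℝ] Lp (RN N) 2 (volume.restrict U)) g
      =ᵐ[volume.restrict U] fun x => ContinuousLinearMap.adjoint
        (ContinuousLinearMap.id ℝ (RN N)) ((1 : ℝ) • ContinuousLinearMap.id ℝ (RN N) (g x)) :=
  Eventually.of_forall fun x => by simp [ContinuousLinearMap.adjoint_id]

theorem one_ae_eq_mul (U : Set (RN N)) (f : Lp ℝ 2 (volume.restrict U)) :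
    (1 : Lp ℝ 2 (volume.restrict U) →L[ℝ] Lp ℝ 2 (volume.restrict U)) f
      =ᵐ[volume.restrict U] fun x => 1 * f x :=
  Eventually.of_forall fun x => by simp

/-- The restriction of a pair to a smaller set. -/
noncomputable def L2Pair.restrict {U Ω : Set (RN N)} (h : U ⊆ Ω) (p : L2Pair Ω) : L2Pair U :=
  L2Pair.mk (p.memLp_fn.mono_measure (Measure.restrict_mono h le_rfl))
    (p.memLp_grad.mono_measure (Measure.restrict_mono h le_rfl))

theorem L2Pair.restrict_fn {U Ω : Set (RN N)} (h : U ⊆ Ω) (p : L2Pair Ω) :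
    (p.restrict h).fn =ᵐ[volume.restrict U] p.fn :=
  L2Pair.mk_fn _ _

theorem L2Pair.restrict_grad {U Ω : Set (RN N)} (h : U ⊆ Ω) (p : L2Pair Ω) :
    (p.restrict h).grad =ᵐ[volume.restrict U] p.grad :=
  L2Pair.mk_grad _ _

theorem weightedForm_congr (a b A B : ℝ) (U : Set (RN N)) (m : RN N → RN N →L[ℝ] RN N)
    (j : RN N → ℝ) {f₁ f₂ f₁' f₂' : RN N → ℝ} (s₁ s₂ : RN N → ℝ) {g₁ g₂ g₁' g₂' : RN N → RN N}
    (h₁ h₂ : RN N → RN N) (e₁ : f₁ =ᵐ[volume.restrict U] f₁') (e₂ : f₂ =ᵐ[volume.restrict U] f₂')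
    (e₃ : g₁ =ᵐ[volume.restrict U] g₁') (e₄ : g₂ =ᵐ[volume.restrict U] g₂') :
    weightedForm a b A B U m j f₁ f₂ s₁ s₂ g₁ g₂ h₁ h₂
      = weightedForm a b A B U m j f₁' f₂' s₁ s₂ g₁' g₂' h₁ h₂ := by
  rw [weightedForm, weightedForm]
  congr 1
  · refine integral_congr_ae ?_
    filter_upwards [e₃, e₄] with x h3 h4
    rw [h3, h4]
  · refine integral_congr_ae ?_
    filter_upwards [e₁, e₂] with x h1 h2
    rw [h1, h2]

theorem isWeakSolution_iff_weightedForm {Ω : Set (RN N)} (a b A B : ℝ) (φ ψ : H1 Ω)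
    (U : Set (RN N)) (w : H10 U × H10 U) :
    IsWeakSolution a b A B φ ψ U w ↔ ∀ t : H10 U × H10 U,
      weightedForm a b A B U (fun _ => ContinuousLinearMap.id ℝ (RN N)) (fun _ => 1)
        w.1.1.fn w.2.1.fn t.1.1.fn t.2.1.fn w.1.1.grad w.2.1.grad t.1.1.grad t.2.1.grad
      = - weightedForm a b A B U (fun _ => ContinuousLinearMap.id ℝ (RN N)) (fun _ => 1)
        φ.1.fn ψ.1.fn t.1.1.fn t.2.1.fn φ.1.grad ψ.1.grad t.1.1.grad t.2.1.grad := by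
  simp only [IsWeakSolution, weightedForm, ContinuousLinearMap.id_apply, mul_one, Prod.forall,
    neg_add, sub_eq_add_neg]

theorem systemForm_restrict_eq_weightedForm (a b A B : ℝ) {Ω U : Set (RN N)} (hU : U ⊆ Ω)
    {K : Lp (RN N) 2 (volume.restrict U) →L[ℝ] Lp (RN N) 2 (volume.restrict U)}
    {Q : Lp ℝ 2 (volume.restrict U) →L[ℝ] Lp ℝ 2 (volume.restrict U)}
    {m : RN N → RN N →L[ℝ] RN N} {j : RN N → ℝ}
    (hK : ∀ g, K g =ᵐ[volume.restrict U]
      fun x => ContinuousLinearMap.adjoint (m x) (j x • m x (g x)))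
    (hQ : ∀ f, Q f =ᵐ[volume.restrict U] fun x => j x * f x)
    (p q : L2Pair Ω) (δ₁ δ₂ : Lp (RN N) 2 (volume.restrict U))
    (θ₁ θ₂ : Lp ℝ 2 (volume.restrict U)) :
    systemForm a b A B K Q (p.restrict hU).snd (q.restrict hU).snd (p.restrict hU).fst
        (q.restrict hU).fst δ₁ δ₂ θ₁ θ₂
      = weightedForm a b A B U m j p.fn q.fn θ₁ θ₂ p.grad q.grad δ₁ δ₂ :=
  (systemForm_eq_weightedForm a b A B U hK hQ _ _ _ _ _ _ _ _).trans
    (weightedForm_congr a b A B U m j θ₁ θ₂ δ₁ δ₂ (p.restrict_fn hU) (q.restrict_fn hU)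
      (p.restrict_grad hU) (q.restrict_grad hU))

theorem systemForm_equation_iff (a b A B : ℝ) {Ω U : Set (RN N)} (hU : U ⊆ Ω)
    {K : Lp (RN N) 2 (volume.restrict U) →L[ℝ] Lp (RN N) 2 (volume.restrict U)}
    {Q : Lp ℝ 2 (volume.restrict U) →L[ℝ] Lp ℝ 2 (volume.restrict U)}
    {m : RN N → RN N →L[ℝ] RN N} {j : RN N → ℝ}
    (hK : ∀ g, K g =ᵐ[volume.restrict U]
      fun x => ContinuousLinearMap.adjoint (m x) (j x • m x (g x)))
    (hQ : ∀ f, Q f =ᵐ[volume.restrict U] fun x => j x * f x)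
    (p q : L2Pair Ω) (w₁ w₂ t₁ t₂ : H10 U) :
    (systemForm a b A B K Q (H10.sndL U w₁) (H10.sndL U w₂) (H10.fstL U w₁) (H10.fstL U w₂)
        (H10.sndL U t₁) (H10.sndL U t₂) (H10.fstL U t₁) (H10.fstL U t₂)
      = -systemForm a b A B K Q (p.restrict hU).snd (q.restrict hU).snd (p.restrict hU).fst
        (q.restrict hU).fst (H10.sndL U t₁) (H10.sndL U t₂) (H10.fstL U t₁) (H10.fstL U t₂)) ↔
    (weightedForm a b A B U m j w₁.1.fn w₂.1.fn t₁.1.fn t₂.1.fn w₁.1.grad w₂.1.grad t₁.1.grad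
        t₂.1.grad
      = -weightedForm a b A B U m j p.fn q.fn t₁.1.fn t₂.1.fn p.grad q.grad t₁.1.grad
        t₂.1.grad) := by
  rw [systemForm_restrict_eq_weightedForm a b A B hU hK hQ,
    systemForm_eq_weightedForm a b A B U hK hQ]
  rfl

theorem existsUnique_isWeakSolution {Ω U : Set (RN N)} (hU : U ⊆ Ω) {a b A B : ℝ}
    (h : SystemCoercive a b A B (H10.sndL U) (H10.fstL U)) (φ ψ : H1 Ω) :
    ∃! w : H10 U × H10 U, IsWeakSolution a b A B φ ψ U w := by
  obtain ⟨w, hw, hu⟩ := SystemCoercive.existsUnique h (φ.1.restrict hU).snd (ψ.1.restrict hU).snd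
    (φ.1.restrict hU).fst (ψ.1.restrict hU).fst
  have key := fun w t : H10 U × H10 U => systemForm_equation_iff a b A B hU
    (one_ae_eq_adjoint U) (one_ae_eq_mul U) φ.1 ψ.1 w.1 w.2 t.1 t.2
  refine ⟨w, ?_, fun v hv => hu v fun t => ?_⟩
  · exact (isWeakSolution_iff_weightedForm a b A B φ ψ U w).2 fun t => (key w t).1 (hw t)
  · exact (key v t).2 ((isWeakSolution_iff_weightedForm a b A B φ ψ U v).1 hv t)

/-- Let `F` and `G` be the total squared `L²` norms of the functions and of the gradients. The form
is at least `G - λ F`, and Poincaré gives `F ≤ C G`. -/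
theorem AdmissibleCoeffs.systemCoercive {Ω U : Set (RN N)} (hU : U ⊆ Ω) {a b A B : ℝ}
    (h : AdmissibleCoeffs Ω a b A B) : SystemCoercive a b A B (H10.sndL U) (H10.fstL U) := by
  obtain ⟨lam, C, hl, hC, hlC, hP, hco⟩ := h.exists_poincare
  -- This constant arises from `G - λ F ≥ (1 - λ C) G` and `F + G ≤ (1 + C) G`.
  have hc : 0 < (1 - lam * C) / (1 + C) := div_pos (by linarith) (by linarith)
  refine ⟨_, hc, fun v₁ v₂ => ?_⟩
  have h1 := H10.norm_fst_sq_le_of_subset hU hP v₁.2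
  have h2 := H10.norm_fst_sq_le_of_subset hU hP v₂.2
  have n1 : ‖v₁‖ ^ 2 = ‖v₁.1.fst‖ ^ 2 + ‖v₁.1.snd‖ ^ 2 := L2Pair.norm_sq v₁.1
  have n2 : ‖v₂‖ ^ 2 = ‖v₂.1.fst‖ ^ 2 + ‖v₂.1.snd‖ ^ 2 := L2Pair.norm_sq v₂.1
  have hlow : -lam * (‖v₁.1.fst‖ ^ 2 + ‖v₂.1.fst‖ ^ 2) ≤
      a * ⟪v₁.1.fst, v₁.1.fst⟫_ℝ + b * ⟪v₂.1.fst, v₁.1.fst⟫_ℝ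
        + A * ⟪v₁.1.fst, v₂.1.fst⟫_ℝ + B * ⟪v₂.1.fst, v₂.1.fst⟫_ℝ := by
    have hi := fun (g h : Lp ℝ 2 (volume.restrict U)) => L2.integrable_inner (𝕜 := ℝ) g h
    rw [← real_inner_self_eq_norm_sq, ← real_inner_self_eq_norm_sq]
    simp only [L2.inner_def]
    rw [integral_linear_combination a b A B (hi _ _) (hi _ _) (hi _ _) (hi _ _),
      ← integral_add (hi _ _) (hi _ _), ← integral_const_mul]
    refine integral_mono (((hi _ _).add (hi _ _)).const_mul _)
      (((((hi _ _).const_mul a).add ((hi _ _).const_mul b)).add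
        ((hi _ _).const_mul A)).add ((hi _ _).const_mul B)) fun x => ?_
    have := hco (v₁.1.fst x) (v₂.1.fst x)
    simp only [RCLike.inner_apply, conj_trivial]
    linarith
  change _ ≤ ⟪v₁.1.snd, v₁.1.snd⟫_ℝ + ⟪v₂.1.snd, v₂.1.snd⟫_ℝ
    + (a * ⟪v₁.1.fst, v₁.1.fst⟫_ℝ + b * ⟪v₂.1.fst, v₁.1.fst⟫_ℝ
        + A * ⟪v₁.1.fst, v₂.1.fst⟫_ℝ + B * ⟪v₂.1.fst, v₂.1.fst⟫_ℝ)
  rw [real_inner_self_eq_norm_sq v₁.1.snd, real_inner_self_eq_norm_sq v₂.1.snd]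
  rw [div_mul_eq_mul_div, div_le_iff₀ (by linarith), n1, n2]
  set F := ‖v₁.1.fst‖ ^ 2 + ‖v₂.1.fst‖ ^ 2 with hF
  set G := ‖v₁.1.snd‖ ^ 2 + ‖v₂.1.snd‖ ^ 2 with hG
  have hG0 : 0 ≤ G := by positivity
  have hFG : F ≤ C * G := by rw [hF, hG, mul_add]; exact add_le_add h1 h2
  have s1 : (1 - lam * C) * (F + G) ≤ (1 - lam * C) * ((1 + C) * G) :=
    mul_le_mul_of_nonneg_left (by linarith) (by linarith)
  have s2 : (1 - lam * C) * G ≤ G + -lam * F := by nlinarith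
  have s3 : (1 - lam * C) * ((1 + C) * G) ≤ (G + -lam * F) * (1 + C) := by nlinarith
  have s4 := mul_le_mul_of_nonneg_right (add_le_add_right hlow G) (by linarith : 0 ≤ 1 + C)
  have s5 : ‖v₁.1.fst‖ ^ 2 + ‖v₁.1.snd‖ ^ 2 + (‖v₂.1.fst‖ ^ 2 + ‖v₂.1.snd‖ ^ 2) = F + G := by
    rw [hF, hG]; ring
  rw [s5]
  exact s1.trans (s3.trans s4)

end SystemForm

/-! ### Multiplication operators on `L²` that depend analytically on the Jacobian field. -/

section Multipliers

open Filter Topology Set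
open scoped ENNReal NNReal

variable {N : ℕ}

/-- Multiplication by a bounded field `A` through a continuous bilinear map `b`, as an operator on
`L²(U)` which depends linearly and continuously on `A`. -/
noncomputable def mulOp {E F : Type*} [NormedAddCommGroup E] [NormedSpace ℝ E]
    [NormedAddCommGroup F] [NormedSpace ℝ F] (b : E →L[ℝ] F →L[ℝ] F) (U : Set (RN N)) :
    Lp E ⊤ (volume : Measure (RN N)) →L[ℝ]
      Lp F 2 (volume.restrict U) →L[ℝ] Lp F 2 (volume.restrict U) :=
  (b.holderL (volume.restrict U) ⊤ 2 2).comp (LpToLpRestrictCLM (RN N) E ℝ volume ⊤ U)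

theorem mulOp_ae_eq {E F : Type*} [NormedAddCommGroup E] [NormedSpace ℝ E]
    [NormedAddCommGroup F] [NormedSpace ℝ F] (b : E →L[ℝ] F →L[ℝ] F) (U : Set (RN N))
    (A : Lp E ⊤ (volume : Measure (RN N))) (f : Lp F 2 (volume.restrict U)) :
    mulOp b U A f =ᵐ[volume.restrict U] fun x => b (A x) (f x) := by
  have h1 := b.coeFn_holder (r := 2) (LpToLpRestrictCLM (RN N) E ℝ volume ⊤ U A) f
  have h2 := LpToLpRestrictCLM_coeFn ℝ U A
  refine h1.trans ?_
  filter_upwards [h2] with x hx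
  rw [hx]

/-- The adjoint as a real-linear continuous map. -/
noncomputable def adjointL (E : Type*) [NormedAddCommGroup E] [InnerProductSpace ℝ E]
    [CompleteSpace E] : (E →L[ℝ] E) →L[ℝ] (E →L[ℝ] E) :=
  LinearMap.mkContinuous
    { toFun := fun A => ContinuousLinearMap.adjoint A
      map_add' := fun A B => map_add _ A B
      map_smul' := fun c A => by simp } 1
    fun A => by simp

/-- The `(i, k)` entry of the matrix of an operator. -/
noncomputable def entryL (i k : Fin N) : (RN N →L[ℝ] RN N) →L[ℝ] ℝ :=
  (EuclideanSpace.proj i : RN N →L[ℝ] ℝ).comp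
    (ContinuousLinearMap.apply ℝ (RN N) (EuclideanSpace.single k (1 : ℝ)))

/-- The Leibniz products run over a list so that `detOp` can repeat the formula in the
noncommutative algebra of operators. -/
theorem det_eq_sum_entryL (A : RN N →L[ℝ] RN N) :
    A.det = ∑ σ : Equiv.Perm (Fin N), ((Equiv.Perm.sign σ : ℤ) : ℝ) *
      ((List.finRange N).map fun i => entryL (σ i) i A).prod := by
  rw [ContinuousLinearMap.det, ← LinearMap.det_toMatrix (EuclideanSpace.basisFun (Fin N) ℝ).toBasis,
    Matrix.det_apply']
  refine Finset.sum_congr rfl fun σ _ => ?_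
  rw [Fin.prod_univ_def]
  congr 3

variable {F : Type*} [NormedAddCommGroup F] [NormedSpace ℝ F]

/-- Multiplication by the `(i, k)` entry of `I + A`, as an operator on `L²(U)`. -/
noncomputable def entryOp (F : Type*) [NormedAddCommGroup F] [NormedSpace ℝ F] (U : Set (RN N))
    (A : Lp (RN N →L[ℝ] RN N) ⊤ (volume : Measure (RN N))) (i k : Fin N) :
    Lp F 2 (volume.restrict U) →L[ℝ] Lp F 2 (volume.restrict U) :=
  entryL i k (ContinuousLinearMap.id ℝ (RN N)) • 1
    + mulOp ((ContinuousLinearMap.lsmul ℝ ℝ : ℝ →L[ℝ] F →L[ℝ] F).comp (entryL i k)) U A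

theorem entryOp_ae_eq (U : Set (RN N)) (A : Lp (RN N →L[ℝ] RN N) ⊤ (volume : Measure (RN N)))
    (i k : Fin N) (f : Lp F 2 (volume.restrict U)) :
    entryOp F U A i k f =ᵐ[volume.restrict U]
      fun x => entryL i k (ContinuousLinearMap.id ℝ (RN N) + A x) • f x := by
  set c := entryL i k (ContinuousLinearMap.id ℝ (RN N)) with hc
  set T := mulOp ((ContinuousLinearMap.lsmul ℝ ℝ : ℝ →L[ℝ] F →L[ℝ] F).comp (entryL i k)) U A f
    with hT
  have h0 : entryOp F U A i k f = c • f + T := rfl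
  rw [h0]
  filter_upwards [Lp.coeFn_add (c • f) T, Lp.coeFn_smul c f, mulOp_ae_eq
    ((ContinuousLinearMap.lsmul ℝ ℝ : ℝ →L[ℝ] F →L[ℝ] F).comp (entryL i k)) U A f] with x h1 h2 h3
  rw [h1, Pi.add_apply, h2, hT, h3, map_add, add_smul]
  rfl

/-- Multiplication by `det (I + A)`, as an operator on `L²(U)`. -/
noncomputable def detOp (F : Type*) [NormedAddCommGroup F] [NormedSpace ℝ F] (U : Set (RN N))
    (A : Lp (RN N →L[ℝ] RN N) ⊤ (volume : Measure (RN N))) :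
    Lp F 2 (volume.restrict U) →L[ℝ] Lp F 2 (volume.restrict U) :=
  ∑ σ : Equiv.Perm (Fin N), ((Equiv.Perm.sign σ : ℤ) : ℝ) •
    ((List.finRange N).map fun i => entryOp F U A (σ i) i).prod

theorem list_prod_ae_eq {ι : Type*} (U : Set (RN N)) (l : List ι)
    {T : ι → Lp F 2 (volume.restrict U) →L[ℝ] Lp F 2 (volume.restrict U)} {e : ι → RN N → ℝ}
    (h : ∀ i f, T i f =ᵐ[volume.restrict U] fun x => e i x • f x)
    (f : Lp F 2 (volume.restrict U)) :
    (l.map T).prod f =ᵐ[volume.restrict U] fun x => (l.map fun i => e i x).prod • f x := by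
  induction l with
  | nil => exact Eventually.of_forall fun x => by simp
  | cons i l ih =>
    rw [List.map_cons, List.prod_cons]
    filter_upwards [ih, h i ((l.map T).prod f)] with x h1 h2
    rw [mul_apply_eq_comp, h2, h1, smul_smul, List.map_cons, List.prod_cons]

theorem finset_sum_smul_ae_eq {ι : Type*} (U : Set (RN N)) (s : Finset ι) (c : ι → ℝ)
    {T : ι → Lp F 2 (volume.restrict U) →L[ℝ] Lp F 2 (volume.restrict U)} {e : ι → RN N → ℝ}
    (h : ∀ i f, T i f =ᵐ[volume.restrict U] fun x => e i x • f x)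
    (f : Lp F 2 (volume.restrict U)) :
    (∑ i ∈ s, c i • T i) f =ᵐ[volume.restrict U] fun x => (∑ i ∈ s, c i * e i x) • f x := by
  classical
  induction s using Finset.induction_on with
  | empty =>
    simp only [Finset.sum_empty, zero_smul]
    exact Lp.coeFn_zero F 2 _
  | insert i s hi ih =>
    rw [Finset.sum_insert hi]
    have h0 : (c i • T i + ∑ j ∈ s, c j • T j) f = c i • T i f + (∑ j ∈ s, c j • T j) f := rfl
    rw [h0]
    filter_upwards [ih, h i f, Lp.coeFn_add (c i • T i f) ((∑ j ∈ s, c j • T j) f),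
      Lp.coeFn_smul (c i) (T i f)] with x h1 h2 h3 h4
    rw [h3, Pi.add_apply, h4, Pi.smul_apply, h2, h1, Finset.sum_insert hi, add_smul, smul_smul]

theorem detOp_ae_eq (U : Set (RN N)) (A : Lp (RN N →L[ℝ] RN N) ⊤ (volume : Measure (RN N)))
    (f : Lp F 2 (volume.restrict U)) :
    detOp F U A f =ᵐ[volume.restrict U]
      fun x => (ContinuousLinearMap.id ℝ (RN N) + A x).det • f x := by
  refine (finset_sum_smul_ae_eq U Finset.univ
    (fun σ : Equiv.Perm (Fin N) => ((Equiv.Perm.sign σ : ℤ) : ℝ))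
    (T := fun σ => ((List.finRange N).map fun i => entryOp F U A (σ i) i).prod)
    (fun σ f => list_prod_ae_eq U (List.finRange N)
      (fun i f => entryOp_ae_eq U A (σ i) i f) f) f).trans ?_
  refine Eventually.of_forall fun x => ?_
  dsimp only
  rw [det_eq_sum_entryL]

theorem AnalyticAt.list_prod {ι X R : Type*} [NormedAddCommGroup X] [NormedSpace ℝ X]
    [NormedRing R] [NormedAlgebra ℝ R] (l : List ι) {T : ι → X → R} {x : X}
    (h : ∀ i, AnalyticAt ℝ (T i) x) : AnalyticAt ℝ (fun y => (l.map fun i => T i y).prod) x := by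
  induction l with
  | nil => exact analyticAt_const
  | cons i l ih => exact (h i).mul ih

/-- The operator is a polynomial in the entry multipliers, each of which is affine and continuous in
`A`. -/
theorem analyticAt_detOp (U : Set (RN N)) (A : Lp (RN N →L[ℝ] RN N) ⊤ (volume : Measure (RN N))) :
    AnalyticAt ℝ (detOp F U) A := by
  have h : ∀ σ : Equiv.Perm (Fin N), AnalyticAt ℝ (fun A => ((Equiv.Perm.sign σ : ℤ) : ℝ) •
      ((List.finRange N).map fun i => entryOp F U A (σ i) i).prod) A := fun σ =>
    AnalyticAt.fun_smul analyticAt_const (AnalyticAt.list_prod (List.finRange N)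
      (T := fun i A => entryOp F U A (σ i) i) fun i =>
        AnalyticAt.add analyticAt_const (ContinuousLinearMap.analyticAt
          (mulOp ((ContinuousLinearMap.lsmul ℝ ℝ : ℝ →L[ℝ] F →L[ℝ] F).comp (entryL (σ i) i)) U) A))
  exact Finset.analyticAt_fun_sum _ fun σ _ => h σ

theorem detOp_abs_ae_eq (U : Set (RN N)) {A : Lp (RN N →L[ℝ] RN N) ⊤ (volume : Measure (RN N))}
    (hA : ‖A‖ < 1) (f : Lp F 2 (volume.restrict U)) :
    detOp F U A f =ᵐ[volume.restrict U]
      fun x => |(ContinuousLinearMap.id ℝ (RN N) + A x).det| • f x := by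
  refine (detOp_ae_eq U _ f).trans ?_
  filter_upwards [ae_restrict_of_ae (Lp.ae_norm_le_norm_top A)] with x hx
  rw [abs_of_pos (det_id_add_pos_of_norm_lt_one (hx.trans_lt hA))]

theorem detOp_zero (U : Set (RN N)) : detOp F U 0 = 1 := by
  refine ContinuousLinearMap.ext fun f => Lp.ext ?_
  refine (detOp_ae_eq U 0 f).trans ?_
  filter_upwards [ae_restrict_of_ae
    (Lp.coeFn_zero (RN N →L[ℝ] RN N) ⊤ (volume : Measure (RN N)))] with x hx
  rw [hx, Pi.zero_apply, add_zero, ContinuousLinearMap.det, ContinuousLinearMap.coe_id,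
    LinearMap.det_id, one_smul]
  rfl

theorem eventually_norm_lt_one (X : Type*) [NormedAddCommGroup X] :
    ∀ᶠ x : X in 𝓝 0, ‖x‖ < 1 :=
  continuous_norm.continuousAt.eventually (gt_mem_nhds (norm_zero.trans_lt one_pos))

theorem analyticAt_one_add_clm {X R : Type*} [NormedAddCommGroup X] [NormedSpace ℝ X]
    [NormedRing R] [NormedAlgebra ℝ R] (L : X →L[ℝ] R) (x : X) :
    AnalyticAt ℝ (fun y => 1 + L y) x :=
  analyticAt_const.add (L.analyticAt x)

theorem analyticAt_ringInverse_one_add {X R : Type*} [NormedAddCommGroup X] [NormedSpace ℝ X]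
    [NormedRing R] [NormedAlgebra ℝ R] [CompleteSpace R] (L : X →L[ℝ] R) :
    AnalyticAt ℝ (fun y => Ring.inverse (1 + L y)) 0 ∧ ∀ᶠ y in 𝓝 0, IsUnit (1 + L y) := by
  have h0 : 1 + L 0 = ((1 : Rˣ) : R) := by simp
  have hL := analyticAt_one_add_clm L 0
  refine ⟨?_, ?_⟩
  · have h1 : AnalyticAt ℝ Ring.inverse (1 + L 0) := by
      rw [h0]
      exact analyticAt_inverse (𝕜 := ℝ) (1 : Rˣ)
    exact AnalyticAt.comp (f := fun y => 1 + L y) h1 hL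
  · have h1 : {T : R | IsUnit T} ∈ 𝓝 (1 + L 0) :=
      Units.isOpen.mem_nhds (by rw [h0]; exact Units.isUnit 1)
    exact hL.continuousAt.eventually h1

theorem analyticAt_inverse_mul_mul_inverse {X H : Type*} [NormedAddCommGroup X] [NormedSpace ℝ X]
    [NormedAddCommGroup H] [NormedSpace ℝ H] [CompleteSpace H] (L L' : X →L[ℝ] H →L[ℝ] H)
    {D : X → H →L[ℝ] H} (hD : AnalyticAt ℝ D 0) :
    AnalyticAt ℝ (fun y => Ring.inverse (1 + L y) * D y * Ring.inverse (1 + L' y)) 0 :=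
  ((analyticAt_ringInverse_one_add L).1.mul hD).mul (analyticAt_ringInverse_one_add L').1

/-- The triple product is characterised by two equations involving only `1 + L y`, `1 + L' y` and `D
y`. These can be read pointwise, without first describing the inverse operators. -/
theorem eventually_inverse_mul_mul_inverse_apply {X H : Type*} [NormedAddCommGroup X]
    [NormedSpace ℝ X] [NormedAddCommGroup H] [NormedSpace ℝ H] [CompleteSpace H]
    (L L' : X →L[ℝ] H →L[ℝ] H) (D : X → H →L[ℝ] H) :
    ∀ᶠ y in 𝓝 0, ∀ g, ∃ z, (1 + L' y) z = g ∧
      (1 + L y) ((Ring.inverse (1 + L y) * D y * Ring.inverse (1 + L' y)) g) = D y z := by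
  filter_upwards [(analyticAt_ringInverse_one_add L).2,
    (analyticAt_ringInverse_one_add L').2] with y h1 h2 g
  exact ⟨Ring.inverse (1 + L' y) g, DFunLike.congr_fun (Ring.mul_inverse_cancel _ h2) g,
    DFunLike.congr_fun (Ring.mul_inverse_cancel _ h1) _⟩

theorem one_add_mulOp_id_ae_eq (U : Set (RN N))
    (A : Lp (RN N →L[ℝ] RN N) ⊤ (volume : Measure (RN N))) (f : Lp (RN N) 2 (volume.restrict U)) :
    (1 + mulOp (ContinuousLinearMap.id ℝ (RN N →L[ℝ] RN N)) U A) f =ᵐ[volume.restrict U]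
      fun x => (ContinuousLinearMap.id ℝ (RN N) + A x) (f x) := by
  set T := mulOp (ContinuousLinearMap.id ℝ (RN N →L[ℝ] RN N)) U A f with hT
  have h0 : (1 + mulOp (ContinuousLinearMap.id ℝ (RN N →L[ℝ] RN N)) U A) f = f + T := rfl
  rw [h0]
  filter_upwards [Lp.coeFn_add f T,
    mulOp_ae_eq (ContinuousLinearMap.id ℝ (RN N →L[ℝ] RN N)) U A f] with x h1 h2
  rw [h1, Pi.add_apply]
  exact congrArg (f x + ·) h2

theorem one_add_mulOp_adjointL_ae_eq (U : Set (RN N))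
    (A : Lp (RN N →L[ℝ] RN N) ⊤ (volume : Measure (RN N))) (f : Lp (RN N) 2 (volume.restrict U)) :
    (1 + mulOp (adjointL (RN N)) U A) f =ᵐ[volume.restrict U]
      fun x => ContinuousLinearMap.adjoint (ContinuousLinearMap.id ℝ (RN N) + A x) (f x) := by
  set T := mulOp (adjointL (RN N)) U A f with hT
  have h0 : (1 + mulOp (adjointL (RN N)) U A) f = f + T := rfl
  rw [h0]
  filter_upwards [Lp.coeFn_add f T, mulOp_ae_eq (adjointL (RN N)) U A f] with x h1 h2
  rw [h1, Pi.add_apply, map_add, ContinuousLinearMap.adjoint_id]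
  exact congrArg (f x + ·) h2

/-- Multiplication by `|det D| • M^* M`, where `D = I + A` and `M = (D^*)⁻¹`, as an operator on
`L²(U; ℝ^N)`. -/
noncomputable def stiffnessOp (U : Set (RN N))
    (A : Lp (RN N →L[ℝ] RN N) ⊤ (volume : Measure (RN N))) :
    Lp (RN N) 2 (volume.restrict U) →L[ℝ] Lp (RN N) 2 (volume.restrict U) :=
  Ring.inverse (1 + mulOp (ContinuousLinearMap.id ℝ (RN N →L[ℝ] RN N)) U A) * detOp (RN N) U A *
    Ring.inverse (1 + mulOp (adjointL (RN N)) U A)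

theorem analyticAt_stiffnessOp (U : Set (RN N)) : AnalyticAt ℝ (stiffnessOp U) 0 :=
  analyticAt_inverse_mul_mul_inverse (mulOp (ContinuousLinearMap.id ℝ (RN N →L[ℝ] RN N)) U)
    (mulOp (adjointL (RN N)) U) (analyticAt_detOp U 0)

theorem stiffnessOp_zero (U : Set (RN N)) : stiffnessOp U 0 = 1 := by
  rw [stiffnessOp, detOp_zero, map_zero, map_zero, add_zero, Ring.inverse_one, one_mul, one_mul]

/-- With `D = I + A`, almost everywhere `D^* z = g` and `D (S g) = det D • z`, where `S` is the
stiffness operator. Solving these pointwise gives `S g = M^* (|det D| M g)`. -/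
theorem eventually_stiffnessOp_ae_eq (U : Set (RN N)) :
    ∀ᶠ A : Lp (RN N →L[ℝ] RN N) ⊤ (volume : Measure (RN N)) in 𝓝 0, ∀ g,
      stiffnessOp U A g =ᵐ[volume.restrict U] fun x =>
        ContinuousLinearMap.adjoint
          (ContinuousLinearMap.adjoint (ContinuousLinearMap.id ℝ (RN N) + A x)).inverse
          (|(ContinuousLinearMap.id ℝ (RN N) + A x).det| •
            (ContinuousLinearMap.adjoint (ContinuousLinearMap.id ℝ (RN N) + A x)).inverse
              (g x)) := by
  have hsol := eventually_inverse_mul_mul_inverse_apply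
    (mulOp (ContinuousLinearMap.id ℝ (RN N →L[ℝ] RN N)) U) (mulOp (adjointL (RN N)) U)
    (detOp (RN N) U)
  filter_upwards [eventually_norm_lt_one _, hsol] with A hA hs g
  obtain ⟨z, e1, e2⟩ := hs g
  have a1 := one_add_mulOp_adjointL_ae_eq U A z
  have a2 := one_add_mulOp_id_ae_eq U A (stiffnessOp U A g)
  rw [e1] at a1
  rw [stiffnessOp, e2, ← stiffnessOp] at a2
  filter_upwards [a1, a2, detOp_abs_ae_eq U hA z,
    ae_restrict_of_ae (Lp.ae_norm_le_norm_top A)] with x b1 b2 b3 hx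
  have b4 := inverse_adjoint_apply (isUnit_id_add_of_norm_lt_one (hx.trans_lt hA))
  rw [b1, (b4 _).1, ← b3, b2]
  -- It remains to see that `M^* D = I`, which follows by duality from `D^* M = I`.
  refine ext_inner_right ℝ fun w => ?_
  rw [ContinuousLinearMap.adjoint_inner_left, ← ContinuousLinearMap.adjoint_inner_right, (b4 w).2]

end Multipliers

/-! ### The transported system and its solution map. -/

section Transport

open Filter Topology Set
open scoped ENNReal NNReal

variable {N : ℕ} {Ω Dstar : Set (RN N)}

theorem transportedRHS_eq_neg_weightedForm (a b A B : ℝ) (μ : WZero Ω Dstar) (φ ψ : H1 Ω)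
    (U : Set (RN N)) (t : H10 U × H10 U) :
    transportedRHS a b A B μ φ ψ U t = -weightedForm a b A B U (defM μ) (defJac μ) φ.1.fn ψ.1.fn
      t.1.1.fn t.2.1.fn φ.1.grad ψ.1.grad t.1.1.grad t.2.1.grad := by
  rw [transportedRHS, weightedForm, neg_add, sub_eq_add_neg]

/-- The change of variables produces `Jac(m)`, and `M` undoes the factor `(m')^*` that each
pulled-back gradient carries. -/
theorem weightedForm_comp_defMap (a b A B : ℝ) (μ : WZero Ω Dstar) (hμ : ‖μ‖ < 1)
    {U V : Set (RN N)} (hV : MeasurableSet V) (h : ∀ x, x ∈ V ↔ (WZero.homeo μ hμ).map x ∈ U)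
    {f₁ f₂ s₁ s₂ f₁' f₂' s₁' s₂' : RN N → ℝ} {g₁ g₂ h₁ h₂ g₁' g₂' h₁' h₂' : RN N → RN N}
    (ef₁ : f₁' =ᵐ[volume.restrict V] fun x => f₁ (defMap μ x))
    (ef₂ : f₂' =ᵐ[volume.restrict V] fun x => f₂ (defMap μ x))
    (es₁ : s₁' =ᵐ[volume.restrict V] fun x => s₁ (defMap μ x))
    (es₂ : s₂' =ᵐ[volume.restrict V] fun x => s₂ (defMap μ x))
    (eg₁ : g₁' =ᵐ[volume.restrict V]
      fun x => ContinuousLinearMap.adjoint (defDeriv μ x) (g₁ (defMap μ x)))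
    (eg₂ : g₂' =ᵐ[volume.restrict V]
      fun x => ContinuousLinearMap.adjoint (defDeriv μ x) (g₂ (defMap μ x)))
    (eh₁ : h₁' =ᵐ[volume.restrict V]
      fun x => ContinuousLinearMap.adjoint (defDeriv μ x) (h₁ (defMap μ x)))
    (eh₂ : h₂' =ᵐ[volume.restrict V]
      fun x => ContinuousLinearMap.adjoint (defDeriv μ x) (h₂ (defMap μ x))) :
    weightedForm a b A B U (fun _ => ContinuousLinearMap.id ℝ (RN N)) (fun _ => 1)
        f₁ f₂ s₁ s₂ g₁ g₂ h₁ h₂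
      = weightedForm a b A B V (defM μ) (defJac μ) f₁' f₂' s₁' s₂' g₁' g₂' h₁' h₂' := by
  have hD := ae_restrict_of_ae (s := V) (WZero.ae_fderiv_defMap μ)
  rw [weightedForm, weightedForm, (WZero.homeo μ hμ).setIntegral_comp hV h,
    (WZero.homeo μ hμ).setIntegral_comp hV h, WZero.homeo_map]
  congr 1
  · refine integral_congr_ae ?_
    filter_upwards [eg₁, eg₂, eh₁, eh₂, hD,
      ae_restrict_of_ae (WZero.ae_defM_adjoint μ hμ)] with x e1 e2 e3 e4 e5 e6
    rw [e1, e2, e3, e4, e5, (e6 _).1, (e6 _).1, (e6 _).1, (e6 _).1, defJac]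
    simp only [ContinuousLinearMap.id_apply]
    ring
  · refine integral_congr_ae ?_
    filter_upwards [ef₁, ef₂, es₁, es₂, hD] with x e1 e2 e3 e4 e5
    rw [e1, e2, e3, e4, e5, defJac]
    ring

theorem WZero.pullback_grad (μ : WZero Ω Dstar) (hμ : ‖μ‖ < 1) {U V : Set (RN N)}
    (hU : MeasurableSet U) (h : ∀ x, x ∈ V ↔ (WZero.homeo μ hμ).map x ∈ U) (p : L2Pair U) :
    ((WZero.homeo μ hμ).pullback hU h p).grad =ᵐ[volume.restrict V]
      fun x => ContinuousLinearMap.adjoint (defDeriv μ x) (p.grad (defMap μ x)) := by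
  filter_upwards [(WZero.homeo μ hμ).pullback_grad hU h p,
    ae_restrict_of_ae (WZero.ae_fderiv_defMap μ)] with x h1 h2
  rw [h1, WZero.homeo_map, h2]

/-- The pairs transported by `m` solve the transported equations exactly when the original pairs
solve the system in the deformed domain. -/
theorem isWeakSolution_iff_transportedT (a b A B : ℝ) (hΩ : IsOpen Ω)
    (hΩb : Bornology.IsBounded Ω) (hD : closure Dstar ⊆ Ω) (μ : WZero Ω Dstar) (hμ : ‖μ‖ < 1)
    (φ ψ : H1 Ω) (hφ : ∀ᵐ x ∂volume.restrict (closure Dstar), φ.1.fn x = 0)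
    (hψ : ∀ᵐ x ∂volume.restrict (closure Dstar), ψ.1.fn x = 0) {U V : Set (RN N)}
    (hU : IsOpen U) (hV : IsOpen V) (hVΩ : V ⊆ Ω)
    (h : ∀ x, x ∈ V ↔ (WZero.homeo μ hμ).map x ∈ U) (w : H10 U × H10 U) :
    IsWeakSolution a b A B φ ψ U w ↔ ∀ t,
      transportedT a b A B μ V ((WZero.homeo μ hμ).pullbackH10 hU hV h w.1,
        (WZero.homeo μ hμ).pullbackH10 hU hV h w.2) t = transportedRHS a b A B μ φ ψ V t := by
  set P := (WZero.homeo μ hμ).pullbackH10 hU hV h with hP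
  have hfn : ∀ u : H10 U, (P u).1.fn =ᵐ[volume.restrict V] fun x => u.1.fn (defMap μ x) :=
    fun u => (WZero.homeo μ hμ).pullback_fn hU.measurableSet h u.1
  have hgr : ∀ u : H10 U, (P u).1.grad =ᵐ[volume.restrict V]
      fun x => ContinuousLinearMap.adjoint (defDeriv μ x) (u.1.grad (defMap μ x)) :=
    fun u => WZero.pullback_grad μ hμ hU.measurableSet h u.1
  have hdata : ∀ χ : H1 Ω, (∀ᵐ x ∂volume.restrict (closure Dstar), χ.1.fn x = 0) →
      (χ.1.fn =ᵐ[volume.restrict V] fun x => χ.1.fn (defMap μ x)) ∧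
      (χ.1.grad =ᵐ[volume.restrict V]
        fun x => ContinuousLinearMap.adjoint (defDeriv μ x) (χ.1.grad (defMap μ x))) := by
    intro χ hχ
    have hsub := ae_mono (Measure.restrict_mono hVΩ (le_refl (volume : Measure (RN N))))
    exact ⟨((WZero.comp_defMap_ae_eq μ hΩ hD hμ hχ).filter_mono hsub).symm,
      EventuallyEq.symm ((WZero.adjoint_defDeriv_grad μ hΩ hΩb hD hμ χ hχ).filter_mono hsub)⟩
  obtain ⟨fφ, gφ⟩ := hdata φ hφ
  obtain ⟨fψ, gψ⟩ := hdata ψ hψ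
  have hT : ∀ t : H10 U × H10 U, transportedT a b A B μ V (P w.1, P w.2) (P t.1, P t.2) =
      weightedForm a b A B U (fun _ => ContinuousLinearMap.id ℝ (RN N)) (fun _ => 1)
        w.1.1.fn w.2.1.fn t.1.1.fn t.2.1.fn w.1.1.grad w.2.1.grad t.1.1.grad t.2.1.grad :=
    fun t => (weightedForm_comp_defMap a b A B μ hμ hV.measurableSet h (hfn _) (hfn _) (hfn _)
      (hfn _) (hgr _) (hgr _) (hgr _) (hgr _)).symm
  have hR : ∀ t : H10 U × H10 U, transportedRHS a b A B μ φ ψ V (P t.1, P t.2) =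
      - weightedForm a b A B U (fun _ => ContinuousLinearMap.id ℝ (RN N)) (fun _ => 1)
        φ.1.fn ψ.1.fn t.1.1.fn t.2.1.fn φ.1.grad ψ.1.grad t.1.1.grad t.2.1.grad := fun t => by
    rw [transportedRHS_eq_neg_weightedForm]
    exact congrArg Neg.neg (weightedForm_comp_defMap a b A B μ hμ hV.measurableSet h fφ fψ (hfn _)
      (hfn _) gφ gψ (hgr _) (hgr _)).symm
  rw [isWeakSolution_iff_weightedForm]
  constructor
  · intro hw t
    -- Every test pair on `V` is a pullback, so testing against pullbacks loses nothing.
    have ht : t = (P (P.symm t.1), P (P.symm t.2)) :=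
      Prod.ext (P.apply_symm_apply _).symm (P.apply_symm_apply _).symm
    rw [ht]
    exact ((hT (P.symm t.1, P.symm t.2)).trans (hw _)).trans (hR (P.symm t.1, P.symm t.2)).symm
  · exact fun hw t => ((hT t).symm.trans (hw _)).trans (hR t)

/-- Well-posedness is carried over from the deformed domain by the bijection `P`, so coercivity of
the transported form is not needed. -/
theorem existsUnique_transportedT (a b A B : ℝ) (hΩ : IsOpen Ω)
    (hΩb : Bornology.IsBounded Ω) (hD : closure Dstar ⊆ Ω) (μ : WZero Ω Dstar) (hμ : ‖μ‖ < 1)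
    (hcoef : AdmissibleCoeffs Ω a b A B)
    (φ ψ : H1 Ω) (hφ : ∀ᵐ x ∂volume.restrict (closure Dstar), φ.1.fn x = 0)
    (hψ : ∀ᵐ x ∂volume.restrict (closure Dstar), ψ.1.fn x = 0) (D₀ : Set (RN N)) :
    ∃! w : H10 (Ω \ closure D₀) × H10 (Ω \ closure D₀), ∀ t,
      transportedT a b A B μ (Ω \ closure D₀) w t
        = transportedRHS a b A B μ φ ψ (Ω \ closure D₀) t := by
  have hU : IsOpen (Ω \ closure (defMap μ '' D₀)) := hΩ.sdiff isClosed_closure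
  have hV : IsOpen (Ω \ closure D₀) := hΩ.sdiff isClosed_closure
  have hmem := WZero.mem_diff_iff μ hΩ hD hμ D₀
  obtain ⟨w, hw, hu⟩ := existsUnique_isWeakSolution (U := Ω \ closure (defMap μ '' D₀))
    sdiff_subset (hcoef.systemCoercive sdiff_subset) φ ψ
  set P := (WZero.homeo μ hμ).pullbackH10 hU hV hmem with hP
  have key := fun w => isWeakSolution_iff_transportedT a b A B hΩ hΩb hD μ hμ φ ψ hφ hψ hU hV
    sdiff_subset hmem w
  refine ⟨(P w.1, P w.2), (key w).1 hw, fun v hv => ?_⟩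
  have hv' := hu (P.symm v.1, P.symm v.2) ((key _).2 fun t => by
    rw [← hP]
    simpa only [Equiv.apply_symm_apply] using hv t)
  rw [← hv']
  simp only [Equiv.apply_symm_apply]

open Classical in
/-- The solution `(u₀, v₀)` of the transported system, as a function of the deformation. -/
noncomputable def transportedSolution (a b A B : ℝ) (φ ψ : H1 Ω) (U : Set (RN N))
    (μ : WZero Ω Dstar) : H10 U × H10 U :=
  if h : ∃ w, ∀ t, transportedT a b A B μ U w t = transportedRHS a b A B μ φ ψ U t then
    h.choose else 0

theorem eq_transportedSolution_iff (a b A B : ℝ) (φ ψ : H1 Ω) (U : Set (RN N))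
    (μ : WZero Ω Dstar)
    (h : ∃! w, ∀ t, transportedT a b A B μ U w t = transportedRHS a b A B μ φ ψ U t)
    (w : H10 U × H10 U) :
    (∀ t, transportedT a b A B μ U w t = transportedRHS a b A B μ φ ψ U t) ↔
      w = transportedSolution a b A B φ ψ U μ := by
  have hs : ∀ t, transportedT a b A B μ U (transportedSolution a b A B φ ψ U μ) t
      = transportedRHS a b A B μ φ ψ U t := by
    rw [transportedSolution, dif_pos h.exists]
    exact h.exists.choose_spec
  exact ⟨fun hw => h.unique hw hs, fun hw => hw ▸ hs⟩

/-- The Jacobian matrix `μ'` as a continuous linear function of `μ`. -/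
noncomputable def WZero.derivL (Ω Dstar : Set (RN N)) :
    WZero Ω Dstar →L[ℝ] Lp (RN N →L[ℝ] RN N) ⊤ (volume : Measure (RN N)) :=
  (ContinuousLinearMap.snd ℝ _ _).comp (WZero Ω Dstar).subtypeL

theorem AnalyticAt.comp_continuousLinearMap {X E F : Type*} [NormedAddCommGroup X]
    [NormedSpace ℝ X] [NormedAddCommGroup E] [NormedSpace ℝ E] [NormedAddCommGroup F]
    [NormedSpace ℝ F] (L : X →L[ℝ] E) {f : E → F} {x : X} (hf : AnalyticAt ℝ f (L x)) :
    AnalyticAt ℝ (fun y => f (L y)) x :=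
  hf.comp (L.analyticAt x)

/-- The coefficients see `μ` only through `μ'`, so the solution is built as a function of the
Jacobian field in `L^∞`. -/
theorem exists_analyticAt_transportedT (a b A B : ℝ) (hcoef : AdmissibleCoeffs Ω a b A B)
    (φ ψ : H1 Ω) {U : Set (RN N)} (hU : U ⊆ Ω) :
    ∃ G : Lp (RN N →L[ℝ] RN N) ⊤ (volume : Measure (RN N)) → H10 U × H10 U, AnalyticAt ℝ G 0 ∧
      ∀ᶠ A' in 𝓝 0, ∀ μ : WZero Ω Dstar, μ.1.2 = A' → ∀ t,
        transportedT a b A B μ U (G A') t = transportedRHS a b A B μ φ ψ U t := by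
  obtain ⟨G, hG, hev⟩ := SystemCoercive.exists_analyticAt
    (hcoef.systemCoercive hU) (φ.1.restrict hU).snd (ψ.1.restrict hU).snd
    (φ.1.restrict hU).fst (ψ.1.restrict hU).fst (analyticAt_stiffnessOp U)
    (analyticAt_detOp (F := ℝ) U 0) (stiffnessOp_zero U) (detOp_zero U)
  refine ⟨G, hG, ?_⟩
  filter_upwards [hev, eventually_stiffnessOp_ae_eq U, eventually_norm_lt_one _]
    with A' h1 h2 h3 μ hμ t
  subst hμ
  rw [transportedRHS_eq_neg_weightedForm]
  exact (systemForm_equation_iff a b A B hU h2 (detOp_abs_ae_eq U h3) φ.1 ψ.1 (G μ.1.2).1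
    (G μ.1.2).2 t.1 t.2).1 (h1 t)

/-- Near `0` the analytic family from `exists_analyticAt_transportedT`, composed with the linear map
`μ ↦ μ'`, solves the transported system, so uniqueness makes it the solution map. -/
theorem analyticAt_transportedSolution (a b A B : ℝ) (hΩ : IsOpen Ω)
    (hΩb : Bornology.IsBounded Ω) (hD : closure Dstar ⊆ Ω)
    (hcoef : AdmissibleCoeffs Ω a b A B)
    (φ ψ : H1 Ω) (hφ : ∀ᵐ x ∂volume.restrict (closure Dstar), φ.1.fn x = 0)
    (hψ : ∀ᵐ x ∂volume.restrict (closure Dstar), ψ.1.fn x = 0) (D₀ : Set (RN N)) :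
    AnalyticAt ℝ (transportedSolution (Dstar := Dstar) a b A B φ ψ (Ω \ closure D₀)) 0 := by
  obtain ⟨G, hG, hev⟩ := exists_analyticAt_transportedT (Dstar := Dstar) a b A B hcoef φ ψ
    (U := Ω \ closure D₀) sdiff_subset
  have h0 : WZero.derivL Ω Dstar 0 = 0 := map_zero _
  rw [← h0] at hG hev
  refine (AnalyticAt.comp_continuousLinearMap (WZero.derivL Ω Dstar) hG).congr ?_
  filter_upwards [(WZero.derivL Ω Dstar).continuous.continuousAt.eventually hev,
    eventually_norm_lt_one (WZero Ω Dstar)] with μ h1 h2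
  exact (eq_transportedSolution_iff a b A B φ ψ _ μ
    (existsUnique_transportedT a b A B hΩ hΩb hD μ h2 hcoef φ ψ hφ hψ D₀) _).1 (h1 μ rfl)

end Transport

/-! ### The main theorem. -/

theorem mainTheorem6 {N : ℕ} (hN : 1 ≤ N)
    (Ω Dstar D₀ : Set (RN N))
    (hΩ : IsOpen Ω) (hΩc : IsConnected Ω) (hΩb : Bornology.IsBounded Ω)
    (hDs : IsOpen Dstar) (hDsn : Dstar.Nonempty) (hDsΩ : closure Dstar ⊆ Ω)
    (hD₀ : IsOpen D₀) (hD₀s : closure D₀ ⊆ Dstar)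
    (a b A B : ℝ) (hcoef : AdmissibleCoeffs Ω a b A B)
    (φ₁ ψ₁ : H1 Ω)
    (hφ₁ : ∀ᵐ x ∂volume.restrict (closure Dstar), φ₁.1.fn x = 0)
    (hψ₁ : ∀ᵐ x ∂volume.restrict (closure Dstar), ψ₁.1.fn x = 0)
    (ε : ℝ) (hε₀ : 0 < ε) (hε₁ : ε < 1) :
    (∀ μ ∈ WEps Ω Dstar ε,
      (∃! w₁ : H10 (Ω \ closure (defMap μ '' D₀)) × H10 (Ω \ closure (defMap μ '' D₀)),
        IsWeakSolution a b A B φ₁ ψ₁ (Ω \ closure (defMap μ '' D₀)) w₁) ∧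
      ((fun x => φ₁.1.fn (defMap μ x)) =ᵐ[volume.restrict Ω] φ₁.1.fn) ∧
      ((fun x => ψ₁.1.fn (defMap μ x)) =ᵐ[volume.restrict Ω] ψ₁.1.fn)) ∧
    ∃ S : WZero Ω Dstar → H10 (Ω \ closure D₀) × H10 (Ω \ closure D₀),
      (∀ μ ∈ WEps Ω Dstar ε,
        (∀ w₁ : H10 (Ω \ closure (defMap μ '' D₀)) × H10 (Ω \ closure (defMap μ '' D₀)),
          IsWeakSolution a b A B φ₁ ψ₁ (Ω \ closure (defMap μ '' D₀)) w₁ →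
            IsTransport μ w₁ (S μ)) ∧
        (∀ w₀ : H10 (Ω \ closure D₀) × H10 (Ω \ closure D₀),
          (∀ t, transportedT a b A B μ (Ω \ closure D₀) w₀ t
            = transportedRHS a b A B μ φ₁ ψ₁ (Ω \ closure D₀) t) ↔ w₀ = S μ)) ∧
      ∃ r : ℝ, 0 < r ∧ r ≤ ε ∧ AnalyticOnNhd ℝ S (Metric.ball 0 r) := by
  have hlt : ∀ μ ∈ WEps Ω Dstar ε, ‖μ‖ < 1 := fun μ hμ => lt_of_le_of_lt hμ hε₁
  have hS : ∀ μ ∈ WEps Ω Dstar ε, ∀ w₀ : H10 (Ω \ closure D₀) × H10 (Ω \ closure D₀),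
      (∀ t, transportedT a b A B μ (Ω \ closure D₀) w₀ t
        = transportedRHS a b A B μ φ₁ ψ₁ (Ω \ closure D₀) t) ↔
      w₀ = transportedSolution a b A B φ₁ ψ₁ (Ω \ closure D₀) μ := fun μ hμ =>
    eq_transportedSolution_iff a b A B φ₁ ψ₁ _ μ
      (existsUnique_transportedT a b A B hΩ hΩb hDsΩ μ (hlt μ hμ) hcoef φ₁ ψ₁ hφ₁ hψ₁ D₀)
  refine ⟨fun μ hμ => ⟨existsUnique_isWeakSolution Set.sdiff_subset
    (hcoef.systemCoercive Set.sdiff_subset) φ₁ ψ₁,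
    WZero.comp_defMap_ae_eq μ hΩ hDsΩ (hlt μ hμ) hφ₁,
    WZero.comp_defMap_ae_eq μ hΩ hDsΩ (hlt μ hμ) hψ₁⟩,
    transportedSolution a b A B φ₁ ψ₁ (Ω \ closure D₀), fun μ hμ => ⟨fun w hw => ?_, hS μ hμ⟩, ?_⟩
  · have hU : IsOpen (Ω \ closure (defMap μ '' D₀)) := hΩ.sdiff isClosed_closure
    have hV : IsOpen (Ω \ closure D₀) := hΩ.sdiff isClosed_closure
    have hmem := WZero.mem_diff_iff μ hΩ hDsΩ (hlt μ hμ) D₀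
    rw [← (hS μ hμ _).1 ((isWeakSolution_iff_transportedT a b A B hΩ hΩb hDsΩ μ (hlt μ hμ) φ₁ ψ₁
      hφ₁ hψ₁ hU hV Set.sdiff_subset hmem w).1 hw)]
    exact ⟨(WZero.homeo μ (hlt μ hμ)).pullback_fn hU.measurableSet hmem w.1.1,
      (WZero.homeo μ (hlt μ hμ)).pullback_fn hU.measurableSet hmem w.2.1⟩
  · have han := analyticAt_transportedSolution a b A B hΩ hΩb hDsΩ hcoef φ₁ ψ₁ hφ₁ hψ₁ D₀
    -- Analyticity at the origin propagates to a whole ball, since the set of points of analyticity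
    -- is open.
    obtain ⟨r, hr, hball⟩ := Metric.eventually_nhds_iff_ball.1 han.eventually_analyticAt
    exact ⟨min r ε, lt_min hr hε₀, min_le_right _ _,
      fun μ hμ => hball μ (Metric.ball_subset_ball (min_le_left _ _) hμ)⟩
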